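/- **Setting.** Let $\mathcal X\subset\mathbb R^d$ be compact and non-empty, and let $f\sim\mathcal{GP}(m,k)$ be a Gaussian process on $\mathcal X$ with continuous sample paths and $k(x,x')\le 1$ for all $x,x'$. Let $\mathcal A$ be a set of queries, let $p(\cdot\mid a)$, $a\in\mathcal A$, be a conditional distribution (Markov kernel) on $\mathcal X$, and put $$g(a)=\int f(x)\,p(dx\mid a),\qquad \nu(a)=\int m(x)\,p(dx\mid a),\qquad q(a,a')=\iint k(x,x')\,p(dx\mid a)\,p(dx'\mid a').$$ Assume $q(a,a)>0$ for all $a$. Querying $a_t$ returns $z_t=g(a_t)+\epsilon_t$, where $\epsilon_1,\epsilon_2,\dots$ are i.i.d. $N(0,\sigma^2)$, $\sigma>0$. With $\mathbf a_t=(a_1,\dots,a_t)$, $\mathbf z_t=(z_1,\dots,z_t)$ and $Q_t=(q(a_i,a_j))_{i,j\le t}$, the posterior mean and variance of $g(a)$ are $$\nu_t(a)=\nu(a)+q(a,\mathbf a_t)(Q_t+\sigma^2I)^{-1}(\mathbf z_t-\nu(\mathbf a_t)),\qquad \sigma_t^g(a)^2=q(a,a)-q(a,\mathbf a_t)(Q_t+\sigma^2I)^{-1}q(\mathbf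 a_t,a).$$ Let $f_*=\max_{x\in\mathcal X}f(x)$ and let $F$ be its distribution function under the prior. Let $f_*^1,f_*^2,\dots$ be i.i.d. draws from $F$; $f$, the noise and the draws are independent. For $t\ge1$ let $\gamma_t(a)=(f_*^t-\nu_{t-1}(a))/\sigma^g_{t-1}(a)$. Suppose that each $a_t$ is computed (measurably) from $z_1,\dots,z_{t-1}$ and $f_*^1,\dots,f_*^t$, and that almost surely, for every $t$, it satisfies the single-sample CMES criterion $$a_t\in\arg\max_{a\in\mathcal A}\ \frac{\gamma_t(a)\,\psi(\gamma_t(a))}{2\Psi(\gamma_t(a))}-\log\Psi(\gamma_t(a)),$$ where $\psi,\Psi$ are the standard normal density and distribution function. Let $\kappa_t=\min_{a\in\mathcal A}\gamma_t(a)$. Let $\rho_T=\sup_{b_1,\dots,b_T\in\mathcal A} I\big((g(b_i)+\epsilon_i)_{i\le T};f\big)$ be the maximum information gain (mutual information between $T$ noisy integrated feedbacks, repeated queries allowed, and $f$). Let $T\ge1$, $\delta\in(0,1)$, and $\pi_1,\dots,\pi_T>0$ with $\sum_{i=1}^T\pi_i^{-1}\le1$. Put $C=2/\log(1+\sigma^{-2})$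 and $\zeta_T=\sqrt{2\log(\pi_T/\delta)}$. **Theorem.** Let $w\in(0,1)$ be a constant and let $T'=\sum_{i=1}^T\big\lceil\log_w\frac{\delta}{2\pi_i}\big\rceil$. With probability at least $1-\delta$ the following holds: if $F(f_*)\le w$ (in particular if $F(f_*)=w$), then some $t\le T'$ has $f_*^t>f_*$, and the instant regret after $T'$ iterations satisfies $$f_*-\max_{t\le T'}g(a_t)\ \le\ \sqrt{\frac{C\rho_T}{T}}\,\big(\kappa_{t^*}+\zeta_T\big),$$ where $t^*$ maximizes $\kappa_t$ among the $t\le T'$ with $f_*^t>f_*$. -/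

import Mathlib

open MeasureTheory ProbabilityTheory
open scoped ENNReal NNReal Matrix

namespace CMES

noncomputable section

/-- `f` is a Gaussian process with mean function `m` and covariance function `k`, all of whose
sample paths are continuous. -/
structure IsContinuousGP {𝒳 Ω : Type*} [TopologicalSpace 𝒳] [MeasurableSpace Ω]
    (f : 𝒳 → Ω → ℝ) (m : 𝒳 → ℝ) (k : 𝒳 → 𝒳 → ℝ) (P : Measure Ω) : Prop where
  measurable : ∀ x, Measurable (f x)
  gaussian : IsGaussianProcess f P
  mean : ∀ x, ∫ ω, f x ω ∂P = m x
  cov : ∀ x y, covariance (f x) (f y) P = k x y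
  continuous_path : ∀ ω, Continuous fun x => f x ω

/-- The maximum `f_*` of a sample path. -/
def pathMax {𝒳 Ω : Type*} (f : 𝒳 → Ω → ℝ) (ω : Ω) : ℝ := ⨆ x, f x ω

section Integrated

variable {𝒳 𝒜 : Type*} [MeasurableSpace 𝒳] [MeasurableSpace 𝒜]

/-- The conditional expectation `∫ φ(x) p(dx | a)` of a function `φ` on `𝒳`. For `φ = f` this is
the integrated function `g`, for `φ = m` it is the prior mean `ν` of `g`. -/
def integrated (p : Kernel 𝒜 𝒳) (φ : 𝒳 → ℝ) (a : 𝒜) : ℝ := ∫ x, φ x ∂(p a)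

/-- The prior covariance `q(a, a') = ∫∫ k(x, x') p(dx | a) p(dx' | a')` of `g`. -/
def integratedCov (p : Kernel 𝒜 𝒳) (k : 𝒳 → 𝒳 → ℝ) (a a' : 𝒜) : ℝ :=
  ∫ x, ∫ x', k x x' ∂(p a') ∂(p a)

end Integrated

section Posterior

variable {𝒜 : Type*}

/-- The matrix `Q + σ² I` at the queries `A`. -/
def noisyGram (q : 𝒜 → 𝒜 → ℝ) (σ : ℝ) {t : ℕ} (A : Fin t → 𝒜) : Matrix (Fin t) (Fin t) ℝ :=
  Matrix.of (fun i j => q (A i) (A j)) + σ ^ 2 • (1 : Matrix (Fin t) (Fin t) ℝ)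

/-- Posterior mean of `g(a)` when the noisy feedback `z` has been observed at the queries `A`. -/
def postMean (ν : 𝒜 → ℝ) (q : 𝒜 → 𝒜 → ℝ) (σ : ℝ) {t : ℕ} (A : Fin t → 𝒜) (z : Fin t → ℝ)
    (a : 𝒜) : ℝ :=
  ν a + (fun i => q a (A i)) ⬝ᵥ ((noisyGram q σ A)⁻¹ *ᵥ fun i => z i - ν (A i))

/-- Posterior covariance of `g(a)` and `g(a')` after noisy feedback at the queries `A`. -/
def postCov (q : 𝒜 → 𝒜 → ℝ) (σ : ℝ) {t : ℕ} (A : Fin t → 𝒜) (a a' : 𝒜) : ℝ :=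
  q a a' - (fun i => q a (A i)) ⬝ᵥ ((noisyGram q σ A)⁻¹ *ᵥ fun i => q (A i) a')

/-- Posterior standard deviation of `g(a)`. -/
def postStd (q : 𝒜 → 𝒜 → ℝ) (σ : ℝ) {t : ℕ} (A : Fin t → 𝒜) (a : 𝒜) : ℝ :=
  Real.sqrt (postCov q σ A a a)

/-- `γ_y(a) = (y - posterior mean of g(a)) / posterior standard deviation of g(a)`. -/
def gammaScore (ν : 𝒜 → ℝ) (q : 𝒜 → 𝒜 → ℝ) (σ : ℝ) {t : ℕ} (A : Fin t → 𝒜) (z : Fin t → ℝ)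
    (y : ℝ) (a : 𝒜) : ℝ :=
  (y - postMean ν q σ A z a) / postStd q σ A a

end Posterior

/-- The single-sample criterion `γ ψ(γ) / (2 Ψ(γ)) - log Ψ(γ)` as a function of `γ`, where `ψ`
and `Ψ` are the density and the distribution function of the standard normal law. -/
def criterion (γ : ℝ) : ℝ :=
  γ * gaussianPDFReal 0 1 γ / (2 * cdf (gaussianReal 0 1) γ)
    - Real.log (cdf (gaussianReal 0 1) γ)

/-- Mutual information of two random variables: the Kullback-Leibler divergence of the joint law
from the product of the marginal laws. -/
def mutualInfo {Ω E F : Type*} [MeasurableSpace Ω] [MeasurableSpace E] [MeasurableSpace F]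
    (P : Measure Ω) (U : Ω → E) (V : Ω → F) : ℝ≥0∞ :=
  InformationTheory.klDiv (P.map fun ω => (U ω, V ω)) ((P.map U).prod (P.map V))

/-- The maximum information gain `ρ_T`: the supremum, over all choices of `T` queries (repetitions
allowed), of the mutual information of the `T` noisy feedbacks and `f`. -/
def maxInfoGain {𝒳 𝒜 Ω : Type*} [MeasurableSpace 𝒳] [MeasurableSpace 𝒜] [MeasurableSpace Ω]
    (P : Measure Ω) (p : Kernel 𝒜 𝒳) (f : 𝒳 → Ω → ℝ) (ε : ℕ → Ω → ℝ) (T : ℕ) : ℝ≥0∞ :=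
  ⨆ A : Fin T → 𝒜,
    mutualInfo P (fun ω (i : Fin T) => integrated p (fun x => f x ω) (A i) + ε i ω)
      (fun ω x => f x ω)

/-- The number of iterations `T' = ∑_{i=1}^T k_i`, where `k_i` is `log_w (δ / (2 π_i))` rounded
up to an integer. -/
def numIterations (w δ : ℝ) (π : ℕ → ℝ) (T : ℕ) : ℕ :=
  ∑ i ∈ Finset.Icc 1 T, ⌈Real.logb w (δ / (2 * π i))⌉₊

/-- The instant regret after the queries `a 0, …, a (N - 1)`, for the function `φ`. -/
def instantRegret {𝒳 𝒜 : Type*} [MeasurableSpace 𝒳] [MeasurableSpace 𝒜] (p : Kernel 𝒜 𝒳)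
    (φ : 𝒳 → ℝ) (a : ℕ → 𝒜) (N : ℕ) : ℝ :=
  (⨆ x, φ x) - ⨆ t : Fin N, integrated p φ (a t)

/-- `κ = min_a γ_y(a)`, for the posterior given the feedbacks `z 0, …, z (t - 1)` at the queries
`a 0, …, a (t - 1)`. -/
def kappa {𝒜 : Type*} (ν : 𝒜 → ℝ) (q : 𝒜 → 𝒜 → ℝ) (σ : ℝ) (a : ℕ → 𝒜) (z : ℕ → ℝ) (y : ℝ)
    (t : ℕ) : ℝ :=
  ⨅ b, gammaScore ν q σ (fun i : Fin t => a i) (fun i : Fin t => z i) y b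

end

end CMES

/-!
The proof rests on one confidence bound, used at a single random iteration, and on one count of the
iterations whose sample exceeds `f_*`.

The event that `f_*^t > f_*` involves the unknown function, so the confidence bound cannot be
applied directly to iterations selected by it. The samples `f_*^1, f_*^2, …` are however independent
of the path and of the noise together, so all of them, future ones included, may be treated as side
information known in advance. Call an iteration `t < T'` *top-ranked* if fewer than `T` of the `T'`
samples exceed `f_*^t` (`topRanked`). This depends on the samples alone, and

* if `T ≤ T'`, at least `T` iterations are top-ranked (`le_card_topRanked`);
* if at least `T` of the samples exceed `f_*`, then the samples of all top-ranked iterations do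
  (`lt_of_mem_topRanked`).

The event that `F(f_*) ≤ w` and that a block of `⌈log_w (δ / (2 π_i))⌉` samples contains none above
`f_*` has probability at most `δ / (2 π_i)`. Therefore, where `F(f_*) ≤ w`, at least `T` samples
exceed `f_*`, up to an event of probability `δ / 2` (`measure_card_exceeding_lt_le`).

Among any `T` iterations, consecutive or not, one has a posterior variance of at most `C ρ_T / T`
(`NoisyModel.exists_postStd_le`): the information gain at fixed queries is `∑ ½ log (1 + σ⁻² v_j)`
with the successive posterior variances `v_j` (`NoisyModel.mutualInfo_eq`), and dropping feedbacks
only increases the posterior variances (`postCov_le_postCov_comp`). Let `τ` be the first top-ranked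
iteration with such a variance. Whether `τ = t` is decided by the feedbacks before `t` and the
samples, so the lower confidence bound `g(a_τ) ≥ ν_τ(a_τ) - ζ σ_τ(a_τ)` fails with probability at
most `exp (-ζ² / 2) / 2 ≤ δ / 2`; the events `τ = t` are disjoint, and no union bound over the
iterations is needed (`NoisyModel.measure_first_below_confidence_le`).

Outside these two events, `f_* - g(a_τ) ≤ f_*^τ - ν_τ(a_τ) + ζ σ_τ(a_τ) = (κ_τ + ζ) σ_τ(a_τ)`: the
criterion is strictly decreasing in the score (`strictAnti_criterion`), so the query attains `κ_τ`.
The factor `κ_τ + ζ` is nonnegative and at most `κ_{t^*} + ζ`.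

The fixed-path computations are done in a `NoisyModel`, where `g` is a Gaussian process that is a
jointly measurable function of the query and the path. For adaptive queries, Bayes' rule is needed
at every value of the feedbacks (`NoisyModel.map_residual_withDensity`), not only at almost every
one, since the queries depend on that value.
-/

set_option linter.unusedSectionVars false

namespace CMES

open Filter Topology

/-! ### Gaussian estimates and the criterion -/

lemma gaussianReal_Iio_zero_le (v : ℝ≥0) : gaussianReal 0 v (Set.Iio 0) ≤ 1 / 2 := by
  have h1 : gaussianReal 0 v (Set.Iio 0) = gaussianReal 0 v (Set.Ioi 0) := by
    conv_lhs => rw [← neg_zero, ← gaussianReal_map_neg (μ := 0) (v := v)]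
    rw [Measure.map_apply measurable_neg measurableSet_Iio]
    congr 1
    ext x
    simp
  have h2 : gaussianReal 0 v (Set.Iio 0) + gaussianReal 0 v (Set.Ioi 0) ≤ 1 := by
    rw [← measure_union _ measurableSet_Ioi]
    · exact prob_le_one
    · exact Set.disjoint_left.2 fun x hx hx' => lt_asymm (Set.mem_Iio.1 hx) (Set.mem_Ioi.1 hx')
  rw [← h1, ← two_mul] at h2
  rw [ENNReal.le_div_iff_mul_le (by simp) (by simp), mul_comm]
  exact h2

/-- The Gaussian tail bound with the factor `1 / 2`, obtained by shifting the mean to `ζ √v`. -/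
lemma gaussianReal_tail_le {v : ℝ≥0} (hv : v ≠ 0) {ζ : ℝ} (hζ : 0 ≤ ζ) :
    gaussianReal 0 v (Set.Iio (-(ζ * Real.sqrt v)))
      ≤ ENNReal.ofReal (Real.exp (-ζ ^ 2 / 2) / 2) := by
  set a : ℝ := ζ * Real.sqrt v with ha
  have hv0 : (0 : ℝ) < v := by positivity
  have ha0 : 0 ≤ a := by positivity
  have ha2 : a ^ 2 = ζ ^ 2 * v := by rw [ha, mul_pow, Real.sq_sqrt hv0.le]
  have h1 : gaussianReal 0 v (Set.Iio (-a)) = gaussianReal a v (Set.Iio 0) := by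
    have := gaussianReal_map_add_const (μ := 0) (v := v) a
    rw [zero_add] at this
    rw [← this, Measure.map_apply (measurable_add_const a) measurableSet_Iio]
    congr 1
    ext x
    simp only [Set.mem_Iio, Set.mem_preimage]
    constructor <;> intro h <;> linarith
  have h2 : gaussianReal a v (Set.Iio 0)
      ≤ ENNReal.ofReal (Real.exp (-ζ ^ 2 / 2)) * gaussianReal 0 v (Set.Iio 0) := by
    rw [gaussianReal_apply _ hv, gaussianReal_apply _ hv,
      ← lintegral_const_mul _ (measurable_gaussianPDF 0 v)]
    refine setLIntegral_mono (by fun_prop) fun x hx => ?_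
    rw [gaussianPDF, gaussianPDF, ← ENNReal.ofReal_mul (Real.exp_nonneg _)]
    apply ENNReal.ofReal_le_ofReal
    rw [gaussianPDFReal, gaussianPDFReal, mul_left_comm, ← Real.exp_add]
    gcongr
    have hx' : x < 0 := hx
    rw [div_add_div _ _ (by norm_num) (by positivity),
      div_le_div_iff₀ (by positivity) (by positivity)]
    have : 0 ≤ -(a * x) := by nlinarith
    have e1 : -(x - a) ^ 2 = -(x ^ 2) + 2 * (a * x) - ζ ^ 2 * v := by rw [← ha2]; ring
    rw [e1]
    nlinarith [mul_nonneg this hv0.le]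
  rw [h1]
  refine h2.trans ?_
  rw [div_eq_mul_one_div (Real.exp _), ENNReal.ofReal_mul (Real.exp_nonneg _)]
  gcongr
  refine (gaussianReal_Iio_zero_le v).trans ?_
  rw [ENNReal.ofReal_div_of_pos (by norm_num)]
  simp

/-- On `[0, 1]`, the concave function `x ↦ log (1 + c x)` lies above its chord. -/
lemma le_div_log_mul_log {c x : ℝ} (hc : 0 < c) (hx0 : 0 ≤ x) (hx1 : x ≤ 1) :
    x ≤ Real.log (1 + c * x) / Real.log (1 + c) := by
  have hlog : 0 < Real.log (1 + c) := Real.log_pos (by linarith)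
  rw [le_div_iff₀ hlog]
  have h := strictConcaveOn_log_Ioi.concaveOn.2 (show (1 : ℝ) ∈ Set.Ioi 0 by simp)
    (show (1 + c : ℝ) ∈ Set.Ioi 0 by simp; linarith) (sub_nonneg.2 hx1) hx0 (by ring)
  simp only [smul_eq_mul, Real.log_one, mul_zero, zero_add] at h
  have e : (1 - x) * 1 + x * (1 + c) = 1 + c * x := by ring
  rwa [e] at h

lemma gaussianPDFReal_zero_one (x : ℝ) :
    gaussianPDFReal 0 1 x = (Real.sqrt (2 * Real.pi))⁻¹ * Real.exp (-x ^ 2 / 2) := by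
  simp [gaussianPDFReal]

lemma continuous_gaussianPDFReal_zero_one : Continuous (gaussianPDFReal 0 1) := by
  rw [show gaussianPDFReal 0 1 = fun x =>
    (Real.sqrt (2 * Real.pi))⁻¹ * Real.exp (-x ^ 2 / 2) from funext gaussianPDFReal_zero_one]
  fun_prop

lemma hasDerivAt_gaussianPDFReal_zero_one (x : ℝ) :
    HasDerivAt (gaussianPDFReal 0 1) (-x * gaussianPDFReal 0 1 x) x := by
  have h : HasDerivAt (fun x : ℝ => (Real.sqrt (2 * Real.pi))⁻¹ * Real.exp (-x ^ 2 / 2))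
      ((Real.sqrt (2 * Real.pi))⁻¹ * (Real.exp (-x ^ 2 / 2) * (-(2 * x) / 2))) x := by
    apply HasDerivAt.const_mul
    apply HasDerivAt.exp
    simpa using ((hasDerivAt_pow 2 x).neg.div_const 2)
  rw [show gaussianPDFReal 0 1 = fun x =>
    (Real.sqrt (2 * Real.pi))⁻¹ * Real.exp (-x ^ 2 / 2) from funext gaussianPDFReal_zero_one]
  convert h using 1
  ring

lemma hasDerivAt_cdf_gaussianReal (x : ℝ) :
    HasDerivAt (cdf (gaussianReal 0 1)) (gaussianPDFReal 0 1 x) x := by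
  have hint := integrable_gaussianPDFReal 0 1
  have h1 : ∀ y, cdf (gaussianReal 0 1) y = ∫ t in Set.Iic y, gaussianPDFReal 0 1 t := by
    intro y
    rw [cdf_eq_real, measureReal_def, gaussianReal_apply_eq_integral 0 one_ne_zero,
      ENNReal.toReal_ofReal]
    exact integral_nonneg fun t => gaussianPDFReal_nonneg _ _ _
  have h2 : ∀ y, cdf (gaussianReal 0 1) y
      = cdf (gaussianReal 0 1) 0 + ∫ t in (0 : ℝ)..y, gaussianPDFReal 0 1 t := by
    intro y
    rw [h1, h1, ← intervalIntegral.integral_Iic_sub_Iic hint.integrableOn hint.integrableOn]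
    ring
  rw [show (cdf (gaussianReal 0 1) : ℝ → ℝ) = _ from funext h2]
  apply HasDerivAt.const_add
  exact intervalIntegral.integral_hasDerivAt_right hint.intervalIntegrable
    (continuous_gaussianPDFReal_zero_one.stronglyMeasurableAtFilter _ _)
    continuous_gaussianPDFReal_zero_one.continuousAt

lemma cdf_gaussianReal_pos (x : ℝ) : 0 < cdf (gaussianReal 0 1) x := by
  rw [cdf_eq_real, measureReal_def, ENNReal.toReal_pos_iff]
  refine ⟨?_, measure_lt_top _ _⟩
  rw [pos_iff_ne_zero]
  intro h
  have := gaussianReal_absolutelyContinuous' 0 one_ne_zero h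
  simp at this

lemma tendsto_pow_mul_gaussianPDFReal_atBot (n : ℕ) :
    Tendsto (fun z : ℝ => z ^ n * gaussianPDFReal 0 1 z) atBot (𝓝 0) := by
  have hb : Tendsto (fun z : ℝ => |z| ^ (n : ℝ) * Real.exp (-(1 / 2) * |z| ^ 2)) atBot (𝓝 0) := by
    have := (rpow_mul_exp_neg_mul_sq_isLittleO_exp_neg (b := 1 / 2) (by norm_num) (n : ℝ))
    have h2 : Tendsto (fun x : ℝ => Real.exp (-(1 / 2) * x)) atTop (𝓝 0) := by
      apply Real.tendsto_exp_atBot.comp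
      exact tendsto_id.const_mul_atTop_of_neg (by norm_num)
    exact (this.trans_tendsto h2).comp tendsto_abs_atBot_atTop
  have hc := hb.const_mul (Real.sqrt (2 * Real.pi))⁻¹
  rw [mul_zero] at hc
  refine squeeze_zero_norm (fun z => le_of_eq ?_) hc
  rw [gaussianPDFReal_zero_one, Real.norm_eq_abs, abs_mul, abs_pow, abs_mul, Real.abs_exp,
    Real.rpow_natCast, abs_of_nonneg (by positivity : 0 ≤ (Real.sqrt (2 * Real.pi))⁻¹), sq_abs,
    mul_left_comm]
  congr 3
  ring

/-- The quantity is `E[(γ - Z)² 1_{Z < γ}]` for a standard normal `Z`. -/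
lemma one_add_sq_mul_cdf_add_pos (γ : ℝ) :
    0 < (1 + γ ^ 2) * cdf (gaussianReal 0 1) γ + γ * gaussianPDFReal 0 1 γ := by
  -- `H z = E[(γ - Z)² 1_{Z ≤ z}]`, with the moments of the truncated normal law inserted
  set H : ℝ → ℝ := fun z => (1 + γ ^ 2) * cdf (gaussianReal 0 1) z
    + 2 * γ * gaussianPDFReal 0 1 z - z * gaussianPDFReal 0 1 z with hH
  have hd : ∀ z, HasDerivAt H ((γ - z) ^ 2 * gaussianPDFReal 0 1 z) z := by
    intro z
    have := (((hasDerivAt_cdf_gaussianReal z).const_mul (1 + γ ^ 2)).add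
      ((hasDerivAt_gaussianPDFReal_zero_one z).const_mul (2 * γ))).sub
      ((hasDerivAt_id z).mul (hasDerivAt_gaussianPDFReal_zero_one z))
    refine HasDerivAt.congr_deriv (f := H) this ?_
    simp only [id]
    ring
  have hlim : Tendsto H atBot (𝓝 0) := by
    have h0 := tendsto_pow_mul_gaussianPDFReal_atBot 0
    have h1 := tendsto_pow_mul_gaussianPDFReal_atBot 1
    simp only [pow_zero, one_mul, pow_one] at h0 h1
    have := (((tendsto_cdf_atBot (gaussianReal 0 1)).const_mul (1 + γ ^ 2)).add
      (h0.const_mul (2 * γ))).sub h1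
    simpa using this
  have hmono : Monotone H := monotone_of_hasDerivAt_nonneg hd
    fun z => mul_nonneg (sq_nonneg _) (gaussianPDFReal_nonneg _ _ _)
  have hnn : ∀ z, 0 ≤ H z := fun z => hmono.le_of_tendsto hlim z
  have hlt : H (γ - 1) < H γ := by
    have hs : StrictMonoOn H (Set.Iic γ) := by
      apply strictMonoOn_of_deriv_pos (convex_Iic γ)
      · exact fun z _ => (hd z).continuousAt.continuousWithinAt
      · intro z hz
        rw [interior_Iic] at hz
        rw [(hd z).deriv]
        have : 0 < γ - z := sub_pos.2 hz
        have := gaussianPDFReal_pos 0 1 z one_ne_zero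
        positivity
    exact hs (by simp) (by simp) (by linarith)
  have := (hnn (γ - 1)).trans_lt hlt
  simp only [hH] at this
  linarith

/-- The criterion is a strictly decreasing function of the score `γ`, so maximizing it amounts to
minimizing `γ`. -/
lemma strictAnti_criterion : StrictAnti criterion := by
  have hd : ∀ x, HasDerivAt criterion
      (((gaussianPDFReal 0 1 x + x * (-x * gaussianPDFReal 0 1 x)) * (2 * cdf (gaussianReal 0 1) x)
        - x * gaussianPDFReal 0 1 x * (2 * gaussianPDFReal 0 1 x))
          / (2 * cdf (gaussianReal 0 1) x) ^ 2
        - gaussianPDFReal 0 1 x / cdf (gaussianReal 0 1) x) x := by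
    intro x
    have hp := cdf_gaussianReal_pos x
    have := (((hasDerivAt_id x).mul (hasDerivAt_gaussianPDFReal_zero_one x)).div
      ((hasDerivAt_cdf_gaussianReal x).const_mul 2) (by positivity)).sub
      ((hasDerivAt_cdf_gaussianReal x).log hp.ne')
    refine HasDerivAt.congr_deriv (f := criterion) this ?_
    simp
  apply strictAnti_of_hasDerivAt_neg hd
  intro x
  have hp := cdf_gaussianReal_pos x
  have hφ := gaussianPDFReal_pos 0 1 x one_ne_zero
  have key := one_add_sq_mul_cdf_add_pos x
  set p := cdf (gaussianReal 0 1) x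
  set φ := gaussianPDFReal 0 1 x
  have : ((φ + x * (-x * φ)) * (2 * p) - x * φ * (2 * φ)) / (2 * p) ^ 2 - φ / p
      = -(φ * ((1 + x ^ 2) * p + x * φ)) / (2 * p ^ 2) := by
    field_simp
    ring
  rw [this]
  exact div_neg_of_neg_of_pos (neg_neg_of_pos (mul_pos hφ key)) (by positivity)

/-! ### Posterior mean and variance -/

section PosteriorAlgebra

variable {𝒜 : Type*}

/-- `q` is a covariance function: symmetric and positive semidefinite. -/
structure IsCovKernel (q : 𝒜 → 𝒜 → ℝ) : Prop where
  symm : ∀ a b, q a b = q b a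
  nonneg : ∀ (n : ℕ) (A : Fin n → 𝒜) (c : Fin n → ℝ), 0 ≤ ∑ i, ∑ j, c i * q (A i) (A j) * c j

lemma dotProduct_mulVec_eq_sum {n : ℕ} (K : Matrix (Fin n) (Fin n) ℝ) (c : Fin n → ℝ) :
    c ⬝ᵥ (K *ᵥ c) = ∑ i, ∑ j, c i * K i j * c j := by
  simp only [dotProduct, Matrix.mulVec, Finset.mul_sum, mul_assoc]

lemma IsCovKernel.posDef_noisyGram {q : 𝒜 → 𝒜 → ℝ} (hq : IsCovKernel q) {σ : ℝ} (hσ : 0 < σ)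
    {n : ℕ} (A : Fin n → 𝒜) : (noisyGram q σ A).PosDef := by
  have h1 : (Matrix.of fun i j => q (A i) (A j)).PosSemidef := by
    refine Matrix.PosSemidef.of_dotProduct_mulVec_nonneg ?_ ?_
    · ext i j
      simp [hq.symm (A i) (A j)]
    · intro c
      rw [star_trivial, dotProduct_mulVec_eq_sum]
      exact hq.nonneg n A c
  have h2 : (σ ^ 2 • (1 : Matrix (Fin n) (Fin n) ℝ)).PosDef :=
    Matrix.PosDef.smul Matrix.PosDef.one (by positivity)
  exact h2.posSemidef_add h1

lemma IsCovKernel.noisyGram_isUnit_det {q : 𝒜 → 𝒜 → ℝ} (hq : IsCovKernel q) {σ : ℝ} (hσ : 0 < σ)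
    {n : ℕ} (A : Fin n → 𝒜) : IsUnit (noisyGram q σ A).det :=
  (hq.posDef_noisyGram hσ A).det_pos.ne'.isUnit

/-- The mean squared error of the linear predictor of `g(b)` with weights `c` on the noisy
feedbacks at the queries `A`. -/
def predVar (q : 𝒜 → 𝒜 → ℝ) (σ : ℝ) {n : ℕ} (A : Fin n → 𝒜) (b : 𝒜) (c : Fin n → ℝ) : ℝ :=
  q b b - 2 * (c ⬝ᵥ fun i => q b (A i)) + c ⬝ᵥ (noisyGram q σ A *ᵥ c)

/-- The weights of the posterior mean. -/
noncomputable def postWeights (q : 𝒜 → 𝒜 → ℝ) (σ : ℝ) {n : ℕ} (A : Fin n → 𝒜) (b : 𝒜) : Fin n → ℝ :=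
  (noisyGram q σ A)⁻¹ *ᵥ fun i => q b (A i)

lemma noisyGram_transpose {q : 𝒜 → 𝒜 → ℝ} (hq : IsCovKernel q) (σ : ℝ) {n : ℕ} (A : Fin n → 𝒜) :
    (noisyGram q σ A)ᵀ = noisyGram q σ A := by
  ext i j
  simp only [noisyGram, Matrix.transpose_apply, Matrix.add_apply, Matrix.of_apply,
    Matrix.smul_apply, hq.symm (A j) (A i)]
  rw [← Matrix.transpose_apply (1 : Matrix (Fin n) (Fin n) ℝ) i j, Matrix.transpose_one]

lemma noisyGram_mulVec_postWeights {q : 𝒜 → 𝒜 → ℝ} (hq : IsCovKernel q) {σ : ℝ} (hσ : 0 < σ)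
    {n : ℕ} (A : Fin n → 𝒜) (b : 𝒜) :
    noisyGram q σ A *ᵥ postWeights q σ A b = fun i => q b (A i) := by
  rw [postWeights, Matrix.mulVec_mulVec, Matrix.mul_nonsing_inv _ (hq.noisyGram_isUnit_det hσ A),
    Matrix.one_mulVec]

lemma dotProduct_inv_mulVec {q : 𝒜 → 𝒜 → ℝ} (hq : IsCovKernel q) (σ : ℝ)
    {n : ℕ} (A : Fin n → 𝒜) (b : 𝒜) (v : Fin n → ℝ) :
    (fun i => q b (A i)) ⬝ᵥ ((noisyGram q σ A)⁻¹ *ᵥ v) = postWeights q σ A b ⬝ᵥ v := by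
  rw [Matrix.dotProduct_mulVec, ← Matrix.mulVec_transpose, Matrix.transpose_nonsing_inv,
    noisyGram_transpose hq, postWeights]

lemma postMean_eq_postWeights {q : 𝒜 → 𝒜 → ℝ} (hq : IsCovKernel q) (ν : 𝒜 → ℝ) (σ : ℝ)
    {n : ℕ} (A : Fin n → 𝒜) (z : Fin n → ℝ) (b : 𝒜) :
    postMean ν q σ A z b = ν b + ∑ i, postWeights q σ A b i * (z i - ν (A i)) := by
  rw [postMean, dotProduct_inv_mulVec hq]
  rfl

lemma postCov_self_eq {q : 𝒜 → 𝒜 → ℝ} (hq : IsCovKernel q) (σ : ℝ)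
    {n : ℕ} (A : Fin n → 𝒜) (b : 𝒜) :
    postCov q σ A b b = q b b - ∑ i, postWeights q σ A b i * q b (A i) := by
  rw [postCov, dotProduct_inv_mulVec hq]
  simp only [dotProduct, hq.symm _ b]

/-- The posterior variance is the least mean squared error of a linear predictor. -/
lemma postCov_add_eq_predVar {q : 𝒜 → 𝒜 → ℝ} (hq : IsCovKernel q) {σ : ℝ} (hσ : 0 < σ)
    {n : ℕ} (A : Fin n → 𝒜) (b : 𝒜) (c : Fin n → ℝ) :
    predVar q σ A b c = postCov q σ A b b +
      (c - postWeights q σ A b) ⬝ᵥ (noisyGram q σ A *ᵥ (c - postWeights q σ A b)) := by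
  have h1 := noisyGram_mulVec_postWeights hq hσ A b
  set w := postWeights q σ A b with hw
  have h2 : w ⬝ᵥ (noisyGram q σ A *ᵥ c) = c ⬝ᵥ fun i => q b (A i) := by
    rw [Matrix.dotProduct_mulVec, ← Matrix.mulVec_transpose, noisyGram_transpose hq, h1,
      dotProduct_comm]
  have h3 : postCov q σ A b b = q b b - w ⬝ᵥ fun i => q b (A i) := postCov_self_eq hq σ A b
  rw [predVar, h3, Matrix.mulVec_sub, h1, sub_dotProduct, dotProduct_sub, dotProduct_sub, h2]
  ring

lemma postCov_le_predVar {q : 𝒜 → 𝒜 → ℝ} (hq : IsCovKernel q) {σ : ℝ} (hσ : 0 < σ)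
    {n : ℕ} (A : Fin n → 𝒜) (b : 𝒜) (c : Fin n → ℝ) :
    postCov q σ A b b ≤ predVar q σ A b c := by
  rw [postCov_add_eq_predVar hq hσ]
  have := (hq.posDef_noisyGram hσ A).posSemidef.dotProduct_mulVec_nonneg
    (c - postWeights q σ A b)
  rw [star_trivial] at this
  linarith

lemma predVar_postWeights {q : 𝒜 → 𝒜 → ℝ} (hq : IsCovKernel q) {σ : ℝ} (hσ : 0 < σ)
    {n : ℕ} (A : Fin n → 𝒜) (b : 𝒜) :
    predVar q σ A b (postWeights q σ A b) = postCov q σ A b b := by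
  rw [postCov_add_eq_predVar hq hσ]
  simp

lemma postCov_le_self {q : 𝒜 → 𝒜 → ℝ} (hq : IsCovKernel q) {σ : ℝ} (hσ : 0 < σ)
    {n : ℕ} (A : Fin n → 𝒜) (b : 𝒜) : postCov q σ A b b ≤ q b b := by
  simpa [predVar] using postCov_le_predVar hq hσ A b 0

/-- Noisy feedback never determines `g(b)`. -/
lemma postCov_pos {q : 𝒜 → 𝒜 → ℝ} (hq : IsCovKernel q) {σ : ℝ} (hσ : 0 < σ)
    {n : ℕ} (A : Fin n → 𝒜) {b : 𝒜} (hb : 0 < q b b) : 0 < postCov q σ A b b := by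
  rw [← predVar_postWeights hq hσ]
  generalize postWeights q σ A b = c
  have h1 := hq.nonneg (n + 1) (Fin.cons b A) (Fin.cons 1 (-c))
  have h2 : predVar q σ A b c =
      (∑ i, ∑ j, (Fin.cons 1 (-c) : Fin (n + 1) → ℝ) i *
        q ((Fin.cons b A : Fin (n + 1) → 𝒜) i) ((Fin.cons b A : Fin (n + 1) → 𝒜) j) *
          (Fin.cons 1 (-c) : Fin (n + 1) → ℝ) j)
      + σ ^ 2 * ∑ i, c i ^ 2 := by
    have e1 : c ⬝ᵥ (noisyGram q σ A *ᵥ c)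
        = (∑ i, ∑ j, c i * q (A i) (A j) * c j) + σ ^ 2 * ∑ i, c i ^ 2 := by
      rw [noisyGram, Matrix.add_mulVec, dotProduct_add, dotProduct_mulVec_eq_sum,
        Matrix.smul_mulVec, Matrix.one_mulVec, dotProduct_smul]
      simp [dotProduct, pow_two]
    rw [predVar, e1]
    simp only [Fin.sum_univ_succ, Fin.cons_zero, Fin.cons_succ, Pi.neg_apply, one_mul, mul_one,
      Finset.sum_add_distrib, dotProduct, hq.symm _ b, mul_neg, neg_mul,
      Finset.sum_neg_distrib]
    have e2 : ∑ i, q b (A i) * c i = ∑ i, c i * q b (A i) :=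
      Finset.sum_congr rfl fun i _ => mul_comm _ _
    rw [e2]
    ring
  rcases eq_or_ne c 0 with rfl | hc
  · simpa [predVar] using hb
  · have h3 : 0 < ∑ i, c i ^ 2 := by
      obtain ⟨i, hi⟩ := Function.ne_iff.1 hc
      exact Finset.sum_pos' (fun i _ => sq_nonneg _) ⟨i, Finset.mem_univ _, by
        have : c i ≠ 0 := hi
        positivity⟩
    rw [h2]
    have : 0 < σ ^ 2 * ∑ i, c i ^ 2 := by positivity
    linarith

/-- Fewer observations leave a larger posterior variance. -/
lemma postCov_le_postCov_comp {q : 𝒜 → 𝒜 → ℝ} (hq : IsCovKernel q) {σ : ℝ} (hσ : 0 < σ)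
    {n m : ℕ} (A : Fin n → 𝒜) {e : Fin m → Fin n} (he : Function.Injective e) (b : 𝒜) :
    postCov q σ A b b ≤ postCov q σ (fun i => A (e i)) b b := by
  rw [← predVar_postWeights hq hσ (fun i => A (e i))]
  generalize postWeights q σ (fun i => A (e i)) b = c
  refine (postCov_le_predVar hq hσ A b (Function.extend e c 0)).trans_eq ?_
  have key : ∀ v : Fin n → ℝ, ∑ i, Function.extend e c 0 i * v i = ∑ j, c j * v (e j) := by
    intro v
    refine (Fintype.sum_of_injective e he _ _ ?_ ?_).symm
    · intro i hi
      rw [Function.extend_apply' _ _ _ (by simpa using hi)]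
      simp
    · intro j
      rw [he.extend_apply]
  have hK : noisyGram q σ (fun i => A (e i)) = (noisyGram q σ A).submatrix e e := by
    ext i j
    simp [noisyGram, Matrix.one_apply, he.eq_iff]
  rw [predVar, predVar, hK]
  simp only [dotProduct, Matrix.mulVec, Matrix.submatrix_apply]
  rw [key, key]
  congr 1
  refine Finset.sum_congr rfl fun j _ => ?_
  congr 1
  calc ∑ i, noisyGram q σ A (e j) i * Function.extend e c 0 i
      = ∑ i, Function.extend e c 0 i * noisyGram q σ A (e j) i :=
        Finset.sum_congr rfl fun i _ => mul_comm _ _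
    _ = ∑ i, noisyGram q σ A (e j) (e i) * c i := by
        rw [key]
        exact Finset.sum_congr rfl fun i _ => mul_comm _ _

end PosteriorAlgebra

/-! ### The integrated Gaussian process -/

section GaussianLimit

lemma tendsto_charFun_gaussianReal {a b : ℕ → ℝ} {m v : ℝ} (ha : Tendsto a atTop (𝓝 m))
    (hb : Tendsto b atTop (𝓝 v)) (t : ℝ) :
    Tendsto (fun n => charFun (gaussianReal (a n) (b n).toNNReal) t) atTop
      (𝓝 (charFun (gaussianReal m v.toNNReal) t)) := by
  simp only [charFun_gaussianReal, Real.coe_toNNReal']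
  have h1 : Tendsto (fun n => ((a n : ℝ) : ℂ)) atTop (𝓝 (m : ℂ)) :=
    (Complex.continuous_ofReal.tendsto m).comp ha
  have h2 : Tendsto (fun n => ((max (b n) 0 : ℝ) : ℂ)) atTop (𝓝 ((max v 0 : ℝ) : ℂ)) :=
    (Complex.continuous_ofReal.tendsto _).comp (hb.max tendsto_const_nhds)
  exact (((h1.const_mul _).mul_const _).sub ((h2.mul_const _).div_const _)).cexp

variable {Ω : Type*} [MeasurableSpace Ω] {P : Measure Ω} [IsProbabilityMeasure P]

/-- A pointwise limit of Gaussian variables with bounded second moments is Gaussian: along a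
subsequence the means and variances converge, and then so do the characteristic functions. -/
lemma hasGaussianLaw_of_tendsto {Y : ℕ → Ω → ℝ} {Z : Ω → ℝ} (hY : ∀ n, HasGaussianLaw (Y n) P)
    (hYm : ∀ n, Measurable (Y n)) (hlim : ∀ ω, Tendsto (fun n => Y n ω) atTop (𝓝 (Z ω)))
    {B : ℝ} (hB : ∀ n, ∫ ω, Y n ω ^ 2 ∂P ≤ B) : HasGaussianLaw Z P := by
  have hZm : Measurable Z := measurable_of_tendsto_metrizable hYm (tendsto_pi_nhds.2 hlim)
  have hvar : ∀ n, Var[Y n; P] = ∫ ω, Y n ω ^ 2 ∂P - (∫ ω, Y n ω ∂P) ^ 2 := fun n => by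
    rw [variance_eq_sub (hY n).memLp_two]
    rfl
  have hmean : ∀ n, ∫ ω, Y n ω ∂P ∈ Set.Icc (-(Real.sqrt B)) (Real.sqrt B) := by
    intro n
    rw [Set.mem_Icc, ← abs_le]
    apply Real.abs_le_sqrt
    have := variance_nonneg (Y n) P
    rw [hvar] at this
    linarith [hB n]
  have hvarB : ∀ n, Var[Y n; P] ∈ Set.Icc 0 B := fun n =>
    ⟨variance_nonneg _ _, by rw [hvar]; nlinarith [hB n, sq_nonneg (∫ ω, Y n ω ∂P)]⟩
  obtain ⟨⟨m, v⟩, -, φ, hφ, hconv⟩ := (isCompact_Icc.prod isCompact_Icc).tendsto_subseq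
    (x := fun n => (∫ ω, Y n ω ∂P, Var[Y n; P])) (fun n => Set.mk_mem_prod (hmean n) (hvarB n))
  have hm : Tendsto (fun n => ∫ ω, Y (φ n) ω ∂P) atTop (𝓝 m) := (Prod.tendsto_iff _ _).1 hconv |>.1
  have hv : Tendsto (fun n => Var[Y (φ n); P]) atTop (𝓝 v) := (Prod.tendsto_iff _ _).1 hconv |>.2
  have hlaw : P.map Z = gaussianReal m v.toNNReal := by
    have : IsProbabilityMeasure (P.map Z) := Measure.isProbabilityMeasure_map hZm.aemeasurable
    apply Measure.ext_of_charFun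
    ext t
    have h1 : Tendsto (fun n => charFun (P.map (Y (φ n))) t) atTop (𝓝 (charFun (P.map Z) t)) := by
      simp only [charFun_apply_real]
      rw [integral_map hZm.aemeasurable (by fun_prop)]
      simp_rw [fun n => integral_map (μ := P) (hYm (φ n)).aemeasurable
        (f := fun x : ℝ => Complex.exp (t * x * Complex.I)) (by fun_prop)]
      refine tendsto_integral_of_dominated_convergence (fun _ => (1 : ℝ)) ?_
        (integrable_const _) ?_ ?_
      · intro n
        have := hYm (φ n)
        fun_prop
      · intro n
        refine ae_of_all _ fun ω => ?_
        rw [← Complex.ofReal_mul, Complex.norm_exp_ofReal_mul_I]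
      · refine ae_of_all _ fun ω => ?_
        have h := (hlim ω).comp hφ.tendsto_atTop
        have hc : Continuous fun x : ℝ => Complex.exp (t * x * Complex.I) := by fun_prop
        exact (hc.tendsto _).comp h
    have h2 := (tendsto_charFun_gaussianReal hm hv t).congr
      fun n => congrArg (fun μ => charFun μ t) (hY (φ n)).map_eq_gaussianReal.symm
    exact tendsto_nhds_unique h1 h2
  constructor
  rw [hlaw]
  infer_instance

/-- A pointwise limit of Gaussian processes with bounded second moments is a Gaussian process. -/
lemma isGaussianProcess_of_tendsto {S : Type*} {Y : ℕ → S → Ω → ℝ} {Z : S → Ω → ℝ}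
    (hY : ∀ n, IsGaussianProcess (Y n) P) (hYm : ∀ n s, Measurable (Y n s))
    (hlim : ∀ s ω, Tendsto (fun n => Y n s ω) atTop (𝓝 (Z s ω)))
    {B : ℝ} (hB : ∀ n s, ∫ ω, Y n s ω ^ 2 ∂P ≤ B) : IsGaussianProcess Z P := by
  have hZm : ∀ s, Measurable (Z s) := fun s =>
    measurable_of_tendsto_metrizable (fun n => hYm n s) (tendsto_pi_nhds.2 (hlim s))
  classical
  constructor
  intro I
  constructor
  have hm : Measurable fun ω => I.restrict (Z · ω) :=
    measurable_pi_lambda _ fun s => hZm s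
  have hmY : ∀ n, Measurable fun ω => I.restrict (Y n · ω) := fun n =>
    measurable_pi_lambda _ fun s => hYm n s
  refine ⟨fun L => ?_⟩
  have hLm : Measurable L := L.continuous.measurable
  have hG : HasGaussianLaw (fun ω => L (I.restrict (Z · ω))) P := by
    refine hasGaussianLaw_of_tendsto (Y := fun n ω => L (I.restrict (Y n · ω)))
      (fun n => ((hY n).hasGaussianLaw I).map_fun L) (fun n => hLm.comp (hmY n)) ?_
      (B := (∑ i, L (Pi.single i 1) ^ 2) * (I.card * B)) ?_
    · intro ω
      refine (L.continuous.tendsto _).comp (tendsto_pi_nhds.2 fun s => hlim s ω)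
    · intro n
      have hint : ∀ s, Integrable (fun ω => Y n s ω ^ 2) P := fun s =>
        ((hY n).hasGaussianLaw_eval s).memLp_two.integrable_sq
      have hL : ∀ x : I → ℝ, L x = ∑ i, L (Pi.single i 1) * x i := by
        intro x
        conv_lhs => rw [← Finset.univ_sum_single x]
        rw [map_sum]
        refine Finset.sum_congr rfl fun i _ => ?_
        rw [mul_comm, ← smul_eq_mul, ← map_smul, ← Pi.single_smul, smul_eq_mul, mul_one]
      calc ∫ ω, L (I.restrict (Y n · ω)) ^ 2 ∂P
          ≤ ∫ ω, (∑ i, L (Pi.single i 1) ^ 2) * ∑ i : I, Y n i ω ^ 2 ∂P := by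
            refine integral_mono_of_nonneg (ae_of_all _ fun ω => sq_nonneg _) ?_
              (ae_of_all _ fun ω => ?_)
            · exact (integrable_finsetSum _ fun (i : I) _ => hint i).const_mul _
            · change L (I.restrict (Y n · ω)) ^ 2 ≤ _
              rw [hL]
              exact Finset.sum_mul_sq_le_sq_mul_sq _ _ _
        _ = (∑ i, L (Pi.single i 1) ^ 2) * ∑ i : I, ∫ ω, Y n i ω ^ 2 ∂P := by
            rw [integral_const_mul, integral_finsetSum _ fun (i : I) _ => hint i]
        _ ≤ (∑ i, L (Pi.single i 1) ^ 2) * (I.card * B) := by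
            gcongr
            refine (Finset.sum_le_sum fun (i : I) _ => hB n i).trans_eq ?_
            simp
  rw [Measure.map_map hLm hm, integral_map hm.aemeasurable hLm.aestronglyMeasurable,
    variance_map hLm.aemeasurable hm.aemeasurable]
  exact hG.map_eq_gaussianReal

end GaussianLimit

section PathMax

variable {𝒳 Ω : Type*} [TopologicalSpace 𝒳] [CompactSpace 𝒳]

lemma bddAbove_range_of_continuous {φ : 𝒳 → ℝ} (hφ : Continuous φ) : BddAbove (Set.range φ) :=
  (isCompact_range hφ).bddAbove

lemma measurable_pathMax [Nonempty 𝒳] [SecondCountableTopology 𝒳] {mΩ : MeasurableSpace Ω}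
    {f : 𝒳 → Ω → ℝ} (hfm : ∀ x, Measurable (f x)) (hc : ∀ ω, Continuous fun x => f x ω) :
    Measurable (pathMax f) := by
  have h : pathMax f = fun ω => ⨆ n, f (TopologicalSpace.denseSeq 𝒳 n) ω := by
    ext ω
    have hb := bddAbove_range_of_continuous (hc ω)
    have hb' : BddAbove (Set.range fun n => f (TopologicalSpace.denseSeq 𝒳 n) ω) :=
      hb.mono (by rintro _ ⟨n, rfl⟩; exact ⟨_, rfl⟩)
    apply le_antisymm
    · refine ciSup_le fun x => ?_
      refine (TopologicalSpace.denseRange_denseSeq 𝒳).induction_on (p := fun x => f x ω ≤ _) x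
        (isClosed_le (hc ω) continuous_const) fun n => ?_
      exact le_ciSup hb' n
    · exact ciSup_le fun n => le_ciSup hb _
  rw [h]
  exact Measurable.iSup fun n => hfm _

variable [MeasurableSpace 𝒳] [OpensMeasurableSpace 𝒳]

lemma integrable_of_continuous (μ : Measure 𝒳) [IsFiniteMeasure μ] {φ : 𝒳 → ℝ}
    (hφ : Continuous φ) : Integrable φ μ :=
  hφ.integrable_of_hasCompactSupport (HasCompactSupport.of_compactSpace _)

lemma integrated_le_iSup [Nonempty 𝒳] {𝒜 : Type*} [MeasurableSpace 𝒜]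
    (p : Kernel 𝒜 𝒳) [IsMarkovKernel p] {φ : 𝒳 → ℝ} (hφ : Continuous φ) (a : 𝒜) :
    integrated p φ a ≤ ⨆ x, φ x := by
  have h := integral_mono (integrable_of_continuous (p a) hφ) (integrable_const (⨆ x, φ x))
    fun x => le_ciSup (bddAbove_range_of_continuous hφ) x
  simpa [integrated] using h

end PathMax

/-- A finite quadrature formula for the integral of `h ∘ s`, `s` simple. -/
lemma integral_comp_simpleFunc {𝒳 : Type*} [MeasurableSpace 𝒳] (μ : Measure 𝒳) [IsFiniteMeasure μ]
    (s : SimpleFunc 𝒳 𝒳) (h : 𝒳 → ℝ) :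
    ∫ x, h (s x) ∂μ = ∑ y ∈ s.range, μ.real (s ⁻¹' {y}) * h y := by
  have e : ∀ x, h (s x) = ∑ y ∈ s.range, (s ⁻¹' {y}).indicator (fun _ => h y) x := by
    intro x
    rw [Finset.sum_eq_single (s x)]
    · simp
    · intro y _ hy
      simp [hy.symm]
    · intro hx
      exact absurd (s.mem_range_self x) hx
  simp_rw [e]
  rw [integral_finsetSum]
  · refine Finset.sum_congr rfl fun y _ => ?_
    rw [integral_indicator (s.measurableSet_preimage _), setIntegral_const, smul_eq_mul]
  · intro y _
    exact (integrable_const _).indicator (s.measurableSet_preimage _)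

lemma IsContinuousGP.memLp_two {𝒳 Ω : Type*} [TopologicalSpace 𝒳] [MeasurableSpace Ω]
    {f : 𝒳 → Ω → ℝ} {m : 𝒳 → ℝ} {k : 𝒳 → 𝒳 → ℝ} {P : Measure Ω} (hf : IsContinuousGP f m k P)
    (x : 𝒳) : MemLp (f x) 2 P :=
  (hf.gaussian.hasGaussianLaw_eval x).memLp_two

lemma IsContinuousGP.integral_centered_sq {𝒳 Ω : Type*} [TopologicalSpace 𝒳]
    [MeasurableSpace Ω] {f : 𝒳 → Ω → ℝ} {m : 𝒳 → ℝ} {k : 𝒳 → 𝒳 → ℝ} {P : Measure Ω}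
    (hf : IsContinuousGP f m k P)
    (x : 𝒳) :
    ∫ ω, (f x ω - m x) ^ 2 ∂P = k x x := by
  rw [← hf.cov x x, covariance_self (hf.measurable x).aemeasurable,
    variance_eq_integral (hf.measurable x).aemeasurable, hf.mean]

section IntegratedProcess

variable {𝒳 Ω 𝒜 : Type*} [TopologicalSpace 𝒳] [TopologicalSpace.MetrizableSpace 𝒳]
  [SecondCountableTopology 𝒳] [MeasurableSpace 𝒳] [BorelSpace 𝒳] [MeasurableSpace 𝒜]

/-- The integrated function is jointly measurable in the query and the sample point, for every
σ-algebra on the sample space that makes the values `f x` measurable. -/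
lemma measurable_integrated {mΩ : MeasurableSpace Ω} {f : 𝒳 → Ω → ℝ} (hfm : ∀ x, Measurable (f x))
    (hc : ∀ ω, Continuous fun x => f x ω) (p : Kernel 𝒜 𝒳) [IsMarkovKernel p] :
    Measurable fun y : 𝒜 × Ω => integrated p (fun x => f x y.2) y.1 := by
  have h1 := (measurable_uncurry_of_continuous_of_measurable hc hfm).stronglyMeasurable
  have h2 : StronglyMeasurable (Function.uncurry fun (y : 𝒜 × Ω) (x : 𝒳) => f x y.2) :=
    h1.comp_measurable (measurable_snd.prodMk (measurable_snd.comp measurable_fst))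
  exact (h2.integral_kernel_prod_right (κ := p.prodMkRight Ω)).measurable

variable [MeasurableSpace Ω] {P : Measure Ω} {f : 𝒳 → Ω → ℝ} {m : 𝒳 → ℝ} {k : 𝒳 → 𝒳 → ℝ}

lemma IsContinuousGP.measurable_uncurry (hf : IsContinuousGP f m k P) :
    Measurable (Function.uncurry f) :=
  measurable_uncurry_of_continuous_of_measurable hf.continuous_path hf.measurable

lemma IsContinuousGP.measurable_mean [IsProbabilityMeasure P] (hf : IsContinuousGP f m k P) :
    Measurable m := by
  have h := (hf.measurable_uncurry.stronglyMeasurable.integral_prod_right' (ν := P)).measurable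
  convert h using 2 with x
  exact (hf.mean x).symm

variable [IsProbabilityMeasure P]

/-- The paths are bounded, so if `f x` had an arbitrarily large mean it would have to be far from
its mean with large probability; its variance is at most `1`. -/
lemma IsContinuousGP.exists_mean_bound [CompactSpace 𝒳] [Nonempty 𝒳]
    (hf : IsContinuousGP f m k P) (hk : ∀ x x', k x x' ≤ 1) : ∃ M, ∀ x, |m x| ≤ M := by
  have hmeas : Measurable (pathMax fun x ω => |f x ω|) :=
    measurable_pathMax (fun x => (hf.measurable x).abs) fun ω => (hf.continuous_path ω).abs
  obtain ⟨M, hM⟩ : ∃ M : ℕ, P {ω | (M : ℝ) < pathMax (fun x ω => |f x ω|) ω} < 1 / 2 := by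
    have hlim := tendsto_measure_iInter_atTop (μ := P)
      (s := fun n : ℕ => {ω | (n : ℝ) < pathMax (fun x ω => |f x ω|) ω})
      (fun n => (measurableSet_lt measurable_const hmeas).nullMeasurableSet)
      (fun n n' h ω hω => by
        have hω' : (n' : ℝ) < pathMax (fun x ω => |f x ω|) ω := hω
        have h' : (n : ℝ) ≤ n' := by exact_mod_cast h
        exact h'.trans_lt hω')
      ⟨0, measure_ne_top _ _⟩
    have he : ⋂ n : ℕ, {ω | (n : ℝ) < pathMax (fun x ω => |f x ω|) ω} = ∅ := by
      ext ω
      simp only [Set.mem_iInter, Set.mem_ofPred_eq, Set.mem_empty_iff_false, iff_false, not_forall,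
        not_lt]
      exact exists_nat_ge _
    rw [he, measure_empty] at hlim
    exact ((tendsto_order.1 hlim).2 (1 / 2) (by simp)).exists
  -- `|f x| ≤ M` has probability above `1 / 2`, and `|f x - m x| < 2` has probability
  -- at least `3 / 4`
  refine ⟨M + 2, fun x => ?_⟩
  by_contra! hx
  have hcheb : P {ω | (2 : ℝ) ≤ |f x ω - ∫ ω, f x ω ∂P|} ≤ 1 / 4 := by
    refine (meas_ge_le_variance_div_sq (hf.memLp_two x) (by norm_num : (0 : ℝ) < 2)).trans ?_
    rw [← covariance_self (hf.measurable x).aemeasurable, hf.cov]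
    refine (ENNReal.ofReal_le_ofReal (show k x x / 2 ^ 2 ≤ 1 / 4 by linarith [hk x x])).trans_eq ?_
    rw [ENNReal.ofReal_div_of_pos (by norm_num)]
    simp
  have huniv : (Set.univ : Set Ω) ⊆ {ω | (M : ℝ) < pathMax (fun x ω => |f x ω|) ω} ∪
      {ω | (2 : ℝ) ≤ |f x ω - ∫ ω, f x ω ∂P|} := by
    intro ω _
    by_contra! h
    simp only [Set.mem_union, Set.mem_ofPred_eq, not_or, not_lt, not_le, hf.mean] at h
    have h1 : |f x ω| ≤ M := le_trans
      (le_ciSup (bddAbove_range_of_continuous (hf.continuous_path ω).abs) x) h.1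
    have h2 := abs_sub_abs_le_abs_sub (m x) (f x ω)
    rw [abs_sub_comm] at h2
    linarith
  have h1 : (1 : ℝ≥0∞) ≤ P {ω | (M : ℝ) < pathMax (fun x ω => |f x ω|) ω} + 1 / 4 :=
    calc (1 : ℝ≥0∞) = P Set.univ := measure_univ.symm
      _ ≤ _ := (measure_mono huniv).trans (measure_union_le _ _)
      _ ≤ _ := by gcongr
  have h2 : (1 : ℝ≥0∞) < 1 / 2 + 1 / 4 :=
    h1.trans_lt (ENNReal.add_lt_add_right (by simp) hM)
  have h3 : (1 / 2 + 1 / 4 : ℝ≥0∞) ≤ 1 :=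
    calc (1 / 2 + 1 / 4 : ℝ≥0∞) ≤ 1 / 2 + 1 / 2 := by
          refine add_le_add le_rfl ?_
          rw [one_div, one_div, ENNReal.inv_le_inv]
          norm_num
      _ = 1 := ENNReal.add_halves 1
  exact absurd (h2.trans_le h3) (lt_irrefl _)

/-- The integrated function is again a Gaussian process: quadrature sums are finite linear
combinations of values of `f`, and they converge along every path. -/
lemma IsContinuousGP.isGaussianProcess_integrated [CompactSpace 𝒳] [Nonempty 𝒳]
    (hf : IsContinuousGP f m k P) (hk : ∀ x x', k x x' ≤ 1)
    (p : Kernel 𝒜 𝒳) [IsMarkovKernel p] :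
    IsGaussianProcess (fun a ω => integrated p (fun x => f x ω) a) P := by
  obtain ⟨M, hM⟩ := hf.exists_mean_bound hk
  have hsm : StronglyMeasurable (id : 𝒳 → 𝒳) := stronglyMeasurable_id
  set s := hsm.approx with hs
  have hlim : ∀ x, Tendsto (fun n => s n x) atTop (𝓝 x) := fun x => hsm.tendsto_approx x
  have hsum : ∀ n a ω, ∫ x, f (s n x) ω ∂(p a)
      = ∑ y ∈ (s n).range, (p a).real (s n ⁻¹' {y}) * f y ω := fun n a ω =>
    integral_comp_simpleFunc (p a) (s n) fun y => f y ω
  have hone : ∀ n a, ∑ y ∈ (s n).range, (p a).real (s n ⁻¹' {y}) = 1 := by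
    intro n a
    have := integral_comp_simpleFunc (p a) (s n) fun _ => 1
    simpa using this.symm
  have hsq : ∀ x, ∫ ω, f x ω ^ 2 ∂P ≤ 1 + M ^ 2 := by
    intro x
    have h := variance_eq_sub (hf.memLp_two x)
    rw [← covariance_self (hf.measurable x).aemeasurable, hf.cov, hf.mean] at h
    have h2 : m x ^ 2 ≤ M ^ 2 := sq_le_sq' (by linarith [(abs_le.1 (hM x)).1]) (abs_le.1 (hM x)).2
    have h3 : ∫ ω, f x ω ^ 2 ∂P = ∫ ω, (f x ^ 2) ω ∂P := rfl
    rw [h3]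
    linarith [hk x x]
  refine isGaussianProcess_of_tendsto (Y := fun n a ω => ∫ x, f (s n x) ω ∂(p a)) (B := 1 + M ^ 2)
    (fun n => ?_) (fun n a => ?_) (fun a ω => ?_) (fun n a => ?_)
  · refine hf.gaussian.of_isGaussianProcess fun a => ⟨(s n).range,
      ∑ y : (s n).range, (p a).real (s n ⁻¹' {y.1}) • ContinuousLinearMap.proj y, fun ω => ?_⟩
    rw [hsum]
    simp only [sum_apply, smul_apply,
      ContinuousLinearMap.proj_apply, Finset.restrict, smul_eq_mul]
    exact (Finset.sum_coe_sort (s n).range fun y => (p a).real (s n ⁻¹' {y}) * f y ω).symm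
  · simp_rw [hsum]
    exact Finset.measurable_fun_sum _ fun y _ => (hf.measurable y).const_mul _
  · obtain ⟨C, hC⟩ := isCompact_univ.exists_bound_of_continuousOn
      (hf.continuous_path ω).continuousOn
    refine tendsto_integral_of_dominated_convergence (fun _ => C) (fun n => ?_)
      (integrable_const _) (fun n => ae_of_all _ fun x => hC _ trivial) (ae_of_all _ fun x => ?_)
    · exact ((hf.continuous_path ω).measurable.comp (s n).measurable).aestronglyMeasurable
    · exact ((hf.continuous_path ω).tendsto _).comp (hlim x)
  · have hint : ∀ y, Integrable (fun ω => f y ω ^ 2) P := fun y => (hf.memLp_two y).integrable_sq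
    calc ∫ ω, (∫ x, f (s n x) ω ∂(p a)) ^ 2 ∂P
        ≤ ∫ ω, ∑ y ∈ (s n).range, (p a).real (s n ⁻¹' {y}) * f y ω ^ 2 ∂P := by
          refine integral_mono_of_nonneg (ae_of_all _ fun ω => sq_nonneg _) ?_
            (ae_of_all _ fun ω => ?_)
          · exact integrable_finsetSum _ fun y _ => (hint y).const_mul _
          · change (∫ x, f (s n x) ω ∂(p a)) ^ 2 ≤ _
            rw [hsum]
            exact Real.pow_arith_mean_le_arith_mean_pow_of_even _ _ _
              (fun _ _ => measureReal_nonneg) (hone n a) even_two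
      _ = ∑ y ∈ (s n).range, (p a).real (s n ⁻¹' {y}) * ∫ ω, f y ω ^ 2 ∂P := by
          rw [integral_finsetSum _ fun y _ => (hint y).const_mul _]
          simp_rw [integral_const_mul]
      _ ≤ ∑ y ∈ (s n).range, (p a).real (s n ⁻¹' {y}) * (1 + M ^ 2) := by
          gcongr with y _
          exact hsq y
      _ = 1 + M ^ 2 := by rw [← Finset.sum_mul, hone, one_mul]

lemma IsContinuousGP.integrable_centered_mul (hf : IsContinuousGP f m k P) (x y : 𝒳) :
    Integrable (fun ω => (f x ω - m x) * (f y ω - m y)) P :=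
  ((hf.memLp_two x).sub (memLp_const (m x))).integrable_mul
    ((hf.memLp_two y).sub (memLp_const (m y)))

lemma IsContinuousGP.integral_abs_centered_mul_le (hf : IsContinuousGP f m k P)
    (hk : ∀ x x', k x x' ≤ 1) (x y : 𝒳) :
    ∫ ω, |(f x ω - m x) * (f y ω - m y)| ∂P ≤ 1 := by
  have hint : ∀ x, Integrable (fun ω => (f x ω - m x) ^ 2) P := fun x =>
    ((hf.memLp_two x).sub (memLp_const (m x))).integrable_sq
  have h : ∫ ω, |(f x ω - m x) * (f y ω - m y)| ∂P
      ≤ ∫ ω, ((f x ω - m x) ^ 2 / 2 + (f y ω - m y) ^ 2 / 2) ∂P := by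
    refine integral_mono (hf.integrable_centered_mul x y).abs
      (((hint x).div_const 2).add ((hint y).div_const 2)) fun ω => ?_
    simp only [abs_mul]
    nlinarith [sq_nonneg (|f x ω - m x| - |f y ω - m y|), sq_abs (f x ω - m x),
      sq_abs (f y ω - m y)]
  refine h.trans ?_
  rw [integral_add ((hint x).div_const 2) ((hint y).div_const 2), integral_div, integral_div,
    hf.integral_centered_sq, hf.integral_centered_sq]
  linarith [hk x x, hk y y]

lemma IsContinuousGP.integrable_centered (hf : IsContinuousGP f m k P)
    (hk : ∀ x x', k x x' ≤ 1) (μ : Measure 𝒳) [IsProbabilityMeasure μ] :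
    Integrable (fun y : 𝒳 × Ω => f y.1 y.2 - m y.1) (μ.prod P) := by
  have hmeas : Measurable fun y : 𝒳 × Ω => f y.1 y.2 - m y.1 :=
    hf.measurable_uncurry.sub (hf.measurable_mean.comp measurable_fst)
  rw [integrable_prod_iff hmeas.aestronglyMeasurable]
  have hint : ∀ x, Integrable (fun ω => f x ω - m x) P := fun x =>
    ((hf.memLp_two x).integrable one_le_two).sub (integrable_const _)
  refine ⟨ae_of_all _ hint, ?_⟩
  refine Integrable.mono' (g := fun _ => (1 : ℝ)) (integrable_const _)
    hmeas.norm.stronglyMeasurable.integral_prod_right'.aestronglyMeasurable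
    (ae_of_all _ fun x => ?_)
  rw [Real.norm_of_nonneg (integral_nonneg fun _ => norm_nonneg _)]
  have hsq : Integrable (fun ω => (f x ω - m x) ^ 2) P :=
    ((hf.memLp_two x).sub (memLp_const (m x))).integrable_sq
  have h : ∫ ω, ‖f x ω - m x‖ ∂P ≤ ∫ ω, ((f x ω - m x) ^ 2 / 2 + 1 / 2) ∂P := by
    refine integral_mono (hint x).norm ((hsq.div_const 2).add (integrable_const _)) fun ω => ?_
    simp only [Real.norm_eq_abs]
    nlinarith [sq_nonneg (|f x ω - m x| - 1), sq_abs (f x ω - m x)]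
  refine h.trans ?_
  rw [integral_add (hsq.div_const 2) (integrable_const _), integral_div, hf.integral_centered_sq]
  simp only [integral_const, probReal_univ, smul_eq_mul, one_mul]
  linarith [hk x x]

lemma IsContinuousGP.integrable_mean [CompactSpace 𝒳] [Nonempty 𝒳] (hf : IsContinuousGP f m k P)
    (hk : ∀ x x', k x x' ≤ 1) (μ : Measure 𝒳) [IsProbabilityMeasure μ] : Integrable m μ := by
  obtain ⟨M, hM⟩ := hf.exists_mean_bound hk
  exact Integrable.mono' (g := fun _ => M) (integrable_const _)
    hf.measurable_mean.aestronglyMeasurable (ae_of_all _ hM)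

lemma IsContinuousGP.integral_sub_mean [CompactSpace 𝒳] [Nonempty 𝒳] (hf : IsContinuousGP f m k P)
    (hk : ∀ x x', k x x' ≤ 1) (p : Kernel 𝒜 𝒳) [IsMarkovKernel p] (a : 𝒜) (ω : Ω) :
    ∫ x, (f x ω - m x) ∂(p a) = integrated p (fun x => f x ω) a - integrated p m a :=
  integral_sub (integrable_of_continuous _ (hf.continuous_path ω)) (hf.integrable_mean hk _)

lemma IsContinuousGP.integral_integrated [CompactSpace 𝒳] [Nonempty 𝒳]
    (hf : IsContinuousGP f m k P) (hk : ∀ x x', k x x' ≤ 1)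
    (p : Kernel 𝒜 𝒳) [IsMarkovKernel p] (a : 𝒜) :
    ∫ ω, integrated p (fun x => f x ω) a ∂P = integrated p m a := by
  have h1 : ∫ ω, ∫ x, (f x ω - m x) ∂(p a) ∂P = 0 := by
    rw [← integral_integral_swap (f := fun x ω => f x ω - m x) (hf.integrable_centered hk (p a))]
    have h0 : ∀ x, ∫ ω, (f x ω - m x) ∂P = 0 := fun x => by
      rw [integral_sub ((hf.memLp_two x).integrable one_le_two) (integrable_const _), hf.mean]
      simp
    simp [h0]
  simp_rw [hf.integral_sub_mean hk] at h1
  rw [integral_sub ((hf.isGaussianProcess_integrated hk p).hasGaussianLaw_eval a).integrable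
    (integrable_const _)] at h1
  simpa [sub_eq_zero] using h1

lemma IsContinuousGP.integrable_centered_mul_prod (hf : IsContinuousGP f m k P)
    (hk : ∀ x x', k x x' ≤ 1) (μ μ' : Measure 𝒳) [IsProbabilityMeasure μ]
    [IsProbabilityMeasure μ'] :
    Integrable (fun y : (𝒳 × 𝒳) × Ω => (f y.1.1 y.2 - m y.1.1) * (f y.1.2 y.2 - m y.1.2))
      ((μ.prod μ').prod P) := by
  have hF : Measurable fun y : 𝒳 × Ω => f y.1 y.2 - m y.1 :=
    hf.measurable_uncurry.sub (hf.measurable_mean.comp measurable_fst)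
  have hmeas : Measurable fun y : (𝒳 × 𝒳) × Ω =>
      (f y.1.1 y.2 - m y.1.1) * (f y.1.2 y.2 - m y.1.2) :=
    (hF.comp (measurable_fst.fst.prodMk measurable_snd)).mul
      (hF.comp (measurable_fst.snd.prodMk measurable_snd))
  rw [integrable_prod_iff hmeas.aestronglyMeasurable]
  refine ⟨ae_of_all _ fun x => hf.integrable_centered_mul x.1 x.2, ?_⟩
  refine Integrable.mono' (g := fun _ => (1 : ℝ)) (integrable_const _)
    hmeas.norm.stronglyMeasurable.integral_prod_right'.aestronglyMeasurable
    (ae_of_all _ fun x => ?_)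
  rw [Real.norm_of_nonneg (integral_nonneg fun _ => norm_nonneg _)]
  exact hf.integral_abs_centered_mul_le hk x.1 x.2

lemma IsContinuousGP.integral_centered_mul (hf : IsContinuousGP f m k P) (x y : 𝒳) :
    ∫ ω, (f x ω - m x) * (f y ω - m y) ∂P = k x y := by
  rw [← hf.cov x y, covariance, hf.mean, hf.mean]

lemma IsContinuousGP.covariance_integrated [CompactSpace 𝒳] [Nonempty 𝒳]
    (hf : IsContinuousGP f m k P) (hk : ∀ x x', k x x' ≤ 1)
    (p : Kernel 𝒜 𝒳) [IsMarkovKernel p] (a b : 𝒜) :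
    cov[fun ω => integrated p (fun x => f x ω) a, fun ω => integrated p (fun x => f x ω) b; P]
      = integratedCov p k a b := by
  have hint := hf.integrable_centered_mul_prod hk (p a) (p b)
  rw [covariance, hf.integral_integrated hk, hf.integral_integrated hk]
  simp_rw [← hf.integral_sub_mean hk, ← integral_prod_mul]
  rw [← integral_integral_swap (f := fun (y : 𝒳 × 𝒳) ω => (f y.1 ω - m y.1) * (f y.2 ω - m y.2))
    hint]
  have h := hint.integral_prod_left
  simp only [hf.integral_centered_mul] at h ⊢
  exact integral_prod _ h

lemma IsContinuousGP.integratedCov_le_one (hf : IsContinuousGP f m k P) (hk : ∀ x x', k x x' ≤ 1)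
    (p : Kernel 𝒜 𝒳) [IsMarkovKernel p] (a b : 𝒜) : integratedCov p k a b ≤ 1 := by
  have h := (hf.integrable_centered_mul_prod hk (p a) (p b)).integral_prod_left
  simp only [hf.integral_centered_mul] at h
  have e : integratedCov p k a b = ∫ y, k y.1 y.2 ∂((p a).prod (p b)) := (integral_prod _ h).symm
  rw [e]
  refine (integral_mono h (integrable_const (1 : ℝ)) fun y => hk y.1 y.2).trans_eq ?_
  simp

end IntegratedProcess

/-! ### Densities of sequential observations -/

section SequentialDensity

variable {Ω E : Type*} [MeasurableSpace Ω] [MeasurableSpace E] {P : Measure Ω}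

/-- The likelihood of observations `u 0, …, u (n - 1)`, the `i`-th of which is Gaussian with
variance `v i` and with mean a function of the previous observations and of `x`. -/
noncomputable def seqLik (c : (n : ℕ) → (Fin n → ℝ) × E → ℝ) (v : ℕ → ℝ≥0) (n : ℕ)
    (y : (Fin n → ℝ) × E) : ℝ≥0∞ :=
  ∏ i : Fin n, gaussianPDF (c i (fun j => y.1 (j.castLE i.2.le), y.2)) (v i) (y.1 i)

lemma measurable_seqLik {c : (n : ℕ) → (Fin n → ℝ) × E → ℝ} (hc : ∀ n, Measurable (c n))
    (v : ℕ → ℝ≥0) (n : ℕ) : Measurable (seqLik c v n) := by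
  refine Finset.measurable_fun_prod _ fun i _ => ?_
  have h1 : Measurable fun y : (Fin n → ℝ) × E =>
      c i (fun j : Fin i => y.1 (j.castLE i.2.le), y.2) :=
    (hc i).comp (Measurable.prodMk
      (measurable_pi_lambda _ fun j => (measurable_pi_apply _).comp measurable_fst) measurable_snd)
  have h2 : Measurable fun y : (Fin n → ℝ) × E => y.1 i :=
    (measurable_pi_apply _).comp measurable_fst
  exact measurable_uncurry_gaussianPDF.comp (h1.prodMk (measurable_const.prodMk h2))

lemma seqLik_snoc (c : (n : ℕ) → (Fin n → ℝ) × E → ℝ) (v : ℕ → ℝ≥0) (n : ℕ) (u : Fin n → ℝ)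
    (t : ℝ) (x : E) : seqLik c v (n + 1) (Fin.snoc (α := fun _ => ℝ) u t, x)
      = seqLik c v n (u, x) * gaussianPDF (c n (u, x)) (v n) t := by
  rw [seqLik, Fin.prod_univ_castSucc, seqLik]
  congr 1
  · refine Finset.prod_congr rfl fun i _ => ?_
    simp only [Fin.snoc_castSucc, Fin.val_castSucc]
    congr 1
    · congr 2
      funext j
      exact Fin.snoc_castSucc (α := fun _ => ℝ) t u (j.castLE i.2.le)
  · simp only [Fin.snoc_last, Fin.val_last]
    congr 1
    · congr 2
      funext j
      exact Fin.snoc_castSucc (α := fun _ => ℝ) t u j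

lemma lintegral_fin_succ {n : ℕ} {F : (Fin (n + 1) → ℝ) → ℝ≥0∞} (hF : Measurable F) :
    ∫⁻ u, F u = ∫⁻ u : Fin n → ℝ, ∫⁻ t : ℝ, F (Fin.snoc (α := fun _ => ℝ) u t) := by
  have h := (volume_preserving_piFinSuccAbove (fun _ : Fin (n + 1) => ℝ) (Fin.last n)).symm
  rw [← h.lintegral_comp hF, Measure.volume_eq_prod, lintegral_prod_symm]
  · refine lintegral_congr fun u => lintegral_congr fun t => ?_
    congr 1
    exact Fin.insertNth_last' (β := ℝ) t u
  · exact (hF.comp h.measurable).aemeasurable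

lemma lintegral_add_gaussianReal (a : ℝ) {v : ℝ≥0} (hv : v ≠ 0) {h : ℝ → ℝ≥0∞}
    (hh : Measurable h) :
    ∫⁻ e, h (a + e) ∂(gaussianReal 0 v) = ∫⁻ t, h t * gaussianPDF a v t := by
  have h1 := gaussianReal_map_const_add (μ := 0) (v := v) a
  rw [zero_add] at h1
  rw [← lintegral_map (f := h) hh (measurable_const_add a), h1, gaussianReal_of_var_ne_zero _ hv,
    lintegral_withDensity_eq_lintegral_mul _ (measurable_gaussianPDF _ _) hh]
  refine lintegral_congr fun t => ?_
  rw [Pi.mul_apply, mul_comm]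

lemma measurable_snoc {n : ℕ} :
    Measurable fun y : (Fin n → ℝ) × ℝ =>
      (Fin.snoc (α := fun _ => ℝ) y.1 y.2 : Fin (n + 1) → ℝ) := by
  refine measurable_pi_lambda _ fun i => ?_
  induction i using Fin.lastCases with
  | last => simpa using measurable_snd
  | cast i =>
    simp only [Fin.snoc_castSucc]
    exact (measurable_pi_apply i).comp measurable_fst

/-- The joint law of sequential observations: if each `z n` is a function `c n` of the previous
observations and of `x`, plus Gaussian noise independent of these, then given `x` the first `n`
observations have density `seqLik c v n`. -/
theorem lintegral_sequential [IsProbabilityMeasure P] {z : ℕ → Ω → ℝ} {x : Ω → E}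
    (hz : ∀ n, Measurable (z n)) (hx : Measurable x)
    {c : (n : ℕ) → (Fin n → ℝ) × E → ℝ} (hc : ∀ n, Measurable (c n))
    {v : ℕ → ℝ≥0} (hv : ∀ n, v n ≠ 0)
    (hlaw : ∀ n, P.map (fun ω => z n ω - c n (fun i : Fin n => z i ω, x ω)) = gaussianReal 0 (v n))
    (hind : ∀ n, IndepFun (fun ω => z n ω - c n (fun i : Fin n => z i ω, x ω))
      (fun ω => (fun i : Fin n => z i ω, x ω)) P)
    (n : ℕ) {Φ : (Fin n → ℝ) × E → ℝ≥0∞} (hΦ : Measurable Φ) :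
    ∫⁻ ω, Φ (fun i : Fin n => z i ω, x ω) ∂P
      = ∫⁻ ω, (∫⁻ u : Fin n → ℝ, Φ (u, x ω) * seqLik c v n (u, x ω)) ∂P := by
  induction n with
  | zero =>
    refine lintegral_congr fun ω => ?_
    rw [show (volume : Measure (Fin 0 → ℝ)) = Measure.dirac default from
      Measure.volume_pi_eq_dirac default, lintegral_dirac]
    simp only [seqLik, Finset.univ_eq_empty, Finset.prod_empty, mul_one]
    congr 2
    exact Subsingleton.elim _ _
  | succ n ih =>
    have hpre : Measurable fun ω => ((fun i : Fin n => z i ω), x ω) :=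
      (measurable_pi_lambda _ fun i : Fin n => hz i).prodMk hx
    set η : Ω → ℝ := fun ω => z n ω - c n (fun i : Fin n => z i ω, x ω) with hη
    have hηm : Measurable η := (hz n).sub ((hc n).comp hpre)
    have hsn : Measurable fun y : ((Fin n → ℝ) × E) × ℝ =>
        ((Fin.snoc (α := fun _ => ℝ) y.1.1 y.2 : Fin (n + 1) → ℝ), y.1.2) :=
      (measurable_snoc.comp (measurable_fst.fst.prodMk measurable_snd)).prodMk measurable_fst.snd
    have hΦs : Measurable fun y : ((Fin n → ℝ) × E) × ℝ =>
        Φ ((Fin.snoc (α := fun _ => ℝ) y.1.1 y.2 : Fin (n + 1) → ℝ), y.1.2) := hΦ.comp hsn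
    have hpdf : Measurable fun y : ((Fin n → ℝ) × E) × ℝ => gaussianPDF (c n y.1) (v n) y.2 :=
      measurable_uncurry_gaussianPDF.comp
        (((hc n).comp measurable_fst).prodMk (measurable_const.prodMk measurable_snd))
    have hstep : ∫⁻ ω, Φ (fun i : Fin (n + 1) => z i ω, x ω) ∂P
        = ∫⁻ ω, (∫⁻ t, Φ (Fin.snoc (α := fun _ => ℝ) (fun i : Fin n => z i ω) t, x ω)
            * gaussianPDF (c n (fun i : Fin n => z i ω, x ω)) (v n) t) ∂P := by
      have e1 : ∀ ω, (fun i : Fin (n + 1) => z i ω)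
          = Fin.snoc (α := fun _ => ℝ) (fun i : Fin n => z i ω)
            (c n (fun i : Fin n => z i ω, x ω) + η ω) := by
        intro ω
        funext i
        induction i using Fin.lastCases with
        | last => simp [hη]
        | cast i => simp
      have hj := (indepFun_iff_map_prod_eq_prod_map_map hηm.aemeasurable hpre.aemeasurable).1
        (hind n)
      have hΨ : Measurable fun y : ℝ × ((Fin n → ℝ) × E) =>
          Φ (Fin.snoc (α := fun _ => ℝ) y.2.1 (c n y.2 + y.1), y.2.2) :=
        hΦs.comp (measurable_snd.prodMk (((hc n).comp measurable_snd).add measurable_fst))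
      calc ∫⁻ ω, Φ (fun i : Fin (n + 1) => z i ω, x ω) ∂P
          = ∫⁻ y, Φ (Fin.snoc (α := fun _ => ℝ) y.2.1 (c n y.2 + y.1), y.2.2)
              ∂(P.map fun ω => (η ω, ((fun i : Fin n => z i ω), x ω))) := by
            rw [lintegral_map hΨ (hηm.prodMk hpre)]
            exact lintegral_congr fun ω => by rw [e1 ω]
        _ = ∫⁻ ω, ∫⁻ e, Φ (Fin.snoc (α := fun _ => ℝ) (fun i : Fin n => z i ω)
              (c n (fun i : Fin n => z i ω, x ω) + e), x ω) ∂(gaussianReal 0 (v n)) ∂P := by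
            rw [hj, lintegral_prod_symm _ hΨ.aemeasurable, hlaw,
              lintegral_map hΨ.lintegral_prod_left' hpre]
        _ = _ := by
            refine lintegral_congr fun ω => ?_
            exact lintegral_add_gaussianReal _ (hv n)
              (h := fun t => Φ (Fin.snoc (α := fun _ => ℝ) (fun i : Fin n => z i ω) t, x ω))
              (hΦs.comp ((measurable_const (a := ((fun i : Fin n => z i ω), x ω))).prodMk
                measurable_id))
    have hint : Measurable fun y : (Fin n → ℝ) × E =>
        ∫⁻ t, Φ (Fin.snoc (α := fun _ => ℝ) y.1 t, y.2) * gaussianPDF (c n y) (v n) t :=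
      (hΦs.mul hpdf).lintegral_prod_right'
    rw [hstep, ih hint]
    refine lintegral_congr fun ω => ?_
    rw [lintegral_fin_succ]
    · refine lintegral_congr fun u => ?_
      rw [← lintegral_mul_const]
      · refine lintegral_congr fun t => ?_
        rw [seqLik_snoc, mul_assoc, mul_comm (gaussianPDF _ _ _)]
      · exact (hΦs.mul hpdf).comp (measurable_const.prodMk measurable_id)
    · exact (hΦ.mul (measurable_seqLik hc v (n + 1))).comp (measurable_id.prodMk measurable_const)

end SequentialDensity

/-! ### Regression in the noisy observation model -/

section NoisyModel

variable {𝒜 Ω E : Type*} [MeasurableSpace 𝒜] [MeasurableSpace Ω] [MeasurableSpace E]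

/-- The values `g(a) = G(a, x)` form a Gaussian process with mean `ν` and covariance `q`, given
as a jointly measurable function of the query and of a random element `x` (the sample path of the
underlying function), and `ε` is an independent i.i.d. `N(0, σ²)` noise. -/
structure NoisyModel (x : Ω → E) (G : 𝒜 × E → ℝ) (ν : 𝒜 → ℝ) (q : 𝒜 → 𝒜 → ℝ) (σ : ℝ)
    (ε : ℕ → Ω → ℝ) (P : Measure Ω) : Prop where
  measurable_path : Measurable x
  measurable_value : Measurable G
  gaussian : IsGaussianProcess (fun a ω => G (a, x ω)) P
  mean : ∀ a, ∫ ω, G (a, x ω) ∂P = ν a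
  cov : ∀ a b, cov[fun ω => G (a, x ω), fun ω => G (b, x ω); P] = q a b
  noise_pos : 0 < σ
  measurable_noise : ∀ t, Measurable (ε t)
  law_noise : ∀ t, P.map (ε t) = gaussianReal 0 (Real.toNNReal (σ ^ 2))
  iIndep_noise : iIndepFun ε P
  indep : IndepFun x (fun ω t => ε t ω) P

namespace NoisyModel

variable {x : Ω → E} {G : 𝒜 × E → ℝ} {ν : 𝒜 → ℝ} {q : 𝒜 → 𝒜 → ℝ} {σ : ℝ} {ε : ℕ → Ω → ℝ}
  {P : Measure Ω}

lemma noise_ne_zero (h : NoisyModel x G ν q σ ε P) : Real.toNNReal (σ ^ 2) ≠ 0 := by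
  have := h.noise_pos
  rw [← pos_iff_ne_zero, Real.toNNReal_pos]
  positivity

lemma measurable_g (h : NoisyModel x G ν q σ ε P) (a : 𝒜) : Measurable fun ω => G (a, x ω) :=
  h.measurable_value.comp (measurable_const.prodMk h.measurable_path)

lemma memLp_g (h : NoisyModel x G ν q σ ε P) (a : 𝒜) : MemLp (fun ω => G (a, x ω)) 2 P :=
  (h.gaussian.hasGaussianLaw_eval a).memLp_two

lemma hasGaussianLaw_noise (h : NoisyModel x G ν q σ ε P) (t : ℕ) : HasGaussianLaw (ε t) P := by
  constructor
  rw [h.law_noise]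
  infer_instance

lemma memLp_noise (h : NoisyModel x G ν q σ ε P) (t : ℕ) : MemLp (ε t) 2 P :=
  (h.hasGaussianLaw_noise t).memLp_two

lemma indep_g_noise (h : NoisyModel x G ν q σ ε P) (a : 𝒜) (t : ℕ) :
    IndepFun (fun ω => G (a, x ω)) (ε t) P :=
  h.indep.comp (φ := fun e => G (a, e)) (ψ := fun y : ℕ → ℝ => y t)
    (h.measurable_value.comp (measurable_const.prodMk measurable_id)) (measurable_pi_apply t)

lemma integral_noise (h : NoisyModel x G ν q σ ε P) (t : ℕ) : ∫ ω, ε t ω ∂P = 0 := by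
  have h1 := integral_map (μ := P) (h.measurable_noise t).aemeasurable
    (f := fun y : ℝ => y) (by fun_prop)
  rw [h.law_noise, integral_id_gaussianReal] at h1
  exact h1.symm

lemma variance_noise (h : NoisyModel x G ν q σ ε P) (t : ℕ) : Var[ε t; P] = σ ^ 2 := by
  have h1 := variance_map (μ := P) (X := id) (Y := ε t) (by fun_prop)
    (h.measurable_noise t).aemeasurable
  rw [h.law_noise, variance_id_gaussianReal, Real.coe_toNNReal _ (sq_nonneg σ)] at h1
  exact h1.symm

lemma hasGaussianLaw_joint (h : NoisyModel x G ν q σ ε P) {n : ℕ} (A : Fin n → 𝒜) :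
    HasGaussianLaw (fun ω => ((fun i => G (A i, x ω)), fun i : Fin n => ε i ω)) P := by
  refine IndepFun.hasGaussianLaw ?_ ?_ ?_
  · have h1 := (h.gaussian.comp_right A).hasGaussianLaw Finset.univ
    exact h1.map_fun (ContinuousLinearMap.pi fun i : Fin n =>
      ContinuousLinearMap.proj (⟨i, Finset.mem_univ i⟩ : (Finset.univ : Finset (Fin n))))
  · exact iIndepFun.hasGaussianLaw (X := fun i : Fin n => ε i)
      (fun i => h.hasGaussianLaw_noise i) (h.iIndep_noise.precomp Fin.val_injective)
  · exact h.indep.comp (φ := fun e i => G (A i, e)) (ψ := fun (y : ℕ → ℝ) (i : Fin n) => y i)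
      (measurable_pi_lambda _ fun i =>
        h.measurable_value.comp (measurable_const.prodMk measurable_id))
      (measurable_pi_lambda _ fun i => measurable_pi_apply _)

variable [IsProbabilityMeasure P]

lemma cov_feedback (h : NoisyModel x G ν q σ ε P) (a b : 𝒜) (s s' : ℝ) (i j : ℕ) :
    cov[fun ω => G (a, x ω) + s * ε i ω, fun ω => G (b, x ω) + s' * ε j ω; P]
      = q a b + if i = j then s * s' * σ ^ 2 else 0 := by
  have hg := h.memLp_g
  have hn : ∀ (s : ℝ) i, MemLp (fun ω => s * ε i ω) 2 P := fun s i => (h.memLp_noise i).const_mul s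
  have hs : MemLp (fun ω => G (b, x ω) + s' * ε j ω) 2 P := (hg b).add (hn s' j)
  change cov[(fun ω => G (a, x ω)) + (fun ω => s * ε i ω), _; P] = _
  rw [covariance_add_left (hg a) (hn s i) hs]
  change cov[_, (fun ω => G (b, x ω)) + (fun ω => s' * ε j ω); P]
    + cov[_, (fun ω => G (b, x ω)) + (fun ω => s' * ε j ω); P] = _
  rw [covariance_add_right (hg a) (hg b) (hn s' j),
    covariance_add_right (hn s i) (hg b) (hn s' j), h.cov, covariance_const_mul_right,
    covariance_const_mul_left, covariance_const_mul_left, covariance_const_mul_right,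
    (h.indep_g_noise a j).covariance_eq_zero (hg a) (h.memLp_noise j),
    (h.indep_g_noise b i).symm.covariance_eq_zero (h.memLp_noise i) (hg b)]
  split_ifs with hij
  · subst hij
    rw [covariance_self (h.measurable_noise i).aemeasurable, h.variance_noise]
    ring
  · rw [(h.iIndep_noise.indepFun hij).covariance_eq_zero (h.memLp_noise i) (h.memLp_noise j)]
    ring

lemma isCovKernel (h : NoisyModel x G ν q σ ε P) : IsCovKernel q where
  symm a b := by rw [← h.cov, covariance_comm, h.cov]
  nonneg n A c := by
    have hm : ∀ i, MemLp (fun ω => c i * G (A i, x ω)) 2 P := fun i => (h.memLp_g _).const_mul _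
    have hs : MemLp (fun ω => ∑ i, c i * G (A i, x ω)) 2 P := memLp_finsetSum _ fun i _ => hm i
    have h1 := variance_nonneg (fun ω => ∑ i, c i * G (A i, x ω)) P
    rw [← covariance_self hs.aemeasurable, covariance_fun_sum_left hm hs] at h1
    refine h1.trans_eq (Finset.sum_congr rfl fun i _ => ?_)
    rw [covariance_fun_sum_right hm (hm i)]
    refine Finset.sum_congr rfl fun j _ => ?_
    rw [covariance_const_mul_left, covariance_const_mul_right, h.cov]
    ring

/-- The residual of the posterior mean as a predictor of `g(b) + s ε_n` is independent of the
feedbacks it is based on. -/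
lemma regression_residual (h : NoisyModel x G ν q σ ε P) {n : ℕ} (A : Fin n → 𝒜) (b : 𝒜) (s : ℝ) :
    IndepFun (fun ω => G (b, x ω) + s * ε n ω
        - postMean ν q σ A (fun i => G (A i, x ω) + ε i ω) b)
      (fun ω (i : Fin n) => G (A i, x ω) + ε i ω) P ∧
    P.map (fun ω => G (b, x ω) + s * ε n ω
        - postMean ν q σ A (fun i => G (A i, x ω) + ε i ω) b)
      = gaussianReal 0 (Real.toNNReal (postCov q σ A b b + s ^ 2 * σ ^ 2)) := by
  have hq := h.isCovKernel
  set w := postWeights q σ A b with hw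
  set U : Fin n → Ω → ℝ := fun i ω => G (A i, x ω) + ε i ω with hU
  set Y : Ω → ℝ := fun ω => G (b, x ω) + s * ε n ω with hY
  set R : Ω → ℝ := fun ω => Y ω - ∑ i, w i * U i ω with hR
  set C : ℝ := - ν b + ∑ i, w i * ν (A i) with hC
  have hres : (fun ω => G (b, x ω) + s * ε n ω
      - postMean ν q σ A (fun i => G (A i, x ω) + ε i ω) b) = fun ω => R ω + C := by
    ext ω
    simp only [postMean_eq_postWeights hq, hR, hY, hU, hC, mul_sub, Finset.sum_sub_distrib]
    ring
  rw [hres]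
  have hgauss : HasGaussianLaw (fun ω => ((fun _ : Unit => R ω), fun i => U i ω)) P := by
    have h1 := h.hasGaussianLaw_joint (Fin.snoc (α := fun _ => 𝒜) A b)
    let pr : Fin (n + 1) → (Fin (n + 1) → ℝ) →L[ℝ] ℝ := fun i => ContinuousLinearMap.proj i
    let F := ContinuousLinearMap.fst ℝ (Fin (n + 1) → ℝ) (Fin (n + 1) → ℝ)
    let S := ContinuousLinearMap.snd ℝ (Fin (n + 1) → ℝ) (Fin (n + 1) → ℝ)
    have h2 := h1.map_fun (ContinuousLinearMap.prod
      (ContinuousLinearMap.pi fun _ : Unit =>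
        (pr (Fin.last n)).comp F + s • (pr (Fin.last n)).comp S
          - ∑ i : Fin n, w i • ((pr i.castSucc).comp F + (pr i.castSucc).comp S))
      (ContinuousLinearMap.pi fun i : Fin n => (pr i.castSucc).comp F + (pr i.castSucc).comp S))
    refine h2.congr (ae_of_all _ fun ω => ?_)
    refine Prod.ext (funext fun _ => ?_) (funext fun i => ?_)
    · simp [pr, F, S, hR, hY, hU, mul_add]
    · simp [pr, F, S, hU]
  have hUm : ∀ i, MemLp (U i) 2 P := fun i => (h.memLp_g _).add (h.memLp_noise _)
  have hYm : MemLp Y 2 P := (h.memLp_g _).add ((h.memLp_noise _).const_mul s)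
  have hwU : ∀ i, MemLp (fun ω => w i * U i ω) 2 P := fun i => (hUm i).const_mul _
  have hsm : MemLp (fun ω => ∑ i, w i * U i ω) 2 P := memLp_finsetSum _ fun i _ => hwU i
  have hRm : MemLp R 2 P := hYm.sub hsm
  have hUU : ∀ i j, cov[U i, U j; P] = noisyGram q σ A i j := by
    intro i j
    have h1 := h.cov_feedback (A i) (A j) 1 1 i j
    simp only [one_mul] at h1
    refine h1.trans ?_
    simp [noisyGram, Matrix.one_apply, Fin.val_inj]
  have hYU : ∀ j, cov[Y, U j; P] = q b (A j) := by
    intro j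
    have h1 := h.cov_feedback b (A j) s 1 n j
    simp only [one_mul, if_neg (Nat.ne_of_gt j.2), add_zero] at h1
    exact h1
  have hRU : ∀ j, cov[R, U j; P] = 0 := by
    intro j
    rw [hR, covariance_fun_sub_left hYm hsm (hUm j), covariance_fun_sum_left hwU (hUm j), hYU]
    simp only [covariance_const_mul_left, hUU]
    have h1 := congrFun (noisyGram_mulVec_postWeights hq h.noise_pos A b) j
    rw [← h1, Matrix.mulVec, dotProduct, sub_eq_zero]
    refine Finset.sum_congr rfl fun i _ => ?_
    rw [mul_comm, ← Matrix.transpose_apply (noisyGram q σ A) j i, noisyGram_transpose hq]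
  have hind : IndepFun (fun ω (_ : Unit) => R ω) (fun ω i => U i ω) P :=
    HasGaussianLaw.indepFun_of_covariance_eval (X := fun _ => R) hgauss fun _ j => hRU j
  have hRG : HasGaussianLaw R P :=
    hgauss.map_fun ((ContinuousLinearMap.proj ()).comp (ContinuousLinearMap.fst ℝ _ _))
  refine ⟨?_, ?_⟩
  · exact hind.comp (φ := fun r : Unit → ℝ => r () + C) (ψ := id) (by fun_prop) measurable_id
  · have hmean : ∫ ω, R ω ∂P = -C := by
      have hgi : ∀ a, Integrable (fun ω => G (a, x ω)) P := fun a =>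
        (h.memLp_g a).integrable one_le_two
      have hni : ∀ t, Integrable (ε t) P := fun t => (h.memLp_noise t).integrable one_le_two
      have hEU : ∀ i, ∫ ω, U i ω ∂P = ν (A i) := fun i => by
        rw [hU, integral_add (hgi _) (hni _), h.mean, h.integral_noise, add_zero]
      rw [hR, integral_sub (hYm.integrable one_le_two) (hsm.integrable one_le_two),
        integral_finsetSum _ fun i _ => (hwU i).integrable one_le_two]
      simp only [integral_const_mul, hEU]
      rw [hY, integral_add (hgi _) ((hni _).const_mul _), h.mean, integral_const_mul,
        h.integral_noise]
      rw [hC]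
      ring
    have hvar : Var[R; P] = postCov q σ A b b + s ^ 2 * σ ^ 2 := by
      have h1 := h.cov_feedback b b s s n n
      rw [if_pos rfl] at h1
      have h2 : cov[R, Y; P] = postCov q σ A b b + s ^ 2 * σ ^ 2 := by
        conv_lhs => rw [hR]
        rw [covariance_fun_sub_left hYm hsm hYm, covariance_fun_sum_left hwU hYm,
          postCov_self_eq hq, h1]
        simp only [covariance_const_mul_left, covariance_comm (U _) Y, hYU]
        ring
      have h3 : cov[R, fun ω => ∑ i, w i * U i ω; P] = 0 := by
        rw [covariance_fun_sum_right hwU hRm]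
        simp [covariance_const_mul_right, hRU]
      rw [← covariance_self hRm.aemeasurable]
      conv_lhs => arg 2; rw [hR]
      rw [covariance_fun_sub_right hRm hYm hsm, h2, h3, sub_zero]
    have hRmeas : AEMeasurable R P := hRm.aemeasurable
    change P.map ((fun r => r + C) ∘ R) = _
    rw [← AEMeasurable.map_map_of_aemeasurable (by fun_prop) hRmeas, hRG.map_eq_gaussianReal,
      gaussianReal_map_add_const, hmean, hvar, neg_add_cancel]

end NoisyModel
end NoisyModel

/-! ### Bayes' rule at fixed queries -/

section Independence

variable {Ω : Type*} [MeasurableSpace Ω] {P : Measure Ω} [IsProbabilityMeasure P]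

lemma indepFun_prodMk_of_indepFun_prodMk {α β γ : Type*} [MeasurableSpace α] [MeasurableSpace β]
    [MeasurableSpace γ] {X : Ω → α} {Y : Ω → β} {W : Ω → γ} (hX : Measurable X)
    (hY : Measurable Y) (hW : Measurable W) (h1 : IndepFun X Y P)
    (h2 : IndepFun (fun ω => (X ω, Y ω)) W P) : IndepFun X (fun ω => (Y ω, W ω)) P := by
  have h3 : IndepFun Y W P := h2.comp (φ := Prod.snd) (ψ := id) measurable_snd measurable_id
  rw [indepFun_iff_map_prod_eq_prod_map_map hX.aemeasurable (hY.prodMk hW).aemeasurable,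
    (indepFun_iff_map_prod_eq_prod_map_map hY.aemeasurable hW.aemeasurable).1 h3,
    ← Measure.prodAssoc_prod,
    ← (indepFun_iff_map_prod_eq_prod_map_map hX.aemeasurable hY.aemeasurable).1 h1,
    ← (indepFun_iff_map_prod_eq_prod_map_map (hX.prodMk hY).aemeasurable hW.aemeasurable).1 h2,
    Measure.map_map MeasurableEquiv.prodAssoc.measurable ((hX.prodMk hY).prodMk hW)]
  rfl

variable {W : Type*} [MeasurableSpace W] {w : Ω → W} {ε z : ℕ → Ω → ℝ} {v : ℝ≥0}
  {c : (n : ℕ) → (Fin n → ℝ) × W → ℝ}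

/-- Sequential observations are a measurable function of the noise and the side information. -/
lemma exists_measurable_prefix (hc : ∀ n, Measurable (c n))
    (hz : ∀ n ω, z n ω = c n (fun i : Fin n => z i ω, w ω) + ε n ω) (n : ℕ) :
    ∃ ψ : (Fin n → ℝ) × W → (Fin n → ℝ), Measurable ψ ∧
      ∀ ω, (fun i : Fin n => z i ω) = ψ (fun i : Fin n => ε i ω, w ω) := by
  induction n with
  | zero => exact ⟨fun y => y.1, measurable_fst, fun ω => Subsingleton.elim _ _⟩
  | succ n ih =>
    obtain ⟨ψ, hψ, hψz⟩ := ih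
    have h1 : Measurable fun y : (Fin (n + 1) → ℝ) × W =>
        ψ (fun i : Fin n => y.1 i.castSucc, y.2) :=
      hψ.comp (Measurable.prodMk
        (measurable_pi_lambda _ fun i => (measurable_pi_apply _).comp measurable_fst)
        measurable_snd)
    refine ⟨fun y => Fin.snoc (α := fun _ => ℝ) (ψ (fun i : Fin n => y.1 i.castSucc, y.2))
      (c n (ψ (fun i : Fin n => y.1 i.castSucc, y.2), y.2) + y.1 (Fin.last n)), ?_, fun ω => ?_⟩
    · exact measurable_snoc.comp (h1.prodMk (((hc n).comp (h1.prodMk measurable_snd)).add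
        ((measurable_pi_apply _).comp measurable_fst)))
    · have h2 := hψz ω
      funext i
      induction i using Fin.lastCases with
      | last => simp only [Fin.snoc_last, Fin.val_last, Fin.val_castSucc]; rw [← h2, ← hz]
      | cast i => simp only [Fin.snoc_castSucc, Fin.val_castSucc]; rw [← h2]

lemma measurable_sequential (hw : Measurable w) (hε : ∀ n, Measurable (ε n))
    (hc : ∀ n, Measurable (c n))
    (hz : ∀ n ω, z n ω = c n (fun i : Fin n => z i ω, w ω) + ε n ω) (n : ℕ) :
    Measurable (z n) := by
  obtain ⟨ψ, hψ, hψz⟩ := exists_measurable_prefix hc hz (n + 1)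
  have h1 : Measurable fun ω => ψ (fun i : Fin (n + 1) => ε i ω, w ω) :=
    hψ.comp ((measurable_pi_lambda _ fun i : Fin (n + 1) => hε i).prodMk hw)
  rw [← funext hψz] at h1
  exact (measurable_pi_apply (Fin.last n)).comp h1

/-- The joint law of sequential observations with i.i.d. Gaussian noise that is independent of
the side information `w`. -/
theorem lintegral_sequential_of_noise (hw : Measurable w) (hε : ∀ n, Measurable (ε n))
    (hlaw : ∀ n, P.map (ε n) = gaussianReal 0 v) (hv : v ≠ 0) (hi : iIndepFun ε P)
    (hwε : IndepFun w (fun ω t => ε t ω) P) (hc : ∀ n, Measurable (c n))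
    (hz : ∀ n ω, z n ω = c n (fun i : Fin n => z i ω, w ω) + ε n ω)
    (n : ℕ) {Φ : (Fin n → ℝ) × W → ℝ≥0∞} (hΦ : Measurable Φ) :
    ∫⁻ ω, Φ (fun i : Fin n => z i ω, w ω) ∂P
      = ∫⁻ ω, (∫⁻ u : Fin n → ℝ, Φ (u, w ω) * seqLik c (fun _ => v) n (u, w ω)) ∂P := by
  have hεv : ∀ n, Measurable fun ω (i : Fin n) => ε i ω := fun n =>
    measurable_pi_lambda _ fun i => hε i
  have hzm : ∀ n, Measurable (z n) := measurable_sequential hw hε hc hz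
  have hsub : ∀ n, (fun ω => z n ω - c n (fun i : Fin n => z i ω, w ω)) = ε n := fun n => by
    ext ω
    rw [hz n ω]
    ring
  refine lintegral_sequential hzm hw hc (fun _ => hv) (fun n => by rw [hsub, hlaw])
    (fun n => ?_) n hΦ
  rw [hsub]
  have h1 : IndepFun (ε n) (fun ω (i : Fin n) => ε i ω) P := by
    have h := hi.indepFun_finset {n} (Finset.range n) (by simp) hε
    exact h.comp (φ := fun y : (({n} : Finset ℕ) → ℝ) => y ⟨n, by simp⟩)
      (ψ := fun (y : Finset.range n → ℝ) (i : Fin n) => y ⟨i, by simp⟩)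
      (measurable_pi_apply _) (measurable_pi_lambda _ fun i => measurable_pi_apply _)
  have h2 : IndepFun (fun ω => (ε n ω, fun i : Fin n => ε i ω)) w P :=
    (hwε.comp (φ := id) (ψ := fun y : ℕ → ℝ => (y n, fun i : Fin n => y i)) measurable_id
      (by fun_prop)).symm
  have h3 := indepFun_prodMk_of_indepFun_prodMk (hε n) (hεv n) hw h1 h2
  obtain ⟨ψ, hψ, hψz⟩ := exists_measurable_prefix hc hz n
  rw [show (fun ω => ((fun i : Fin n => z i ω), w ω))
      = fun ω => (ψ (fun i : Fin n => ε i ω, w ω), w ω) from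
    funext fun ω => by rw [← hψz ω]]
  exact h3.comp (φ := id) (ψ := fun y => (ψ y, y.2)) measurable_id (hψ.prodMk measurable_snd)

end Independence

section Bayes

lemma gaussianPDF_le (μ : ℝ) (v : ℝ≥0) (t : ℝ) :
    gaussianPDF μ v t ≤ ENNReal.ofReal (Real.sqrt (2 * Real.pi * v))⁻¹ := by
  apply ENNReal.ofReal_le_ofReal
  rw [gaussianPDFReal]
  refine mul_le_of_le_one_right (by positivity) (Real.exp_le_one_iff.2 ?_)
  rw [neg_div]
  exact neg_nonpos.2 (by positivity)

lemma continuous_gaussianPDF (μ : ℝ) (v : ℝ≥0) : Continuous (gaussianPDF μ v) := by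
  refine ENNReal.continuous_ofReal.comp ?_
  unfold gaussianPDFReal
  fun_prop

variable {𝒜 Ω E : Type*} [MeasurableSpace 𝒜] [MeasurableSpace Ω] [MeasurableSpace E]
  {x : Ω → E} {G : 𝒜 × E → ℝ} {ν : 𝒜 → ℝ} {q : 𝒜 → 𝒜 → ℝ} {σ : ℝ} {ε : ℕ → Ω → ℝ}
  {P : Measure Ω}

/-- The likelihood of the feedbacks `u` at the queries `A`, for the sample path `e`. -/
noncomputable def feedbackLik (G : 𝒜 × E → ℝ) (σ : ℝ) {n : ℕ} (A : Fin n → 𝒜) (u : Fin n → ℝ)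
    (e : E) : ℝ≥0∞ :=
  ∏ i, gaussianPDF (G (A i, e)) (Real.toNNReal (σ ^ 2)) (u i)

lemma feedbackLik_le (G : 𝒜 × E → ℝ) (σ : ℝ) {n : ℕ} (A : Fin n → 𝒜) (u : Fin n → ℝ) (e : E) :
    feedbackLik G σ A u e
      ≤ ENNReal.ofReal (Real.sqrt (2 * Real.pi * Real.toNNReal (σ ^ 2)))⁻¹ ^ n := by
  refine (Finset.prod_le_prod' fun i _ => gaussianPDF_le _ _ _).trans_eq ?_
  simp

lemma feedbackLik_ne_top (G : 𝒜 × E → ℝ) (σ : ℝ) {n : ℕ} (A : Fin n → 𝒜) (u : Fin n → ℝ) (e : E) :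
    feedbackLik G σ A u e ≠ ∞ :=
  ne_top_of_le_ne_top (ENNReal.pow_ne_top ENNReal.ofReal_ne_top) (feedbackLik_le G σ A u e)

lemma continuous_feedbackLik (G : 𝒜 × E → ℝ) (σ : ℝ) {n : ℕ} (A : Fin n → 𝒜) (e : E) :
    Continuous fun u => feedbackLik G σ A u e := by
  refine continuous_iff_continuousAt.2 fun u => ?_
  refine ENNReal.tendsto_finsetProd_of_ne_top _ (fun i _ => ?_) fun i _ => gaussianPDF_ne_top
  exact ((continuous_gaussianPDF _ _).comp (continuous_apply i)).continuousAt

lemma measurable_feedbackLik (hG : Measurable G) (σ : ℝ) {n : ℕ} (A : Fin n → 𝒜) :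
    Measurable fun y : (Fin n → ℝ) × E => feedbackLik G σ A y.1 y.2 := by
  refine Finset.measurable_fun_prod _ fun i _ => ?_
  exact measurable_uncurry_gaussianPDF.comp
    ((hG.comp (measurable_const.prodMk measurable_snd)).prodMk
      (measurable_const.prodMk ((measurable_pi_apply i).comp measurable_fst)))

lemma measurable_feedbackLik_path (hG : Measurable G) (hx : Measurable x) (σ : ℝ) {n : ℕ}
    (A : Fin n → 𝒜) (u : Fin n → ℝ) : Measurable fun ω => feedbackLik G σ A u (x ω) := by
  refine Finset.measurable_fun_prod _ fun i _ => ?_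
  exact measurable_uncurry_gaussianPDF.comp
    ((hG.comp (measurable_const.prodMk hx)).prodMk (measurable_const.prodMk measurable_const))

lemma continuous_postMean (hq : IsCovKernel q) (ν : 𝒜 → ℝ) (σ : ℝ) {n : ℕ} (A : Fin n → 𝒜)
    (b : 𝒜) : Continuous fun u => postMean ν q σ A u b := by
  simp_rw [postMean_eq_postWeights hq]
  fun_prop

variable [IsProbabilityMeasure P]

namespace NoisyModel

lemma lintegral_nonadaptive (h : NoisyModel x G ν q σ ε P) {n : ℕ} (A : Fin n → 𝒜)
    {Φ : (Fin n → ℝ) × E → ℝ≥0∞} (hΦ : Measurable Φ) :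
    ∫⁻ ω, Φ (fun i => G (A i, x ω) + ε i ω, x ω) ∂P
      = ∫⁻ ω, (∫⁻ u : Fin n → ℝ, Φ (u, x ω) * feedbackLik G σ A u (x ω)) ∂P := by
  obtain rfl | hn := n.eq_zero_or_pos
  · refine lintegral_congr fun ω => ?_
    rw [show (volume : Measure (Fin 0 → ℝ)) = Measure.dirac default from
      Measure.volume_pi_eq_dirac default, lintegral_dirac]
    simp only [feedbackLik, Finset.univ_eq_empty, Finset.prod_empty, mul_one]
    congr 2
    exact Subsingleton.elim _ _
  -- any continuation of the finite family of queries will do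
  set B : ℕ → 𝒜 := fun i => if hi : i < n then A ⟨i, hi⟩ else A ⟨0, hn⟩ with hB
  have hBA : ∀ i : Fin n, B i = A i := fun i => by simp [hB]
  have h1 := lintegral_sequential_of_noise (c := fun n y => G (B n, y.2))
    (z := fun n ω => G (B n, x ω) + ε n ω) h.measurable_path h.measurable_noise h.law_noise
    h.noise_ne_zero h.iIndep_noise h.indep
    (fun n => h.measurable_value.comp (measurable_const.prodMk measurable_snd))
    (fun n ω => rfl) n hΦ
  simp only [hBA] at h1
  rw [h1]
  simp only [seqLik, feedbackLik, hBA]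

/-- Weighted averages of a bounded continuous function of the residual depend continuously on the
feedbacks. -/
lemma continuous_lintegral_residual (h : NoisyModel x G ν q σ ε P) {n : ℕ} (A : Fin n → 𝒜) (b : 𝒜)
    (φ : BoundedContinuousFunction ℝ ℝ≥0) :
    Continuous fun u : Fin n → ℝ => ∫⁻ ω, φ (G (b, x ω) - postMean ν q σ A u b)
      * feedbackLik G σ A u (x ω) ∂P := by
  have hpm := continuous_postMean h.isCovKernel ν σ A b
  have hmeas : ∀ u : Fin n → ℝ, Measurable fun ω =>
      (φ (G (b, x ω) - postMean ν q σ A u b) : ℝ≥0∞) * feedbackLik G σ A u (x ω) := fun u =>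
    ((φ.continuous.measurable.comp ((h.measurable_g b).sub_const _)).coe_nnreal_ennreal).mul
      (measurable_feedbackLik_path h.measurable_value h.measurable_path σ A u)
  set K : ℝ≥0 := nndist φ 0
  have hK : ∀ t, φ t ≤ K := BoundedContinuousFunction.NNReal.upper_bound φ
  refine continuous_iff_seqContinuous.2 fun u a hu => ?_
  refine tendsto_lintegral_of_dominated_convergence
    (fun _ => K * ENNReal.ofReal (Real.sqrt (2 * Real.pi * Real.toNNReal (σ ^ 2)))⁻¹ ^ n)
    (fun k => hmeas (u k)) (fun k => ae_of_all _ fun ω => ?_) ?_ (ae_of_all _ fun ω => ?_)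
  · exact mul_le_mul' (ENNReal.coe_le_coe.2 (hK _)) (feedbackLik_le _ _ _ _ _)
  · rw [lintegral_const, measure_univ, mul_one]
    exact ENNReal.mul_ne_top ENNReal.coe_ne_top (ENNReal.pow_ne_top ENNReal.ofReal_ne_top)
  · refine ENNReal.Tendsto.mul ?_ (Or.inr ?_) ?_ (Or.inr ENNReal.coe_ne_top)
    · refine ENNReal.tendsto_coe.2 ?_
      exact (φ.continuous.tendsto _).comp (((hpm.tendsto a).comp hu).const_sub _)
    · exact feedbackLik_ne_top _ _ _ _ _
    · exact ((continuous_feedbackLik G σ A (x ω)).tendsto a).comp hu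

/-- Bayes' rule for fixed queries, valid for every value `u` of the feedbacks: under the law of
`x` weighted by the likelihood of `u`, the residual `g(b) - ν_u(b)` is Gaussian with the posterior
variance. For almost every `u` this is the independence of residual and feedbacks; both sides are
continuous in `u`. -/
theorem map_residual_withDensity (h : NoisyModel x G ν q σ ε P) {n : ℕ} (A : Fin n → 𝒜) (b : 𝒜)
    (u : Fin n → ℝ) :
    (P.withDensity fun ω => feedbackLik G σ A u (x ω)).map
        (fun ω => G (b, x ω) - postMean ν q σ A u b)
      = (∫⁻ ω, feedbackLik G σ A u (x ω) ∂P) •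
          gaussianReal 0 (Real.toNNReal (postCov q σ A b b)) := by
  have hlm : Measurable fun y : (Fin n → ℝ) × E => feedbackLik G σ A y.1 y.2 :=
    measurable_feedbackLik h.measurable_value σ A
  have hlm' : ∀ u, Measurable fun ω => feedbackLik G σ A u (x ω) := fun u =>
    measurable_feedbackLik_path h.measurable_value h.measurable_path σ A u
  have hpm := continuous_postMean h.isCovKernel ν σ A b
  have hfin : ∀ u, ∫⁻ ω, feedbackLik G σ A u (x ω) ∂P ≠ ∞ := by
    intro u
    refine ne_top_of_le_ne_top ?_ (lintegral_mono fun ω => feedbackLik_le G σ A u (x ω))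
    rw [lintegral_const, measure_univ, mul_one]
    exact ENNReal.pow_ne_top ENNReal.ofReal_ne_top
  have : IsFiniteMeasure (P.withDensity fun ω => feedbackLik G σ A u (x ω)) :=
    isFiniteMeasure_withDensity (hfin u)
  refine ext_of_forall_lintegral_eq_of_IsFiniteMeasure fun φ => ?_
  have hφ : Measurable fun t : ℝ => (φ t : ℝ≥0∞) := φ.continuous.measurable.coe_nnreal_ennreal
  have hφR : Measurable fun ω => (φ (G (b, x ω) - postMean ν q σ A u b) : ℝ≥0∞) :=
    hφ.comp ((h.measurable_g b).sub_const _)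
  rw [lintegral_map hφ ((h.measurable_g b).sub_const _),
    lintegral_withDensity_eq_lintegral_mul _ (hlm' u) hφR, lintegral_smul_measure]
  set κ : ℝ≥0∞ := ∫⁻ t, φ t ∂(gaussianReal 0 (Real.toNNReal (postCov q σ A b b))) with hκ
  have hκfin : κ ≠ ∞ := φ.lintegral_lt_top_of_nnreal _ |>.ne
  have hD := h.continuous_lintegral_residual (ν := ν) A b φ
  have hN : Continuous fun u : Fin n → ℝ => κ * ∫⁻ ω, feedbackLik G σ A u (x ω) ∂P := by
    have h1 := h.continuous_lintegral_residual (ν := ν) A b (BoundedContinuousFunction.const ℝ 1)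
    simp only [BoundedContinuousFunction.const_apply, ENNReal.coe_one, one_mul] at h1
    exact ENNReal.continuous_const_mul hκfin |>.comp h1
  have hae : (fun u : Fin n → ℝ => ∫⁻ ω, φ (G (b, x ω) - postMean ν q σ A u b)
        * feedbackLik G σ A u (x ω) ∂P)
      =ᵐ[volume] fun u => κ * ∫⁻ ω, feedbackLik G σ A u (x ω) ∂P := by
    refine ae_eq_of_forall_setLIntegral_eq_of_sigmaFinite hD.measurable hN.measurable
      fun s hs _ => ?_
    obtain ⟨hind, hlaw⟩ := h.regression_residual A b 0
    simp only [zero_mul, add_zero, ne_eq, OfNat.ofNat_ne_zero, not_false_eq_true, zero_pow]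
      at hind hlaw
    have hUm : Measurable fun ω => (fun i : Fin n => G (A i, x ω) + ε i ω) :=
      measurable_pi_lambda _ fun i => (h.measurable_g _).add (h.measurable_noise _)
    have hRm : Measurable fun ω =>
        G (b, x ω) - postMean ν q σ A (fun i => G (A i, x ω) + ε i ω) b :=
      (h.measurable_g b).sub (hpm.measurable.comp hUm)
    have hs1 : Measurable (s.indicator (fun _ => (1 : ℝ≥0∞))) := measurable_const.indicator hs
    -- the joint law of residual and feedbacks, computed in two ways
    have e1 := h.lintegral_nonadaptive A
      (Φ := fun y => s.indicator (fun _ => 1) y.1 * φ (G (b, y.2) - postMean ν q σ A y.1 b))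
      ((hs1.comp measurable_fst).mul (hφ.comp
        ((h.measurable_value.comp (measurable_const.prodMk measurable_snd)).sub
          (hpm.measurable.comp measurable_fst))))
    have e2 := h.lintegral_nonadaptive A (Φ := fun y => s.indicator (fun _ => 1) y.1)
      (hs1.comp measurable_fst)
    have e3 := lintegral_mul_eq_lintegral_mul_lintegral_of_indepFun
      (hφ.comp hRm) (hs1.comp hUm) (hind.comp hφ hs1)
    have e4 : ∫⁻ ω, φ (G (b, x ω) - postMean ν q σ A (fun i => G (A i, x ω) + ε i ω) b) ∂P = κ := by
      rw [hκ, ← hlaw, lintegral_map hφ hRm]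
    have swap1 : ∀ F : (Fin n → ℝ) × E → ℝ≥0∞, Measurable F →
        ∫⁻ ω, (∫⁻ u : Fin n → ℝ, s.indicator (fun _ => 1) u * F (u, x ω)) ∂P
          = ∫⁻ u in s, ∫⁻ ω, F (u, x ω) ∂P := by
      intro F hF
      have hF2 : Measurable fun y : Ω × (Fin n → ℝ) => F (y.2, x y.1) :=
        hF.comp (measurable_snd.prodMk (h.measurable_path.comp measurable_fst))
      rw [lintegral_lintegral_swap (((hs1.comp measurable_snd).mul hF2).aemeasurable),
        ← lintegral_indicator hs]
      refine lintegral_congr fun u => ?_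
      have hF3 : Measurable fun ω => F (u, x ω) :=
        hF.comp (measurable_const.prodMk h.measurable_path)
      rw [lintegral_const_mul _ hF3]
      by_cases hu : u ∈ s <;> simp [hu]
    have hF1 : Measurable fun y : (Fin n → ℝ) × E =>
        (φ (G (b, y.2) - postMean ν q σ A y.1 b) : ℝ≥0∞) * feedbackLik G σ A y.1 y.2 :=
      (hφ.comp ((h.measurable_value.comp (measurable_const.prodMk measurable_snd)).sub
        (hpm.measurable.comp measurable_fst))).mul hlm
    calc ∫⁻ u in s, ∫⁻ ω, φ (G (b, x ω) - postMean ν q σ A u b) * feedbackLik G σ A u (x ω) ∂P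
        = ∫⁻ ω, ((fun t : ℝ => (φ t : ℝ≥0∞)) ∘ fun ω =>
              G (b, x ω) - postMean ν q σ A (fun i => G (A i, x ω) + ε i ω) b) ω *
            (s.indicator (fun _ => (1 : ℝ≥0∞)) ∘ fun ω => fun i => G (A i, x ω) + ε i ω) ω ∂P := by
          rw [← swap1 _ hF1]
          simp only [← mul_assoc]
          rw [← e1]
          exact lintegral_congr fun ω => mul_comm _ _
      _ = κ * ∫⁻ ω, s.indicator (fun _ => (1 : ℝ≥0∞)) (fun i => G (A i, x ω) + ε i ω) ∂P := by
          rw [← e4]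
          exact e3
      _ = κ * ∫⁻ u in s, ∫⁻ ω, feedbackLik G σ A u (x ω) ∂P := by
          rw [e2, swap1 _ hlm]
      _ = _ := by
          rw [lintegral_const_mul' _ _ hκfin]
  have heq := congrFun ((hD.ae_eq_iff_eq volume hN).1 hae) u
  calc _ = ∫⁻ ω, φ (G (b, x ω) - postMean ν q σ A u b) * feedbackLik G σ A u (x ω) ∂P :=
        lintegral_congr fun ω => mul_comm _ _
    _ = κ * ∫⁻ ω, feedbackLik G σ A u (x ω) ∂P := heq
    _ = _ := by rw [mul_comm, smul_eq_mul]

end NoisyModel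
end Bayes

/-! ### The confidence bound for adaptive queries -/

section PosteriorMeasurable

variable {𝒜 S : Type*} [MeasurableSpace 𝒜] [MeasurableSpace S] {ν : 𝒜 → ℝ} {q : 𝒜 → 𝒜 → ℝ}
  {σ : ℝ} {n : ℕ}

lemma measurable_inv_apply {M : S → Matrix (Fin n) (Fin n) ℝ}
    (hM : ∀ i j, Measurable fun s => M s i j) (i j : Fin n) :
    Measurable fun s => (M s)⁻¹ i j := by
  have hM' : Measurable fun s => (fun i j => M s i j : Fin n → Fin n → ℝ) :=
    measurable_pi_lambda _ fun i => measurable_pi_lambda _ fun j => hM i j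
  have h1 : Measurable fun N : Fin n → Fin n → ℝ => (Matrix.of N).det := by
    refine Continuous.measurable ?_
    exact Continuous.matrix_det (by fun_prop)
  have h2 : Measurable fun N : Fin n → Fin n → ℝ => (Matrix.of N).adjugate i j := by
    refine Continuous.measurable ?_
    have : Continuous fun N : Fin n → Fin n → ℝ => (Matrix.of N).adjugate :=
      Continuous.matrix_adjugate (by fun_prop)
    exact this.matrix_elem i j
  have h3 : (fun s => (M s)⁻¹ i j) = fun s => (Matrix.of fun i j => M s i j).det⁻¹ *
      (Matrix.of fun i j => M s i j).adjugate i j := by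
    ext s
    rw [Matrix.inv_def, Matrix.smul_apply, Ring.inverse_eq_inv', smul_eq_mul]
    rfl
  rw [h3]
  exact (h1.comp hM').inv.mul (h2.comp hM')

lemma measurable_noisyGram_inv (hq : Measurable fun y : 𝒜 × 𝒜 => q y.1 y.2)
    {A : S → Fin n → 𝒜} (hA : ∀ i, Measurable fun s => A s i) (i j : Fin n) :
    Measurable fun s => (noisyGram q σ (A s))⁻¹ i j := by
  refine measurable_inv_apply (fun i j => ?_) i j
  simp only [noisyGram, Matrix.add_apply, Matrix.of_apply]
  exact (hq.comp ((hA i).prodMk (hA j))).add_const _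

lemma measurable_postMean (hν : Measurable ν) (hq : Measurable fun y : 𝒜 × 𝒜 => q y.1 y.2)
    {A : S → Fin n → 𝒜} (hA : ∀ i, Measurable fun s => A s i) {u : S → Fin n → ℝ}
    (hu : ∀ i, Measurable fun s => u s i) {b : S → 𝒜} (hb : Measurable b) :
    Measurable fun s => postMean ν q σ (A s) (u s) (b s) := by
  simp only [postMean, dotProduct, Matrix.mulVec]
  refine (hν.comp hb).add (Finset.measurable_fun_sum _ fun i _ => ?_)
  refine (hq.comp (hb.prodMk (hA i))).mul (Finset.measurable_fun_sum _ fun j _ => ?_)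
  exact (measurable_noisyGram_inv hq hA i j).mul ((hu j).sub (hν.comp (hA j)))

lemma measurable_postStd (hq : Measurable fun y : 𝒜 × 𝒜 => q y.1 y.2)
    {A : S → Fin n → 𝒜} (hA : ∀ i, Measurable fun s => A s i) {b : S → 𝒜} (hb : Measurable b) :
    Measurable fun s => postStd q σ (A s) (b s) := by
  simp only [postStd, postCov, dotProduct, Matrix.mulVec]
  refine Measurable.sqrt ((hq.comp (hb.prodMk hb)).sub (Finset.measurable_fun_sum _ fun i _ => ?_))
  refine (hq.comp (hb.prodMk (hA i))).mul (Finset.measurable_fun_sum _ fun j _ => ?_)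
  exact (measurable_noisyGram_inv hq hA i j).mul (hq.comp ((hA j).prodMk hb))

end PosteriorMeasurable

section AdaptiveTail

variable {𝒜 Ω E F : Type*} [MeasurableSpace 𝒜] [MeasurableSpace Ω] [MeasurableSpace E]
  [MeasurableSpace F]
  {x : Ω → E} {G : 𝒜 × E → ℝ} {ν : 𝒜 → ℝ} {q : 𝒜 → 𝒜 → ℝ} {σ : ℝ} {ε : ℕ → Ω → ℝ}
  {P : Measure Ω} [IsProbabilityMeasure P]

lemma NoisyModel.measurable_mean (h : NoisyModel x G ν q σ ε P) : Measurable ν := by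
  have h1 : StronglyMeasurable fun y : 𝒜 × Ω => G (y.1, x y.2) :=
    (h.measurable_value.comp
      (measurable_fst.prodMk (h.measurable_path.comp measurable_snd))).stronglyMeasurable
  have h2 := h1.integral_prod_right' (ν := P)
  simp only [h.mean] at h2
  exact h2.measurable

lemma NoisyModel.measurable_cov (h : NoisyModel x G ν q σ ε P) :
    Measurable fun y : 𝒜 × 𝒜 => q y.1 y.2 := by
  have hG : ∀ φ : 𝒜 × 𝒜 → 𝒜, Measurable φ →
      Measurable fun y : (𝒜 × 𝒜) × Ω => G (φ y.1, x y.2) := fun φ hφ =>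
    h.measurable_value.comp ((hφ.comp measurable_fst).prodMk
      (h.measurable_path.comp measurable_snd))
  have h1 : StronglyMeasurable fun y : (𝒜 × 𝒜) × Ω => G (y.1.1, x y.2) * G (y.1.2, x y.2) :=
    ((hG _ measurable_fst).mul (hG _ measurable_snd)).stronglyMeasurable
  have h2 := (h1.integral_prod_right' (ν := P)).measurable
  have h3 : (fun y : 𝒜 × 𝒜 => q y.1 y.2)
      = fun y => (∫ ω, G (y.1, x ω) * G (y.2, x ω) ∂P) - ν y.1 * ν y.2 := by
    ext y
    rw [← h.cov, covariance_eq_sub (h.memLp_g _) (h.memLp_g _), ← h.mean, ← h.mean]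
    rfl
  rw [h3]
  exact h2.sub ((h.measurable_mean.comp measurable_fst).mul (h.measurable_mean.comp measurable_snd))

variable {y : Ω → F} {z : ℕ → Ω → ℝ} {α : (n : ℕ) → (Fin n → ℝ) × F → 𝒜}

/-- The queries selected by the policy `α` when the feedbacks are `u` and the side information
is `y`. -/
def policyQueries (α : (n : ℕ) → (Fin n → ℝ) × F → 𝒜) {n : ℕ} (s : (Fin n → ℝ) × F) (i : Fin n) :
    𝒜 :=
  α i (fun j : Fin i => s.1 (j.castLE i.2.le), s.2)

lemma measurable_policyQueries (hα : ∀ n, Measurable (α n)) {n : ℕ} (i : Fin n) :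
    Measurable fun s : (Fin n → ℝ) × F => policyQueries α s i :=
  (hα i).comp (Measurable.prodMk
      (measurable_pi_lambda _ fun _ => (measurable_pi_apply _).comp measurable_fst) measurable_snd)

/-- The Gaussian tail bound for adaptively chosen queries. The queries may depend on the past
feedbacks and on side information `y` that is independent of path and noise; given any event of
this information, `g` is below the lower confidence bound with at most the Gaussian probability. -/
theorem NoisyModel.measure_below_confidence_le (h : NoisyModel x G ν q σ ε P)
    (hqpos : ∀ a, 0 < q a a) (hy : Measurable y) (hxy : IndepFun x y P)
    (hxyε : IndepFun (fun ω => (x ω, y ω)) (fun ω t => ε t ω) P) (hα : ∀ n, Measurable (α n))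
    (hz : ∀ n ω, z n ω = G (α n (fun i : Fin n => z i ω, y ω), x ω) + ε n ω)
    {ζ : ℝ} (hζ : 0 ≤ ζ) (n : ℕ) {S : Set ((Fin n → ℝ) × F)} (hS : MeasurableSet S) :
    P {ω | (fun i : Fin n => z i ω, y ω) ∈ S ∧
        G (α n (fun i : Fin n => z i ω, y ω), x ω)
          < postMean ν q σ (policyQueries α (fun i : Fin n => z i ω, y ω)) (fun i : Fin n => z i ω)
              (α n (fun i : Fin n => z i ω, y ω))
            - ζ * postStd q σ (policyQueries α (fun i : Fin n => z i ω, y ω))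
              (α n (fun i : Fin n => z i ω, y ω))}
      ≤ ENNReal.ofReal (Real.exp (-ζ ^ 2 / 2) / 2)
        * P {ω | (fun i : Fin n => z i ω, y ω) ∈ S} := by
  set w : Ω → E × F := fun ω => (x ω, y ω) with hw
  have hwm : Measurable w := h.measurable_path.prodMk hy
  set c : (n : ℕ) → (Fin n → ℝ) × (E × F) → ℝ := fun n s => G (α n (s.1, s.2.2), s.2.1) with hc
  have hcm : ∀ n, Measurable (c n) := fun n =>
    h.measurable_value.comp (((hα n).comp (measurable_fst.prodMk
      (measurable_snd.comp measurable_snd))).prodMk (measurable_fst.comp measurable_snd))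
  have hzc : ∀ n ω, z n ω = c n (fun i : Fin n => z i ω, w ω) + ε n ω := hz
  have hseq := fun {Φ} hΦ => lintegral_sequential_of_noise (Φ := Φ) hwm h.measurable_noise
    h.law_noise h.noise_ne_zero h.iIndep_noise hxyε hcm hzc n hΦ
  -- the deviation from the lower confidence bound
  set D : ((Fin n → ℝ) × F) → E → ℝ := fun s e => G (α n s, e)
    - postMean ν q σ (policyQueries α s) s.1 (α n s) with hD
  set sd : ((Fin n → ℝ) × F) → ℝ := fun s => postStd q σ (policyQueries α s) (α n s) with hsd
  have hDm : Measurable fun t : ((Fin n → ℝ) × F) × E => D t.1 t.2 :=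
    (h.measurable_value.comp (((hα n).comp measurable_fst).prodMk measurable_snd)).sub
      ((measurable_postMean h.measurable_mean h.measurable_cov (measurable_policyQueries hα)
        (fun i => (measurable_pi_apply i).comp measurable_fst) (hα n)).comp measurable_fst)
  have hsdm : Measurable sd :=
    measurable_postStd h.measurable_cov (measurable_policyQueries hα) (hα n)
  set N : Set ((Fin n → ℝ) × (E × F)) :=
    {t | D (t.1, t.2.2) t.2.1 < -(ζ * sd (t.1, t.2.2))} with hN
  have hNm : MeasurableSet N := by
    have e1 : Measurable fun t : (Fin n → ℝ) × (E × F) => (t.1, t.2.2) := by fun_prop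
    have e2 : Measurable fun t : (Fin n → ℝ) × (E × F) => t.2.1 := by fun_prop
    exact measurableSet_lt (hDm.comp (e1.prodMk e2)) ((hsdm.comp e1).const_mul ζ).neg
  set S' : Set ((Fin n → ℝ) × (E × F)) := {t | (t.1, t.2.2) ∈ S} with hS'
  have hS'm : MeasurableSet S' := by
    have e1 : Measurable fun t : (Fin n → ℝ) × (E × F) => (t.1, t.2.2) := by fun_prop
    exact e1 hS
  have hind1 : ∀ {M : Set ((Fin n → ℝ) × (E × F))}, MeasurableSet M →
      P {ω | (fun i : Fin n => z i ω, w ω) ∈ M}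
        = ∫⁻ ω, M.indicator (fun _ => 1) (fun i : Fin n => z i ω, w ω) ∂P := by
    intro M hM
    have hpre : Measurable fun ω => (fun i : Fin n => z i ω, w ω) :=
      (measurable_pi_lambda _ fun i : Fin n =>
        measurable_sequential hwm h.measurable_noise hcm hzc i).prodMk hwm
    exact (lintegral_indicator_one (μ := P) (hpre hM)).symm
  have hl : P {ω | (fun i : Fin n => z i ω, y ω) ∈ S ∧
        G (α n (fun i : Fin n => z i ω, y ω), x ω)
          < postMean ν q σ (policyQueries α (fun i : Fin n => z i ω, y ω)) (fun i : Fin n => z i ω)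
              (α n (fun i : Fin n => z i ω, y ω))
            - ζ * postStd q σ (policyQueries α (fun i : Fin n => z i ω, y ω))
              (α n (fun i : Fin n => z i ω, y ω))}
      = P {ω | (fun i : Fin n => z i ω, w ω) ∈ S' ∩ N} := by
    congr 1
    ext ω
    simp only [Set.mem_ofPred_eq, hS', hN, hD, hsd, hw, Set.mem_inter_iff]
    refine and_congr Iff.rfl ⟨fun h => by linarith, fun h => by linarith⟩
  have hr : P {ω | (fun i : Fin n => z i ω, y ω) ∈ S}
      = P {ω | (fun i : Fin n => z i ω, w ω) ∈ S'} := rfl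
  -- integrate the path out first, with the side information frozen
  have hswap : ∀ Φ : (Fin n → ℝ) × (E × F) → ℝ≥0∞, Measurable Φ →
      ∫⁻ ω, (∫⁻ u : Fin n → ℝ, Φ (u, w ω)
          * seqLik c (fun _ => Real.toNNReal (σ ^ 2)) n (u, w ω)) ∂P
        = ∫⁻ ω', (∫⁻ u : Fin n → ℝ, (∫⁻ ω, Φ (u, (x ω, y ω'))
          * feedbackLik G σ (policyQueries α (u, y ω')) u (x ω) ∂P)) ∂P := by
    intro Φ hΦ
    have hΨ := hΦ.mul (measurable_seqLik hcm (fun _ => Real.toNNReal (σ ^ 2)) n)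
    set Ψ : (Fin n → ℝ) × (E × F) → ℝ≥0∞ :=
      Φ * seqLik c (fun _ => Real.toNNReal (σ ^ 2)) n with hΨdef
    have hΨ1 : Measurable fun t : (E × F) × (Fin n → ℝ) => Ψ (t.2, t.1) :=
      hΨ.comp measurable_swap
    have hI : Measurable fun t : E × F => ∫⁻ u : Fin n → ℝ, Ψ (u, t) := hΨ1.lintegral_prod_right'
    have hmap := (indepFun_iff_map_prod_eq_prod_map_map h.measurable_path.aemeasurable
      hy.aemeasurable).1 hxy
    have := Measure.isProbabilityMeasure_map (μ := P) h.measurable_path.aemeasurable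
    have := Measure.isProbabilityMeasure_map (μ := P) hy.aemeasurable
    calc ∫⁻ ω, (∫⁻ u : Fin n → ℝ, Φ (u, w ω)
          * seqLik c (fun _ => Real.toNNReal (σ ^ 2)) n (u, w ω)) ∂P
        = ∫⁻ t, (∫⁻ u : Fin n → ℝ, Ψ (u, t)) ∂(P.map w) := (lintegral_map hI hwm).symm
      _ = ∫⁻ b, ∫⁻ a, (∫⁻ u : Fin n → ℝ, Ψ (u, (a, b))) ∂(P.map x) ∂(P.map y) := by
          rw [hw, hmap, lintegral_prod_symm' _ hI]
      _ = ∫⁻ b, (∫⁻ u : Fin n → ℝ, (∫⁻ a, Ψ (u, (a, b)) ∂(P.map x))) ∂(P.map y) := by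
          refine lintegral_congr fun b => ?_
          refine lintegral_lintegral_swap (Measurable.aemeasurable ?_)
          have e1 : Measurable fun t : E × (Fin n → ℝ) => (t.2, (t.1, b)) := by fun_prop
          exact hΨ.comp e1
      _ = ∫⁻ ω', (∫⁻ u : Fin n → ℝ, (∫⁻ a, Ψ (u, (a, y ω')) ∂(P.map x))) ∂P := by
          refine lintegral_map
            (f := fun b => ∫⁻ u : Fin n → ℝ, (∫⁻ a, Ψ (u, (a, b)) ∂(P.map x))) ?_ hy
          have e1 : Measurable fun t : (F × (Fin n → ℝ)) × E => (t.1.2, (t.2, t.1.1)) := by fun_prop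
          exact (hΨ.comp e1).lintegral_prod_right'.lintegral_prod_right'
      _ = _ := by
          refine lintegral_congr fun ω' => lintegral_congr fun u => ?_
          have e1 : Measurable fun a : E => (u, (a, y ω')) := by fun_prop
          exact lintegral_map (f := fun a => Ψ (u, (a, y ω'))) (hΨ.comp e1) h.measurable_path
  rw [hl, hr, hind1 (hS'm.inter hNm), hind1 hS'm,
    hseq (measurable_const.indicator (hS'm.inter hNm)),
    hseq (measurable_const.indicator hS'm), hswap _ (measurable_const.indicator (hS'm.inter hNm)),
    hswap _ (measurable_const.indicator hS'm), ← lintegral_const_mul' _ _ ENNReal.ofReal_ne_top]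
  refine lintegral_mono fun ω' => ?_
  rw [← lintegral_const_mul' _ _ ENNReal.ofReal_ne_top]
  refine lintegral_mono fun u => ?_
  by_cases hu : (u, y ω') ∈ S
  swap
  · have h1 : ∀ ω, (u, (x ω, y ω')) ∉ S' := fun ω => hu
    have h2 : ∀ ω, (u, (x ω, y ω')) ∉ S' ∩ N := fun ω hh => hu hh.1
    simp [h1, h2]
  have h1 : ∀ ω, (u, (x ω, y ω')) ∈ S' := fun ω => hu
  simp only [Set.indicator_of_mem (h1 _), one_mul]
  set A := policyQueries α (u, y ω') with hA
  set b := α n (u, y ω') with hb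
  have hRm : Measurable fun ω => G (b, x ω) - postMean ν q σ A u b :=
    (h.measurable_g b).sub_const _
  have hB := congrArg (fun μ : Measure ℝ => μ (Set.Iio (-(ζ * postStd q σ A b))))
    (h.map_residual_withDensity A b u)
  simp only [Measure.smul_apply, smul_eq_mul] at hB
  rw [Measure.map_apply hRm measurableSet_Iio, withDensity_apply _ (hRm measurableSet_Iio),
    ← lintegral_indicator (hRm measurableSet_Iio)] at hB
  have hpos := postCov_pos h.isCovKernel h.noise_pos A (hqpos b)
  have htail := gaussianReal_tail_le (v := Real.toNNReal (postCov q σ A b b)) (by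
    rw [← pos_iff_ne_zero, Real.toNNReal_pos]; exact hpos) hζ
  rw [Real.coe_toNNReal _ hpos.le] at htail
  calc ∫⁻ ω, (S' ∩ N).indicator (fun _ => 1) (u, (x ω, y ω')) * feedbackLik G σ A u (x ω) ∂P
      = (∫⁻ ω, feedbackLik G σ A u (x ω) ∂P)
          * gaussianReal 0 (Real.toNNReal (postCov q σ A b b))
            (Set.Iio (-(ζ * postStd q σ A b))) := by
        rw [← hB]
        refine lintegral_congr fun ω => ?_
        by_cases hω : G (b, x ω) - postMean ν q σ A u b < -(ζ * postStd q σ A b)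
        · have h3 : (u, (x ω, y ω')) ∈ S' ∩ N := ⟨hu, hω⟩
          have h4 : ω ∈ (fun ω => G (b, x ω) - postMean ν q σ A u b) ⁻¹'
            Set.Iio (-(ζ * postStd q σ A b)) := hω
          rw [Set.indicator_of_mem h3, Set.indicator_of_mem h4, one_mul]
        · have h3 : (u, (x ω, y ω')) ∉ S' ∩ N := fun hh => hω hh.2
          have h4 : ω ∉ (fun ω => G (b, x ω) - postMean ν q σ A u b) ⁻¹'
            Set.Iio (-(ζ * postStd q σ A b)) := hω
          rw [Set.indicator_of_notMem h3, Set.indicator_of_notMem h4, zero_mul]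
    _ ≤ (∫⁻ ω, feedbackLik G σ A u (x ω) ∂P) * ENNReal.ofReal (Real.exp (-ζ ^ 2 / 2) / 2) :=
        mul_le_mul_right htail _
    _ = _ := mul_comm _ _

end AdaptiveTail

/-! ### Mutual information at fixed queries -/

section MutualInfo

/-- The mutual information of `U` and `x` when `U` has density `N` and, given `x`, density
`L (·, x)`. -/
lemma mutualInfo_eq_integral_log {Ω D E : Type*} [MeasurableSpace Ω] [MeasurableSpace D]
    [MeasurableSpace E] {P : Measure Ω} [IsProbabilityMeasure P] {μ : Measure D} [SFinite μ]
    {U : Ω → D} {x : Ω → E} (hU : Measurable U) (hx : Measurable x)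
    {L : D × E → ℝ≥0∞} (hL : Measurable L) {N : D → ℝ≥0∞} (hN : Measurable N)
    (hN0 : ∀ u, N u ≠ 0) (hNt : ∀ u, N u ≠ ∞)
    (hjoint : ∀ Φ : D × E → ℝ≥0∞, Measurable Φ →
      ∫⁻ ω, Φ (U ω, x ω) ∂P = ∫⁻ ω, (∫⁻ u, Φ (u, x ω) * L (u, x ω) ∂μ) ∂P)
    (hmarg : ∀ Φ : D → ℝ≥0∞, Measurable Φ → ∫⁻ ω, Φ (U ω) ∂P = ∫⁻ u, Φ u * N u ∂μ)
    (hint : Integrable (fun ω => Real.log (L (U ω, x ω) / N (U ω)).toReal) P) :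
    mutualInfo P U x
      = ENNReal.ofReal (∫ ω, Real.log (L (U ω, x ω) / N (U ω)).toReal ∂P) := by
  have hUx : Measurable fun ω => (U ω, x ω) := hU.prodMk hx
  have := Measure.isProbabilityMeasure_map (μ := P) hU.aemeasurable
  have := Measure.isProbabilityMeasure_map (μ := P) hx.aemeasurable
  have := Measure.isProbabilityMeasure_map (μ := P) hUx.aemeasurable
  have hr : Measurable fun t : D × E => L t / N t.1 := hL.div (hN.comp measurable_fst)
  have hmap : P.map U = μ.withDensity N := by
    refine Measure.ext_of_lintegral _ fun Φ hΦ => ?_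
    rw [lintegral_map hΦ hU, hmarg Φ hΦ, lintegral_withDensity_eq_lintegral_mul _ hN hΦ]
    exact lintegral_congr fun u => mul_comm _ _
  have hdens : P.map (fun ω => (U ω, x ω))
      = ((P.map U).prod (P.map x)).withDensity fun t => L t / N t.1 := by
    refine Measure.ext_of_lintegral _ fun Φ hΦ => ?_
    rw [lintegral_map hΦ hUx, hjoint Φ hΦ, lintegral_withDensity_eq_lintegral_mul _ hr hΦ,
      lintegral_prod_symm' _ (hr.mul hΦ), lintegral_map
        (f := fun e => ∫⁻ u, ((fun t : D × E => L t / N t.1) * Φ) (u, e) ∂(P.map U))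
        (hr.mul hΦ).lintegral_prod_left' hx]
    refine lintegral_congr fun ω => ?_
    have h1 : Measurable fun u => ((fun t : D × E => L t / N t.1) * Φ) (u, x ω) :=
      (hr.mul hΦ).comp (measurable_id.prodMk measurable_const)
    rw [hmap, lintegral_withDensity_eq_lintegral_mul _ hN h1]
    refine lintegral_congr fun u => ?_
    simp only [Pi.mul_apply]
    rw [← mul_assoc, ENNReal.mul_div_cancel (hN0 u) (hNt u), mul_comm]
  have hac : P.map (fun ω => (U ω, x ω)) ≪ (P.map U).prod (P.map x) := by
    rw [hdens]
    exact withDensity_absolutelyContinuous _ _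
  have hllr : llr (P.map fun ω => (U ω, x ω)) ((P.map U).prod (P.map x))
      =ᵐ[P.map fun ω => (U ω, x ω)] fun t => Real.log (L t / N t.1).toReal := by
    have h1 := hac.ae_le (Measure.rnDeriv_withDensity ((P.map U).prod (P.map x)) hr)
    rw [← hdens] at h1
    filter_upwards [h1] with t ht
    rw [llr, ht]
  have hlm : Measurable fun t : D × E => Real.log (L t / N t.1).toReal := hr.ennreal_toReal.log
  have hi : Integrable (llr (P.map fun ω => (U ω, x ω)) ((P.map U).prod (P.map x)))
      (P.map fun ω => (U ω, x ω)) := by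
    refine Integrable.congr ?_ hllr.symm
    exact (integrable_map_measure hlm.aestronglyMeasurable hUx.aemeasurable).2 hint
  rw [mutualInfo, InformationTheory.klDiv_of_ac_of_integrable hac hi, integral_congr_ae hllr,
    integral_map hUx.aemeasurable hlm.aestronglyMeasurable]
  simp

lemma log_gaussianPDF_toReal (μ : ℝ) {v : ℝ≥0} (hv : v ≠ 0) (t : ℝ) :
    Real.log (gaussianPDF μ v t).toReal
      = -(Real.log (2 * Real.pi * v) / 2) - (t - μ) ^ 2 / (2 * v) := by
  have hv0 : (0 : ℝ) < v := by positivity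
  have hp : 0 < 2 * Real.pi * v := by positivity
  rw [gaussianPDF, ENNReal.toReal_ofReal (gaussianPDFReal_nonneg _ _ _), gaussianPDFReal,
    Real.log_mul (inv_ne_zero (Real.sqrt_pos.2 hp).ne') (Real.exp_ne_zero _), Real.log_inv,
    Real.log_sqrt hp.le, Real.log_exp]
  ring

variable {𝒜 Ω E : Type*} [MeasurableSpace 𝒜] [MeasurableSpace Ω] [MeasurableSpace E]
  {x : Ω → E} {G : 𝒜 × E → ℝ} {ν : 𝒜 → ℝ} {q : 𝒜 → 𝒜 → ℝ} {σ : ℝ} {ε : ℕ → Ω → ℝ}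
  {P : Measure Ω} [IsProbabilityMeasure P]

/-- The information gain at fixed queries is `∑ ½ log (1 + σ⁻² v_j)`, where `v_j` is the posterior
variance of the `j`-th query given the previous ones. -/
theorem NoisyModel.mutualInfo_eq (h : NoisyModel x G ν q σ ε P) (hqpos : ∀ a, 0 < q a a)
    (B : ℕ → 𝒜) (n : ℕ) :
    mutualInfo P (fun ω (i : Fin n) => G (B i, x ω) + ε i ω) x
      = ENNReal.ofReal (∑ j : Fin n,
          Real.log (1 + (σ ^ 2)⁻¹ * postCov q σ (fun i : Fin j => B i) (B j) (B j)) / 2) := by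
  have hσ := h.noise_pos
  have hσ2 : (0 : ℝ) < σ ^ 2 := by positivity
  have hq := h.isCovKernel
  set s : ℝ≥0 := Real.toNNReal (σ ^ 2) with hs
  have hs0 : s ≠ 0 := h.noise_ne_zero
  have hsv : (s : ℝ) = σ ^ 2 := Real.coe_toNNReal _ hσ2.le
  set V : ℕ → ℝ := fun j => postCov q σ (fun i : Fin j => B i) (B j) (B j) with hV
  have hVpos : ∀ j, 0 < V j := fun j => postCov_pos hq hσ _ (hqpos _)
  set v : ℕ → ℝ≥0 := fun j => Real.toNNReal (V j + 1 ^ 2 * σ ^ 2) with hv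
  have hvv : ∀ j, (v j : ℝ) = V j + σ ^ 2 := fun j => by
    rw [hv, one_pow, one_mul]
    exact Real.coe_toNNReal _ (add_pos (hVpos j) hσ2).le
  have hv0 : ∀ j, v j ≠ 0 := fun j => by
    rw [← NNReal.coe_ne_zero, hvv]
    exact (add_pos (hVpos j) hσ2).ne'
  set z : ℕ → Ω → ℝ := fun i ω => G (B i, x ω) + ε i ω with hz
  have hzm : ∀ i, Measurable (z i) := fun i => (h.measurable_g _).add (h.measurable_noise _)
  have hUm : ∀ n, Measurable fun ω (i : Fin n) => z i ω := fun n =>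
    measurable_pi_lambda _ fun i => hzm i
  -- the innovations `R j` are independent of the past
  set c : (j : ℕ) → (Fin j → ℝ) × Unit → ℝ := fun j t =>
    postMean ν q σ (fun i : Fin j => B i) t.1 (B j) with hc
  have hcm : ∀ j, Measurable (c j) := fun j =>
    (continuous_postMean hq ν σ _ _).measurable.comp measurable_fst
  set R : ℕ → Ω → ℝ := fun j ω => z j ω - c j (fun i : Fin j => z i ω, ()) with hR
  have hRm : ∀ j, Measurable (R j) := fun j =>
    (hzm j).sub ((hcm j).comp ((hUm j).prodMk measurable_const))
  have hres := fun j => h.regression_residual (fun i : Fin j => B i) (B j) 1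
  simp only [one_mul] at hres
  have hRlaw : ∀ j, P.map (R j) = gaussianReal 0 (v j) := fun j => by
    have h1 := (hres j).2
    simp only [hv, hV, one_pow, one_mul] at h1 ⊢
    exact h1
  have hRind : ∀ j, IndepFun (R j) (fun ω => (fun i : Fin j => z i ω, ())) P := fun j =>
    (hres j).1.comp (φ := id) (ψ := fun u : Fin j → ℝ => (u, ())) measurable_id (by fun_prop)
  set N : (Fin n → ℝ) → ℝ≥0∞ := fun u => seqLik c v n (u, ()) with hN
  have hNm : Measurable N :=
    (measurable_seqLik hcm v n).comp (measurable_id.prodMk measurable_const)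
  have hpdf0 : ∀ (μ : ℝ) {r : ℝ≥0} (_ : r ≠ 0) (t : ℝ), gaussianPDF μ r t ≠ 0 :=
    fun μ r hr t => (gaussianPDF_pos μ hr t).ne'
  have hN0 : ∀ u, N u ≠ 0 := fun u => Finset.prod_ne_zero_iff.2 fun i _ => hpdf0 _ (hv0 i) _
  have hNt : ∀ u, N u ≠ ∞ := fun u => ENNReal.prod_ne_top fun i _ => gaussianPDF_ne_top
  have hlog : ∀ ω, Real.log (feedbackLik G σ (fun i : Fin n => B i) (fun i : Fin n => z i ω) (x ω)
        / N (fun i : Fin n => z i ω)).toReal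
      = ∑ j : Fin n, (Real.log (1 + (σ ^ 2)⁻¹ * V j) / 2
          + (R j ω ^ 2 / (2 * v j) - ε j ω ^ 2 / (2 * s))) := by
    intro ω
    have e1 : ∀ (μ : ℝ) {r : ℝ≥0} (_ : r ≠ 0) (t : ℝ), (gaussianPDF μ r t).toReal ≠ 0 :=
      fun μ r hr t => ENNReal.toReal_ne_zero.2 ⟨hpdf0 μ hr t, gaussianPDF_ne_top⟩
    simp only [hN, seqLik, feedbackLik, ENNReal.toReal_div, ENNReal.toReal_prod, ← hs]
    rw [Real.log_div (Finset.prod_ne_zero_iff.2 fun (i : Fin n) _ => e1 _ hs0 _)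
        (Finset.prod_ne_zero_iff.2 fun (i : Fin n) _ => e1 _ (hv0 i) _),
      Real.log_prod (fun (i : Fin n) _ => e1 _ hs0 _),
      Real.log_prod (fun (i : Fin n) _ => e1 _ (hv0 i) _), ← Finset.sum_sub_distrib]
    refine Finset.sum_congr rfl fun j _ => ?_
    rw [log_gaussianPDF_toReal _ hs0, log_gaussianPDF_toReal _ (hv0 j)]
    have e2 : Real.log (1 + (σ ^ 2)⁻¹ * V j)
        = Real.log (2 * Real.pi * v j) - Real.log (2 * Real.pi * s) := by
      have hp : (0 : ℝ) < v j := by have := hv0 j; positivity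
      have hp' : (0 : ℝ) < s := by positivity
      rw [← Real.log_div (by positivity) (by positivity), hvv, hsv]
      congr 1
      field_simp
      ring
    have e3 : z j ω - c j (fun i : Fin j => z i ω, ()) = R j ω := rfl
    have e4 : z j ω - G (B j, x ω) = ε j ω := by simp [hz]
    rw [e2]
    simp only [e4]
    change _ - (_ - (z j ω - c j (fun i : Fin j => z i ω, ())) ^ 2 / (2 * (v j : ℝ))) = _
    rw [e3]
    ring
  have hsq : ∀ {Y : Ω → ℝ} {r : ℝ≥0}, Measurable Y → P.map Y = gaussianReal 0 r →
      Integrable (fun ω => Y ω ^ 2) P ∧ ∫ ω, Y ω ^ 2 ∂P = r := by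
    intro Y r hY hl
    have hg : HasGaussianLaw Y P := ⟨by rw [hl]; infer_instance⟩
    have h2 := hg.memLp_two
    refine ⟨h2.integrable_sq, ?_⟩
    have h3 : ∫ ω, Y ω ∂P = 0 := by
      have h1 := integral_map (μ := P) hY.aemeasurable (f := fun y : ℝ => y) (by fun_prop)
      rw [hl, integral_id_gaussianReal] at h1
      exact h1.symm
    have h4 := variance_map (μ := P) (X := id) (Y := Y) (by fun_prop) hY.aemeasurable
    rw [hl, variance_id_gaussianReal] at h4
    have h5 := variance_of_integral_eq_zero hY.aemeasurable h3
    rw [← h5]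
    exact h4.symm
  have hRsq := fun j => hsq (hRm j) (hRlaw j)
  have hεsq := fun j => hsq (h.measurable_noise j) (h.law_noise j)
  have hterm : ∀ j : Fin n, Integrable (fun ω => Real.log (1 + (σ ^ 2)⁻¹ * V j) / 2
          + (R j ω ^ 2 / (2 * v j) - ε j ω ^ 2 / (2 * s))) P := fun j =>
    (integrable_const _).add (((hRsq j).1.div_const _).sub ((hεsq j).1.div_const _))
  have hmi := mutualInfo_eq_integral_log (P := P) (μ := (volume : Measure (Fin n → ℝ))) (hUm n)
    h.measurable_path (measurable_feedbackLik h.measurable_value σ fun i : Fin n => B i) hNm hN0 hNt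
    (fun Φ hΦ => h.lintegral_nonadaptive (fun i : Fin n => B i) hΦ)
    (fun Φ hΦ => by
      have h1 := lintegral_sequential (x := fun _ : Ω => ()) hzm measurable_const hcm hv0 hRlaw
        hRind n (Φ := fun t => Φ t.1) (hΦ.comp measurable_fst)
      rw [h1, lintegral_const, measure_univ, mul_one])
    (by
      simp only [hlog]
      exact integrable_finsetSum _ fun j _ => hterm j)
  refine hmi.trans ?_
  congr 1
  simp only [hlog]
  rw [integral_finsetSum _ fun j _ => hterm j]
  refine Finset.sum_congr rfl fun j _ => ?_
  have hi1 : Integrable (fun ω => R j ω ^ 2 / (2 * (v j : ℝ))) P := (hRsq j).1.div_const _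
  have hi2 : Integrable (fun ω => ε j ω ^ 2 / (2 * (s : ℝ))) P := (hεsq j).1.div_const _
  have hi3 : Integrable (fun ω => R j ω ^ 2 / (2 * (v j : ℝ)) - ε j ω ^ 2 / (2 * (s : ℝ))) P :=
    hi1.sub hi2
  rw [integral_add (integrable_const _) hi3, integral_sub hi1 hi2, integral_const,
    integral_div, integral_div, (hRsq j).2, (hεsq j).2]
  have hp : (v j : ℝ) ≠ 0 := NNReal.coe_ne_zero.2 (hv0 j)
  have hp' : (s : ℝ) ≠ 0 := NNReal.coe_ne_zero.2 hs0
  simp only [probReal_univ, one_smul]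
  field_simp
  ring

end MutualInfo

/-! ### Small posterior variances, first passage, and ranks of the samples -/

section InformationGain

variable {𝒜 Ω E : Type*} [MeasurableSpace 𝒜] [MeasurableSpace Ω] [MeasurableSpace E]
  {x : Ω → E} {G : 𝒜 × E → ℝ} {ν : 𝒜 → ℝ} {q : 𝒜 → 𝒜 → ℝ} {σ : ℝ} {ε : ℕ → Ω → ℝ}
  {P : Measure Ω} [IsProbabilityMeasure P]

lemma NoisyModel.mutualInfo_le (h : NoisyModel x G ν q σ ε P) (hqpos : ∀ a, 0 < q a a)
    (hq1 : ∀ a, q a a ≤ 1) (B : ℕ → 𝒜) (n : ℕ) :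
    mutualInfo P (fun ω (i : Fin n) => G (B i, x ω) + ε i ω) x
      ≤ ENNReal.ofReal (n * (Real.log (1 + (σ ^ 2)⁻¹) / 2)) := by
  have hσ := h.noise_pos
  rw [h.mutualInfo_eq hqpos]
  refine ENNReal.ofReal_le_ofReal ?_
  have h1 := Finset.sum_le_card_nsmul (Finset.univ : Finset (Fin n)) (fun j : Fin n =>
    Real.log (1 + (σ ^ 2)⁻¹ * postCov q σ (fun i : Fin j => B i) (B j) (B j)) / 2)
    (Real.log (1 + (σ ^ 2)⁻¹) / 2) fun j _ => by
      have e1 := postCov_le_self h.isCovKernel hσ (fun i : Fin j => B i) (B j)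
      have e2 := postCov_pos h.isCovKernel hσ (fun i : Fin j => B i) (hqpos (B j))
      have e3 : (σ ^ 2)⁻¹ * postCov q σ (fun i : Fin j => B i) (B j) (B j) ≤ (σ ^ 2)⁻¹ :=
        mul_le_of_le_one_right (by positivity) (e1.trans (hq1 _))
      gcongr
  simpa using h1

/-- Among any `T` iterations, one has a posterior variance of at most `C ρ / T`, where `ρ` bounds
the information gain of `T` queries. The iterations need not be consecutive: dropping feedbacks
only increases the posterior variances. -/
theorem NoisyModel.exists_postStd_le (h : NoisyModel x G ν q σ ε P) (hqpos : ∀ a, 0 < q a a)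
    (hq1 : ∀ a, q a a ≤ 1) {T : ℕ} (hT : 0 < T) {ρ : ℝ≥0∞} (hρ : ρ ≠ ∞)
    (hmi : ∀ B : ℕ → 𝒜, mutualInfo P (fun ω (i : Fin T) => G (B i, x ω) + ε i ω) x ≤ ρ)
    (a : ℕ → 𝒜) {R : Finset ℕ} (hR : T ≤ R.card) :
    ∃ t ∈ R, postStd q σ (fun i : Fin t => a i) (a t)
      ≤ Real.sqrt (2 / Real.log (1 + (σ ^ 2)⁻¹) * ρ.toReal / T) := by
  have hσ := h.noise_pos
  have hq := h.isCovKernel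
  have hc : 0 < (σ ^ 2)⁻¹ := by positivity
  have hlog : 0 < Real.log (1 + (σ ^ 2)⁻¹) := Real.log_pos (by linarith)
  obtain ⟨R', hR'R, hR'⟩ := Finset.exists_subset_card_eq hR
  set e : Fin T ↪o ℕ := R'.orderEmbOfFin hR' with he
  set B : ℕ → 𝒜 := fun j => if hj : j < T then a (e ⟨j, hj⟩) else a 0 with hB
  have hBe : ∀ j : Fin T, B j = a (e j) := fun j => by simp [hB]
  set V : Fin T → ℝ := fun j => postCov q σ (fun i : Fin j => B i) (B j) (B j) with hV
  have hV1 : ∀ j, V j ≤ 1 := fun j => (postCov_le_self hq hσ _ _).trans (hq1 _)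
  have hV0 : ∀ j, 0 < V j := fun j => postCov_pos hq hσ _ (hqpos _)
  have hle : ∀ j : Fin T, postCov q σ (fun i : Fin (e j) => a i) (a (e j)) (a (e j)) ≤ V j := by
    intro j
    have h1 := postCov_le_postCov_comp hq hσ (fun i : Fin (e j) => a i)
      (e := fun i : Fin j => (⟨e (i.castLE j.2.le), e.strictMono (by
        simp [Fin.lt_def])⟩ : Fin (e j))) (fun i i' hii => by
          have := e.injective (Fin.mk.inj_iff.1 hii)
          simpa [Fin.ext_iff] using this) (a (e j))
    refine h1.trans_eq ?_
    rw [hV]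
    simp only [hBe]
    congr 1
    ext i
    exact (hBe (i.castLE j.2.le)).symm
  have hsum : ∑ j, V j ≤ 2 / Real.log (1 + (σ ^ 2)⁻¹) * ρ.toReal := by
    have h1 := hmi B
    rw [h.mutualInfo_eq hqpos, ENNReal.ofReal_le_iff_le_toReal hρ] at h1
    calc ∑ j, V j ≤ ∑ j, Real.log (1 + (σ ^ 2)⁻¹ * V j) / Real.log (1 + (σ ^ 2)⁻¹) :=
          Finset.sum_le_sum fun j _ => le_div_log_mul_log hc (hV0 j).le (hV1 j)
      _ = 2 / Real.log (1 + (σ ^ 2)⁻¹) * ∑ j, Real.log (1 + (σ ^ 2)⁻¹ * V j) / 2 := by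
          rw [Finset.mul_sum]
          exact Finset.sum_congr rfl fun j _ => by ring
      _ ≤ _ := mul_le_mul_of_nonneg_left h1 (by positivity)
  have : Nonempty (Fin T) := ⟨⟨0, hT⟩⟩
  obtain ⟨j, -, hj⟩ := Finset.exists_le_of_sum_le (s := (Finset.univ : Finset (Fin T)))
    (f := V) (g := fun _ => 2 / Real.log (1 + (σ ^ 2)⁻¹) * ρ.toReal / T) Finset.univ_nonempty (by
      refine hsum.trans_eq ?_
      have : (T : ℝ) ≠ 0 := by positivity
      simp only [Finset.sum_const, Finset.card_univ, Fintype.card_fin, nsmul_eq_mul]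
      field_simp)
  exact ⟨e j, hR'R (R'.orderEmbOfFin_mem hR' j), Real.sqrt_le_sqrt ((hle j).trans hj)⟩

end InformationGain

section FirstPassage

variable {𝒜 Ω E F : Type*} [MeasurableSpace 𝒜] [MeasurableSpace Ω] [MeasurableSpace E]
  [MeasurableSpace F]
  {x : Ω → E} {G : 𝒜 × E → ℝ} {ν : 𝒜 → ℝ} {q : 𝒜 → 𝒜 → ℝ} {σ : ℝ} {ε : ℕ → Ω → ℝ}
  {P : Measure Ω} [IsProbabilityMeasure P]
  {y : Ω → F} {z : ℕ → Ω → ℝ} {α : (n : ℕ) → (Fin n → ℝ) × F → 𝒜}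

/-- The confidence bound at a random time: at the first iteration whose past feedbacks and side
information satisfy `D`, it fails with at most the Gaussian probability. No union bound over the
iterations is needed, since the events "`n` is the first iteration" are disjoint. -/
theorem NoisyModel.measure_first_below_confidence_le (h : NoisyModel x G ν q σ ε P)
    (hqpos : ∀ a, 0 < q a a) (hy : Measurable y) (hxy : IndepFun x y P)
    (hxyε : IndepFun (fun ω => (x ω, y ω)) (fun ω t => ε t ω) P) (hα : ∀ n, Measurable (α n))
    (hz : ∀ n ω, z n ω = G (α n (fun i : Fin n => z i ω, y ω), x ω) + ε n ω)
    {ζ : ℝ} (hζ : 0 ≤ ζ) {D : (n : ℕ) → Set ((Fin n → ℝ) × F)}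
    (hD : ∀ n, MeasurableSet (D n)) (N : ℕ) :
    P {ω | ∃ n < N, (fun i : Fin n => z i ω, y ω) ∈ D n ∧
        (∀ j < n, (fun i : Fin j => z i ω, y ω) ∉ D j) ∧
        G (α n (fun i : Fin n => z i ω, y ω), x ω)
          < postMean ν q σ (policyQueries α (fun i : Fin n => z i ω, y ω)) (fun i : Fin n => z i ω)
              (α n (fun i : Fin n => z i ω, y ω))
            - ζ * postStd q σ (policyQueries α (fun i : Fin n => z i ω, y ω))
              (α n (fun i : Fin n => z i ω, y ω))}
      ≤ ENNReal.ofReal (Real.exp (-ζ ^ 2 / 2) / 2) := by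
  have hzm : ∀ n, Measurable (z n) := measurable_sequential
    (c := fun n s => G (α n (s.1, s.2.2), s.2.1)) (h.measurable_path.prodMk hy) h.measurable_noise
    (fun n => h.measurable_value.comp (((hα n).comp (measurable_fst.prodMk
      (measurable_snd.comp measurable_snd))).prodMk (measurable_fst.comp measurable_snd))) hz
  set S : (n : ℕ) → Set ((Fin n → ℝ) × F) := fun n =>
    D n ∩ ⋂ j : Fin n, {s | (fun i : Fin j => s.1 (i.castLE j.2.le), s.2) ∉ D j} with hS
  have hSm : ∀ n, MeasurableSet (S n) := fun n => by
    refine (hD n).inter (MeasurableSet.iInter fun j => ?_)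
    have e1 : Measurable fun s : (Fin n → ℝ) × F =>
        (fun i : Fin j => s.1 (i.castLE j.2.le), s.2) := by fun_prop
    exact (e1 (hD j)).compl
  have hmem : ∀ n ω, (fun i : Fin n => z i ω, y ω) ∈ S n ↔
      (fun i : Fin n => z i ω, y ω) ∈ D n ∧ ∀ j < n, (fun i : Fin j => z i ω, y ω) ∉ D j := by
    intro n ω
    simp only [hS, Set.mem_inter_iff, Set.mem_iInter, Set.mem_ofPred_eq, Fin.val_castLE]
    exact and_congr Iff.rfl ⟨fun H j hj => H ⟨j, hj⟩, fun H j => H j j.2⟩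
  have hτm : ∀ n, MeasurableSet {ω | (fun i : Fin n => z i ω, y ω) ∈ S n} := fun n =>
    ((measurable_pi_lambda _ fun i : Fin n => hzm i).prodMk hy) (hSm n)
  have hdisj : Set.PairwiseDisjoint (↑(Finset.range N))
      fun n => {ω | (fun i : Fin n => z i ω, y ω) ∈ S n} := by
    have key : ∀ m n, m < n → Disjoint {ω | (fun i : Fin m => z i ω, y ω) ∈ S m}
        {ω | (fun i : Fin n => z i ω, y ω) ∈ S n} := fun m n hmn =>
      Set.disjoint_left.2 fun ω h1 h2 => ((hmem n ω).1 h2).2 m hmn ((hmem m ω).1 h1).1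
    intro m _ n _ hmn
    rcases lt_or_gt_of_ne hmn with h' | h'
    · exact key m n h'
    · exact (key n m h').symm
  refine (measure_mono (t := ⋃ n ∈ Finset.range N, {ω | (fun i : Fin n => z i ω, y ω) ∈ S n ∧
        G (α n (fun i : Fin n => z i ω, y ω), x ω)
          < postMean ν q σ (policyQueries α (fun i : Fin n => z i ω, y ω)) (fun i : Fin n => z i ω)
              (α n (fun i : Fin n => z i ω, y ω))
            - ζ * postStd q σ (policyQueries α (fun i : Fin n => z i ω, y ω))
              (α n (fun i : Fin n => z i ω, y ω))}) ?_).trans ?_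
  · rintro ω ⟨n, hn, h1, h2, h3⟩
    exact Set.mem_biUnion (Finset.mem_coe.2 (Finset.mem_range.2 hn)) ⟨(hmem n ω).2 ⟨h1, h2⟩, h3⟩
  · refine (measure_biUnion_finset_le _ _).trans ?_
    refine (Finset.sum_le_sum fun n _ =>
      h.measure_below_confidence_le hqpos hy hxy hxyε hα hz hζ n (hSm n)).trans ?_
    rw [← Finset.mul_sum, ← measure_biUnion_finset hdisj fun n _ => hτm n]
    exact mul_le_of_le_one_right' prob_le_one

end FirstPassage

section Blocks

variable {Ω : Type*} [MeasurableSpace Ω] {P : Measure Ω} [IsProbabilityMeasure P]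
  {M : Ω → ℝ} {Y : ℕ → Ω → ℝ}

/-- With `M` frozen at `r`, each of the samples in `b` is at most `r` with probability `F r`. -/
lemma measure_forall_le_le (hM : Measurable M) (hY : ∀ t, Measurable (Y t))
    (hlaw : ∀ t, P.map (Y t) = P.map M) (hi : iIndepFun Y P)
    (hMY : IndepFun M (fun ω t => Y t ω) P) {w : ℝ} (b : Finset ℕ) :
    P {ω | cdf (P.map M) (M ω) ≤ w ∧ ∀ t ∈ b, Y t ω ≤ M ω} ≤ ENNReal.ofReal w ^ b.card := by
  have hYm : Measurable fun ω t => Y t ω := measurable_pi_lambda _ hY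
  have := Measure.isProbabilityMeasure_map (μ := P) hM.aemeasurable
  have := Measure.isProbabilityMeasure_map (μ := P) hYm.aemeasurable
  set K : Set (ℝ × (ℕ → ℝ)) := {s | cdf (P.map M) s.1 ≤ w ∧ ∀ t ∈ b, s.2 t ≤ s.1} with hK
  have hKm : MeasurableSet K := by
    have h1 : MeasurableSet {s : ℝ × (ℕ → ℝ) | cdf (P.map M) s.1 ≤ w} :=
      measurableSet_le ((monotone_cdf _).measurable.comp measurable_fst) measurable_const
    have h2 : MeasurableSet (⋂ t ∈ b, {s : ℝ × (ℕ → ℝ) | s.2 t ≤ s.1}) :=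
      Finset.measurableSet_biInter _ fun t _ =>
        measurableSet_le ((measurable_pi_apply t).comp measurable_snd) measurable_fst
    convert h1.inter h2 using 1
    ext s
    simp [hK]
  have e1 : P {ω | cdf (P.map M) (M ω) ≤ w ∧ ∀ t ∈ b, Y t ω ≤ M ω}
      = (P.map fun ω => (M ω, fun t => Y t ω)) K :=
    (Measure.map_apply (hM.prodMk hYm) hKm).symm
  rw [e1, (indepFun_iff_map_prod_eq_prod_map_map hM.aemeasurable hYm.aemeasurable).1 hMY,
    Measure.prod_apply hKm]
  have e2 : ∀ r, (P.map fun ω t => Y t ω) (Prod.mk r ⁻¹' K) ≤ ENNReal.ofReal w ^ b.card := by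
    intro r
    by_cases hr : cdf (P.map M) r ≤ w
    · rw [Measure.map_apply hYm (measurable_prodMk_left hKm)]
      refine (measure_mono (t := ⋂ t ∈ b, Y t ⁻¹' Set.Iic r) fun ω hω => ?_).trans ?_
      · exact Set.mem_iInter₂.2 fun t ht => hω.2 t ht
      · rw [hi.measure_inter_preimage_eq_mul b (sets := fun _ => Set.Iic r)
          fun _ _ => measurableSet_Iic]
        refine (Finset.prod_le_pow_card _ _ _ fun t _ => ?_)
        rw [← Measure.map_apply (hY t) measurableSet_Iic, hlaw, ← ofReal_cdf]
        exact ENNReal.ofReal_le_ofReal hr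
    · have : Prod.mk r ⁻¹' K = ∅ := Set.eq_empty_of_forall_notMem fun s hs => hr hs.1
      rw [this, measure_empty]
      exact zero_le
  refine (lintegral_mono e2).trans ?_
  simp

/-- A set with fewer than `T` elements misses one of `T` consecutive blocks. -/
lemma exists_block_of_card_lt {S : Finset ℕ} (K : ℕ → ℕ) (hK : Monotone K) {T : ℕ}
    (hS : S.card < T) : ∃ j < T, ∀ s ∈ Finset.Ico (K j) (K (j + 1)), s ∉ S := by
  by_contra! hcon
  choose! s hs hsS using hcon
  refine hS.not_ge ?_
  have hlt : ∀ i j, i < j → j < T → s i < s j := fun i j hij hj =>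
    ((Finset.mem_Ico.1 (hs i (hij.trans hj))).2.trans_le (hK hij)).trans_le
      (Finset.mem_Ico.1 (hs j hj)).1
  have h1 := Finset.card_le_card_of_injOn (s := Finset.range T) (t := S) s
    (fun j hj => hsS j (Finset.mem_range.1 hj)) (fun i hi j hj hij => by
      rcases lt_trichotomy i j with h' | h' | h'
      · exact absurd hij (hlt i j h' (Finset.mem_range.1 hj)).ne
      · exact h'
      · exact absurd hij (hlt j i h' (Finset.mem_range.1 hi)).ne')
  simpa using h1

/-- With `T` consecutive blocks of lengths `k 1, …, k T`, at least `T` of the samples exceed `M`,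
up to an event of probability `∑ w ^ k i`. -/
lemma measure_card_exceeding_lt_le (hM : Measurable M) (hY : ∀ t, Measurable (Y t))
    (hlaw : ∀ t, P.map (Y t) = P.map M) (hi : iIndepFun Y P)
    (hMY : IndepFun M (fun ω t => Y t ω) P) {w : ℝ} (k : ℕ → ℕ) (T : ℕ) :
    P {ω | cdf (P.map M) (M ω) ≤ w ∧
        ((Finset.range (∑ i ∈ Finset.Icc 1 T, k i)).filter fun t => M ω < Y t ω).card < T}
      ≤ ∑ i ∈ Finset.Icc 1 T, ENNReal.ofReal w ^ k i := by
  set K : ℕ → ℕ := fun j => ∑ i ∈ Finset.range j, k (i + 1) with hK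
  have hKmono : Monotone K := fun i j hij =>
    Finset.sum_le_sum_of_subset (Finset.range_subset_range.2 hij)
  have hIcc : ∀ {β : Type} [AddCommMonoid β] (φ : ℕ → β), ∑ i ∈ Finset.Icc 1 T, φ i
      = ∑ j ∈ Finset.range T, φ (j + 1) := fun φ => by
    rw [Finset.range_eq_Ico, Finset.sum_Ico_add' φ 0 T 1]
    rfl
  rw [hIcc k, hIcc]
  refine (measure_mono (t := ⋃ j ∈ Finset.range T, {ω | cdf (P.map M) (M ω) ≤ w ∧
    ∀ t ∈ Finset.Ico (K j) (K (j + 1)), Y t ω ≤ M ω}) ?_).trans ?_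
  · rintro ω ⟨h1, h2⟩
    obtain ⟨j, hj, h3⟩ := exists_block_of_card_lt K hKmono h2
    refine Set.mem_biUnion (Finset.mem_coe.2 (Finset.mem_range.2 hj)) ⟨h1, fun t ht => ?_⟩
    have h4 := h3 t ht
    rw [Finset.mem_filter, not_and, not_lt] at h4
    exact h4 (Finset.mem_range.2 ((Finset.mem_Ico.1 ht).2.trans_le (hKmono hj)))
  · refine (measure_biUnion_finset_le _ _).trans (Finset.sum_le_sum fun j _ => ?_)
    refine (measure_forall_le_le hM hY hlaw hi hMY _).trans_eq ?_
    rw [Nat.card_Ico, hK]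
    simp [Finset.sum_range_succ]

end Blocks

section TopRanked

/-- The indices below `N` whose value is among the `T` largest: fewer than `T` values exceed it. -/
noncomputable def topRanked (y : ℕ → ℝ) (T N : ℕ) : Finset ℕ :=
  (Finset.range N).filter fun t => ((Finset.range N).filter fun s => y t < y s).card < T

lemma measurableSet_mem_topRanked (T N t : ℕ) :
    MeasurableSet {y : ℕ → ℝ | t ∈ topRanked y T N} := by
  by_cases ht : t < N
  · have h1 : Measurable fun y : ℕ → ℝ => ((Finset.range N).filter fun s => y t < y s).card := by
      simp only [Finset.card_filter]
      refine Finset.measurable_fun_sum _ fun s _ =>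
        Measurable.ite ?_ measurable_const measurable_const
      exact measurableSet_lt (measurable_pi_apply t) (measurable_pi_apply s)
    simp only [topRanked, Finset.mem_filter, Finset.mem_range, ht, true_and]
    exact measurableSet_lt h1 measurable_const
  · simp [topRanked, ht]

lemma le_card_topRanked (y : ℕ → ℝ) {T N : ℕ} (hTN : T ≤ N) : T ≤ (topRanked y T N).card := by
  by_cases hall : ∀ t ∈ Finset.range N, t ∈ topRanked y T N
  · have := Finset.card_le_card (show Finset.range N ⊆ topRanked y T N from hall)
    rw [Finset.card_range] at this
    omega
  push Not at hall
  obtain ⟨t₀, ht₀, ht₀'⟩ := hall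
  -- all values above the largest value of a non-member belong to members
  obtain ⟨t, ht, hmax⟩ := Finset.exists_max_image (Finset.range N \ topRanked y T N) y
    ⟨t₀, Finset.mem_sdiff.2 ⟨ht₀, ht₀'⟩⟩
  obtain ⟨htN, htR⟩ := Finset.mem_sdiff.1 ht
  have h1 : T ≤ ((Finset.range N).filter fun s => y t < y s).card := by
    by_contra hlt
    exact htR (Finset.mem_filter.2 ⟨htN, not_le.1 hlt⟩)
  refine h1.trans (Finset.card_le_card fun s hs => ?_)
  obtain ⟨hsN, hts⟩ := Finset.mem_filter.1 hs
  by_contra hsR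
  exact (hmax s (Finset.mem_sdiff.2 ⟨hsN, hsR⟩)).not_gt hts

lemma lt_of_mem_topRanked {y : ℕ → ℝ} {T N : ℕ} {M : ℝ}
    (hS : T ≤ ((Finset.range N).filter fun s => M < y s).card) {t : ℕ}
    (ht : t ∈ topRanked y T N) : M < y t := by
  by_contra! hle
  refine (Finset.mem_filter.1 ht).2.not_ge (hS.trans (Finset.card_le_card fun s hs => ?_))
  obtain ⟨hsN, hs⟩ := Finset.mem_filter.1 hs
  exact Finset.mem_filter.2 ⟨hsN, hle.trans_lt hs⟩

end TopRanked

section Model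

variable {𝒳 𝒜 Ω : Type*} [TopologicalSpace 𝒳] [TopologicalSpace.MetrizableSpace 𝒳]
  [SecondCountableTopology 𝒳] [CompactSpace 𝒳] [Nonempty 𝒳] [MeasurableSpace 𝒳] [BorelSpace 𝒳]
  [MeasurableSpace 𝒜] [MeasurableSpace Ω] {P : Measure Ω} {f : 𝒳 → Ω → ℝ} {m : 𝒳 → ℝ}
  {k : 𝒳 → 𝒳 → ℝ}

/-- On the sample paths, the integrated function is a jointly measurable function of the query and
the path, for the product σ-algebra on paths. -/
lemma exists_measurable_integrated_eq (hc : ∀ ω, Continuous fun x => f x ω) (p : Kernel 𝒜 𝒳)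
    [IsMarkovKernel p] : ∃ G : 𝒜 × (𝒳 → ℝ) → ℝ, Measurable G ∧
      ∀ a ω, G (a, fun x => f x ω) = integrated p (fun x => f x ω) a := by
  have h1 := measurable_integrated (mΩ := MeasurableSpace.comap (fun ω x => f x ω) inferInstance)
    (fun x => (measurable_pi_apply x).comp (comap_measurable (fun ω x => f x ω))) hc p
  have h2 : Measurable[MeasurableSpace.comap (Prod.map id fun ω x => f x ω) inferInstance]
      fun y : 𝒜 × Ω => integrated p (fun x => f x y.2) y.1 := by
    refine h1.mono (le_of_eq ?_) le_rfl
    have h := MeasurableSpace.comap_prodMap (mα := ‹MeasurableSpace 𝒜›)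
      (mβ := (inferInstance : MeasurableSpace (𝒳 → ℝ))) id fun ω x => f x ω
    rw [MeasurableSpace.comap_id] at h
    exact h.symm
  obtain ⟨G, hG, hGeq⟩ := h2.exists_eq_measurable_comp
  exact ⟨G, hG, fun a ω => (congrFun hGeq (a, ω)).symm⟩

lemma indepFun_pathMax {F : Type*} [MeasurableSpace F] {y : Ω → F}
    (hc : ∀ ω, Continuous fun x => f x ω) (hind : IndepFun (fun ω x => f x ω) y P) :
    IndepFun (pathMax f) y P := by
  rw [IndepFun_iff_Indep] at hind ⊢
  refine indep_of_indep_of_le_left hind ?_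
  have h1 := measurable_pathMax (mΩ := MeasurableSpace.comap (fun ω x => f x ω) inferInstance)
    (fun x => (measurable_pi_apply x).comp (comap_measurable (fun ω x => f x ω))) hc
  exact measurable_iff_comap_le.1 h1

end Model

end CMES

theorem theorem1 {d : ℕ} (X : Set (EuclideanSpace ℝ (Fin d))) (hX : IsCompact X)
    (hXne : X.Nonempty)
    {𝒜 : Type*} [MeasurableSpace 𝒜] (p : Kernel 𝒜 X) [IsMarkovKernel p]
    {Ω : Type*} [MeasurableSpace Ω] (P : Measure Ω) [IsProbabilityMeasure P]
    -- the unknown function, its prior, and the nondegeneracy that makes `γ` well defined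
    (f : X → Ω → ℝ) (m : X → ℝ) (k : X → X → ℝ) (hf : CMES.IsContinuousGP f m k P)
    (hk : ∀ x x', k x x' ≤ 1) (hq : ∀ a, 0 < CMES.integratedCov p k a a)
    -- the observation noise, i.i.d. `N(0, σ²)`
    (σ : ℝ) (hσ : 0 < σ) (ε : ℕ → Ω → ℝ) (hεm : ∀ t, Measurable (ε t))
    (hε : ∀ t, P.map (ε t) = gaussianReal 0 (Real.toNNReal (σ ^ 2))) (hεi : iIndepFun ε P)
    -- the samples `f_*^t`, i.i.d. from the law of the maximum of the Gaussian process
    (fs : ℕ → Ω → ℝ) (hfsm : ∀ t, Measurable (fs t))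
    (hfs : ∀ t, P.map (fs t) = P.map (CMES.pathMax f)) (hfsi : iIndepFun fs P)
    -- `f`, the noise and the samples are independent
    (hind : IndepFun (fun ω x => f x ω) (fun ω => (fun t => ε t ω, fun t => fs t ω)) P)
    (hind' : IndepFun (fun ω t => ε t ω) (fun ω t => fs t ω) P)
    -- queries `a` and feedbacks `z`; the query is computed from the past feedbacks and the samples
    (a : ℕ → Ω → 𝒜) (z : ℕ → Ω → ℝ)
    (hz : ∀ t ω, z t ω = CMES.integrated p (fun x => f x ω) (a t ω) + ε t ω)
    (policy : (t : ℕ) → (Fin t → ℝ) × (Fin (t + 1) → ℝ) → 𝒜) (hpol : ∀ t, Measurable (policy t))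
    (ha : ∀ t ω, a t ω = policy t (fun i => z i ω, fun i => fs i ω))
    -- every query maximizes the single-sample criterion
    (hmax : ∀ᵐ ω ∂P, ∀ t : ℕ, ∀ b : 𝒜,
      CMES.criterion (CMES.gammaScore (CMES.integrated p m) (CMES.integratedCov p k) σ
          (fun i : Fin t => a i ω) (fun i : Fin t => z i ω) (fs t ω) b) ≤
        CMES.criterion (CMES.gammaScore (CMES.integrated p m) (CMES.integratedCov p k) σ
          (fun i : Fin t => a i ω) (fun i : Fin t => z i ω) (fs t ω) (a t ω)))
    (δ : ℝ) (hδ0 : 0 < δ) (hδ1 : δ < 1) (w : ℝ) (hw0 : 0 < w) (hw1 : w < 1)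
    (T : ℕ) (hT : 1 ≤ T) (π : ℕ → ℝ) (hπ : ∀ i ∈ Finset.Icc 1 T, 0 < π i)
    (hπsum : ∑ i ∈ Finset.Icc 1 T, (π i)⁻¹ ≤ 1) :
    -- the event that `F(f_*) ≤ w` and the bound fails after `T'` iterations has probability `≤ δ`
    P {ω | cdf (P.map (CMES.pathMax f)) (CMES.pathMax f ω) ≤ w ∧
      ¬ ∃ s < CMES.numIterations w δ π T,
        -- `s` maximizes `κ` among the iterations whose sample exceeds `f_*`
        (CMES.pathMax f ω < fs s ω ∧
          ∀ t < CMES.numIterations w δ π T, CMES.pathMax f ω < fs t ω →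
            CMES.kappa (CMES.integrated p m) (CMES.integratedCov p k) σ
                (fun i => a i ω) (fun i => z i ω) (fs t ω) t ≤
              CMES.kappa (CMES.integrated p m) (CMES.integratedCov p k) σ
                (fun i => a i ω) (fun i => z i ω) (fs s ω) s) ∧
        CMES.instantRegret p (fun x => f x ω) (fun i => a i ω) (CMES.numIterations w δ π T) ≤
          Real.sqrt (2 / Real.log (1 + (σ ^ 2)⁻¹) * (CMES.maxInfoGain P p f ε T).toReal / T) *
            (CMES.kappa (CMES.integrated p m) (CMES.integratedCov p k) σ
                (fun i => a i ω) (fun i => z i ω) (fs s ω) s +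
              Real.sqrt (2 * Real.log (π T / δ)))} ≤ ENNReal.ofReal δ := by

  have : CompactSpace X := isCompact_iff_compactSpace.1 hX
  have : Nonempty X := hXne.to_subtype
  obtain ⟨G, hG, hGeq⟩ := CMES.exists_measurable_integrated_eq hf.continuous_path p
  set ν := CMES.integrated p m with hν
  set q := CMES.integratedCov p k with hqdef
  set N := CMES.numIterations w δ π T with hN
  set ρ := CMES.maxInfoGain P p f ε T with hρdef
  set M := CMES.pathMax f with hMdef
  set ζ := Real.sqrt (2 * Real.log (π T / δ)) with hζdef
  set s := Real.sqrt (2 / Real.log (1 + (σ ^ 2)⁻¹) * ρ.toReal / T) with hs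
  set x : Ω → X → ℝ := fun ω x => f x ω with hx
  set y : Ω → ℕ → ℝ := fun ω t => fs t ω with hy
  have hxm : Measurable x := measurable_pi_lambda _ hf.measurable
  have hym : Measurable y := measurable_pi_lambda _ hfsm
  have hεm' : Measurable fun ω t => ε t ω := measurable_pi_lambda _ hεm
  have hMm : Measurable M := CMES.measurable_pathMax hf.measurable hf.continuous_path
  have hxε : IndepFun x (fun ω t => ε t ω) P :=
    hind.comp (φ := id) (ψ := Prod.fst) measurable_id measurable_fst
  have hxy : IndepFun x y P :=
    hind.comp (φ := id) (ψ := Prod.snd) measurable_id measurable_snd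
  have hxyε : IndepFun (fun ω => (x ω, y ω)) (fun ω t => ε t ω) P :=
    ((CMES.indepFun_prodMk_of_indepFun_prodMk hεm' hym hxm hind' hind.symm).comp
      (φ := id) (ψ := Prod.swap) measurable_id measurable_swap).symm
  have hmodel : CMES.NoisyModel x G ν q σ ε P :=
    { measurable_path := hxm
      measurable_value := hG
      gaussian := by
        simp only [hx, hGeq]
        exact hf.isGaussianProcess_integrated hk p
      mean := fun a => by
        simp only [hx, hGeq]
        exact hf.integral_integrated hk p a
      cov := fun a b => by
        simp only [hx, hGeq]
        exact hf.covariance_integrated hk p a b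
      noise_pos := hσ
      measurable_noise := hεm
      law_noise := hε
      iIndep_noise := hεi
      indep := hxε }
  have hq1 : ∀ a, q a a ≤ 1 := fun a => hf.integratedCov_le_one hk p a a
  -- the policy, with all samples as side information
  set α : (n : ℕ) → (Fin n → ℝ) × (ℕ → ℝ) → 𝒜 := fun n t =>
    policy n (t.1, fun i : Fin (n + 1) => t.2 i) with hα
  have hαm : ∀ n, Measurable (α n) := fun n => (hpol n).comp (by fun_prop)
  have haα : ∀ t ω, α t (fun i : Fin t => z i ω, y ω) = a t ω := fun t ω => (ha t ω).symm
  have hzα : ∀ n ω, z n ω = G (α n (fun i : Fin n => z i ω, y ω), x ω) + ε n ω := by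
    intro n ω
    rw [haα, hz, hGeq]
  have hpq : ∀ n ω, CMES.policyQueries α (fun i : Fin n => z i ω, y ω)
      = fun i : Fin n => a i ω := fun n ω => funext fun i => haα i ω
  -- finiteness of the maximum information gain
  have hmi : ∀ B : ℕ → 𝒜,
      CMES.mutualInfo P (fun ω (i : Fin T) => G (B i, x ω) + ε i ω) x ≤ ρ := by
    intro B
    simp only [hx, hGeq]
    exact le_iSup (fun A : Fin T → 𝒜 => CMES.mutualInfo P
      (fun ω (i : Fin T) => CMES.integrated p (fun x => f x ω) (A i) + ε i ω)
      (fun ω x => f x ω)) fun i => B i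
  have hρ : ρ ≠ ∞ := by
    refine ne_top_of_le_ne_top (ENNReal.ofReal_ne_top
      (r := T * (Real.log (1 + (σ ^ 2)⁻¹) / 2))) (iSup_le fun A => ?_)
    have h1 := hmodel.mutualInfo_le hq hq1
      (fun i => if hi : i < T then A ⟨i, hi⟩ else A ⟨0, hT⟩) T
    simp only [Fin.is_lt, dif_pos, Fin.eta, hx, hGeq] at h1
    exact h1
  -- the failure of the confidence bound at the first top-ranked query with small variance
  set D : (n : ℕ) → Set ((Fin n → ℝ) × (ℕ → ℝ)) := fun n =>
    {t | n ∈ CMES.topRanked t.2 T N ∧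
      CMES.postStd q σ (CMES.policyQueries α t) (α n t) ≤ s} with hD
  have hDm : ∀ n, MeasurableSet (D n) := fun n =>
    (measurable_snd (CMES.measurableSet_mem_topRanked T N n)).inter
      (measurableSet_le (CMES.measurable_postStd hmodel.measurable_cov
        (CMES.measurable_policyQueries hαm) (hαm n)) measurable_const)
  have hζ0 : 0 ≤ ζ := Real.sqrt_nonneg _
  have hbad2 := hmodel.measure_first_below_confidence_le hq hym hxy hxyε hαm hzα hζ0 hDm N
  simp only [haα, hpq] at hbad2
  have hbad1 := CMES.measure_card_exceeding_lt_le hMm hfsm hfs hfsi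
    (CMES.indepFun_pathMax hf.continuous_path hxy) (w := w)
    (fun i => ⌈Real.logb w (δ / (2 * π i))⌉₊) T
  have hTmem : T ∈ Finset.Icc 1 T := Finset.mem_Icc.2 ⟨hT, le_rfl⟩
  have hπT : 1 ≤ π T := by
    have h1 := (Finset.single_le_sum (f := fun i => (π i)⁻¹)
      (fun i hi => (inv_pos.2 (hπ i hi)).le) hTmem).trans hπsum
    exact (inv_le_one₀ (hπ T hTmem)).1 h1
  have htail : Real.exp (-ζ ^ 2 / 2) / 2 ≤ δ / 2 := by
    have h1 : 1 ≤ π T / δ := by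
      rw [le_div_iff₀ hδ0]
      linarith
    have h2 : -ζ ^ 2 / 2 = Real.log (δ / π T) := by
      rw [hζdef, Real.sq_sqrt (mul_nonneg zero_le_two (Real.log_nonneg h1)),
        ← inv_div (π T) δ, Real.log_inv]
      ring
    rw [h2, Real.exp_log (by positivity)]
    gcongr
    exact div_le_self hδ0.le hπT
  have hblocks : ∑ i ∈ Finset.Icc 1 T, ENNReal.ofReal w ^ ⌈Real.logb w (δ / (2 * π i))⌉₊
      ≤ ENNReal.ofReal (δ / 2) := by
    simp only [← ENNReal.ofReal_pow hw0.le]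
    rw [← ENNReal.ofReal_sum_of_nonneg fun i _ => by positivity]
    refine ENNReal.ofReal_le_ofReal ?_
    calc ∑ i ∈ Finset.Icc 1 T, w ^ ⌈Real.logb w (δ / (2 * π i))⌉₊
        ≤ ∑ i ∈ Finset.Icc 1 T, δ / 2 * (π i)⁻¹ := by
          refine Finset.sum_le_sum fun i hi => ?_
          have hπi := hπ i hi
          have h1 := Real.rpow_le_rpow_of_exponent_ge hw0 hw1.le
            (Nat.le_ceil (Real.logb w (δ / (2 * π i))))
          rw [Real.rpow_natCast, Real.rpow_logb hw0 hw1.ne (by positivity)] at h1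
          refine h1.trans_eq ?_
          field_simp
      _ ≤ δ / 2 * 1 := by
          rw [← Finset.mul_sum]
          gcongr
      _ = δ / 2 := mul_one _
  refine (measure_mono_ae (t := _ ∪ _) ?_).trans ((measure_union_le _ _).trans
    ((add_le_add (hbad1.trans hblocks)
      (hbad2.trans (ENNReal.ofReal_le_ofReal htail))).trans_eq ?_))
  swap
  · rw [← ENNReal.ofReal_add (by positivity) (by positivity), add_halves]
  filter_upwards [hmax] with ω hω
  rintro ⟨hFw, hfail⟩
  by_contra hgood
  obtain ⟨hgood1, hgood2⟩ := not_or.1 hgood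
  have hcard : T ≤ ((Finset.range N).filter fun t => M ω < y ω t).card := by
    by_contra hlt
    exact hgood1 ⟨hFw, not_le.1 hlt⟩
  have hTN : T ≤ N := hcard.trans ((Finset.card_filter_le _ _).trans_eq (Finset.card_range N))
  have hDω : ∀ t, ((fun i : Fin t => z i ω, y ω) ∈ D t ↔ t ∈ CMES.topRanked (y ω) T N ∧
      CMES.postStd q σ (fun i : Fin t => a i ω) (a t ω) ≤ s) := fun t => by
    simp only [hD, Set.mem_ofPred_eq, haα, hpq]
  obtain ⟨t₀, ht₀R, ht₀⟩ := hmodel.exists_postStd_le hq hq1 hT hρ hmi (fun i => a i ω)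
    (CMES.le_card_topRanked (y ω) hTN)
  have hex : ∃ t, (fun i : Fin t => z i ω, y ω) ∈ D t := ⟨t₀, (hDω t₀).2 ⟨ht₀R, ht₀⟩⟩
  set τ := Nat.find hex with hτ
  obtain ⟨hτR, hτs⟩ := (hDω τ).1 (Nat.find_spec hex)
  have hτN : τ < N := Finset.mem_range.1 (Finset.mem_filter.1 hτR).1
  have hτM : M ω < fs τ ω := CMES.lt_of_mem_topRanked hcard hτR
  have hconf : CMES.postMean ν q σ (fun i : Fin τ => a i ω) (fun i : Fin τ => z i ω) (a τ ω)
      - ζ * CMES.postStd q σ (fun i : Fin τ => a i ω) (a τ ω)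
        ≤ CMES.integrated p (fun x => f x ω) (a τ ω) := by
    by_contra! hlt
    refine hgood2 ⟨τ, hτN, Nat.find_spec hex, fun j hj => Nat.find_min hex hj, ?_⟩
    rw [hGeq]
    exact hlt
  obtain ⟨r, hr, hrmax⟩ := Finset.exists_max_image
    ((Finset.range N).filter fun t => M ω < y ω t)
    (fun t => CMES.kappa ν q σ (fun i => a i ω) (fun i => z i ω) (fs t ω) t)
    (Finset.card_pos.1 (hT.trans hcard))
  obtain ⟨hrN, hrM⟩ := Finset.mem_filter.1 hr
  refine hfail ⟨r, Finset.mem_range.1 hrN, ⟨hrM, fun t htN htM =>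
    hrmax t (Finset.mem_filter.2 ⟨Finset.mem_range.2 htN, htM⟩)⟩, ?_⟩
  have hκr := hrmax τ (Finset.mem_filter.2 ⟨Finset.mem_range.2 hτN, hτM⟩)
  -- the query minimizes the score, because the criterion is decreasing
  have hκ : CMES.kappa ν q σ (fun i => a i ω) (fun i => z i ω) (fs τ ω) τ
      = CMES.gammaScore ν q σ (fun i : Fin τ => a i ω) (fun i : Fin τ => z i ω) (fs τ ω)
        (a τ ω) := by
    have hmin : ∀ b, CMES.gammaScore ν q σ (fun i : Fin τ => a i ω) (fun i : Fin τ => z i ω)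
        (fs τ ω) (a τ ω) ≤ CMES.gammaScore ν q σ (fun i : Fin τ => a i ω)
          (fun i : Fin τ => z i ω) (fs τ ω) b := fun b =>
      CMES.strictAnti_criterion.le_iff_ge.1 (hω τ b)
    have : Nonempty 𝒜 := ⟨a τ ω⟩
    exact le_antisymm (ciInf_le ⟨_, by rintro _ ⟨b, rfl⟩; exact hmin b⟩ (a τ ω)) (le_ciInf hmin)
  set sd := CMES.postStd q σ (fun i : Fin τ => a i ω) (a τ ω) with hsd
  set pm := CMES.postMean ν q σ (fun i : Fin τ => a i ω) (fun i : Fin τ => z i ω) (a τ ω) with hpm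
  set g := CMES.integrated p (fun x => f x ω) (a τ ω) with hg
  have hsd0 : 0 < sd := Real.sqrt_pos.2 (CMES.postCov_pos hmodel.isCovKernel hσ _ (hq _))
  have hgM : g ≤ M ω := CMES.integrated_le_iSup p (hf.continuous_path ω) (a τ ω)
  have hscore : (CMES.kappa ν q σ (fun i => a i ω) (fun i => z i ω) (fs τ ω) τ + ζ) * sd
      = fs τ ω - pm + ζ * sd := by
    rw [hκ, CMES.gammaScore, add_mul, div_mul_cancel₀ _ hsd0.ne']
  have hκ0 : 0 ≤ CMES.kappa ν q σ (fun i => a i ω) (fun i => z i ω) (fs τ ω) τ + ζ := by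
    refine nonneg_of_mul_nonneg_left ?_ hsd0
    rw [hscore]
    linarith
  have hsup : g ≤ ⨆ t : Fin N, CMES.integrated p (fun x => f x ω) (a t ω) :=
    le_ciSup (f := fun t : Fin N => CMES.integrated p (fun x => f x ω) (a t ω))
      (Set.finite_range _).bddAbove ⟨τ, hτN⟩
  calc CMES.instantRegret p (fun x => f x ω) (fun i => a i ω) N
      ≤ M ω - g := sub_le_sub_left hsup _
    _ ≤ (CMES.kappa ν q σ (fun i => a i ω) (fun i => z i ω) (fs τ ω) τ + ζ) * sd := by
        rw [hscore]
        linarith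
    _ ≤ (CMES.kappa ν q σ (fun i => a i ω) (fun i => z i ω) (fs τ ω) τ + ζ) * s :=
        mul_le_mul_of_nonneg_left hτs hκ0
    _ ≤ (CMES.kappa ν q σ (fun i => a i ω) (fun i => z i ω) (fs r ω) r + ζ) * s :=
        mul_le_mul_of_nonneg_right (by linarith) (Real.sqrt_nonneg _)
    _ = _ := mul_comm _ _
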